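/- Let $I=[a,b]\subset\mathbb{R}$ with $a<b$, and let $\gamma\colon I\to\mathbb{R}^3$ be a smooth non-degenerate curve: for some $c_0>0$, $|\det(\gamma^{(1)}(s),\gamma^{(2)}(s),\gamma^{(3)}(s))|\ge c_0$ for all $s\in I$. Let $(\mathbf e_1,\mathbf e_2,\mathbf e_3)(s)$ be its Frenet frame, obtained by applying Gram--Schmidt to $\gamma^{(1)}(s),\gamma^{(2)}(s),\gamma^{(3)}(s)$. For $0<r<1$ and $s\in I$ the $(0,r)$-Frenet box is $$\pi_0(s;r)=\{\xi\in\mathbb{R}^3: |\langle \mathbf e_1(s),\xi\rangle|\le r,\ \tfrac12\le|\langle \mathbf e_2(s),\xi\rangle|\le 2,\ |\langle \mathbf e_3(s),\xi\rangle|\le 1\},$$ and a $(0,r)$-Frenet box decomposition $\mathcal P_0(r)$ along $\gamma$ is the family of boxes $\pi_0(s;r)$ with $s$ varying over a subset of $I$ whose distinct points are at distance at least $r$. Fix a non-negative $\eta\in C_c^\infty(\mathbb{R})$ with $\eta=1$ on $[-1,1]$ and $\operatorname{supp}\eta\subseteq[-2,2]$, let $\tilde\beta(u)=\eta(u/2)-\eta(4u)$,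 and for $\pi=\pi_0(s;r)$ let $$\chi_\pi(\xi)=\eta(r^{-1}\langle \mathbf e_1(s),\xi\rangle)\,\tilde\beta(\langle \mathbf e_2(s),\xi\rangle)\,\eta(\langle \mathbf e_3(s),\xi\rangle),\qquad \chi_\pi(D)f(x)=(2\pi)^{-3}\int_{\mathbb{R}^3} e^{i\langle x,\xi\rangle}\chi_\pi(\xi)\widehat f(\xi)\,d\xi,$$ where $\widehat f(\xi)=\int_{\mathbb{R}^3} e^{-i\langle x,\xi\rangle}f(x)\,dx$, extended to $f\in L^2(\mathbb{R}^3)$ by Plancherel's theorem. For $\boldsymbol\rho=(\rho_1,\rho_2,\rho_3)\in(0,\infty)^3$ and measurable $g\colon\mathbb{R}^3\to[0,\infty]$ let $$\mathcal N_{\boldsymbol\rho}\,g(x)=\sup_{s\in I}\int_{\mathbb{R}^3} g(x-y)\,\rho_1\rho_2\rho_3\Big(1+\sum_{j=1}^3\rho_j|\langle \mathbf e_j(s),y\rangle|\Big)^{-300}dy .$$ Given $\varepsilon>0$, put $K=r^{-\varepsilon/8}$, $M=\max(\lfloor 8/\varepsilon\rfloor-1,0)$, $\mathbf r_*=(r,1,1)$,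 $\mathbf r_m=(K^m r,K^{-1},K^{-1})$, and let $$\widetilde{\mathcal N}^{(\varepsilon)}_{\gamma,r}=\mathcal N_{\mathbf r_M}\circ(\mathcal N_{\mathbf r_{M-1}}\circ\mathcal N_{\mathbf r_{M-1}})\circ\cdots\circ(\mathcal N_{\mathbf r_0}\circ\mathcal N_{\mathbf r_0})\circ\mathcal N_{\mathbf r_*}$$ (for $M=0$ this is $\mathcal N_{\mathbf r_0}\circ\mathcal N_{\mathbf r_*}$). Then for every $\varepsilon>0$: (1) There is a constant $C$ depending only on $\gamma$ (with its domain $I$), $\eta$ and $\varepsilon$ such that for every $0<r<1$, every $(0,r)$-Frenet box decomposition $\mathcal P_0(r)$ along $\gamma$, every $f\in L^2(\mathbb{R}^3)$ and every non-negative $w\in L^1_{\mathrm{loc}}(\mathbb{R}^3)$, $$\int_{\mathbb{R}^3}\sum_{\pi\in\mathcal P_0(r)}|\chi_\pi(D)f(x)|^2\,w(x)\,dx\le C\,r^{-\varepsilon}\int_{\mathbb{R}^3}|f(x)|^2\,\widetilde{\mathcal N}^{(\varepsilon)}_{\gamma,r}w(x)\,dx$$ (the integrals may be infinite). (2) For every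 $\varepsilon_\circ>0$ there is a constant $C$ depending only on $\gamma$ (with $I$), $\varepsilon$ and $\varepsilon_\circ$ such that for every $0<r<1$ and every measurable $g\colon\mathbb{R}^3\to[0,\infty]$, $$\|\widetilde{\mathcal N}^{(\varepsilon)}_{\gamma,r}g\|_{L^2(\mathbb{R}^3)}\le C\,r^{-\varepsilon_\circ}\|g\|_{L^2(\mathbb{R}^3)}.$$ -/

import Mathlib

open Set MeasureTheory
open scoped ENNReal ContDiff FourierTransform

noncomputable section

/-- Three-dimensional Euclidean space. -/
abbrev E3 : Type := EuclideanSpace ℝ (Fin 3)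

/-- The derivative `γ^(k)(s)` of a curve on `I` (one-sided at the endpoints of `I`). -/
def curveDeriv (γ : ℝ → E3) (I : Set ℝ) (k : ℕ) (s : ℝ) : E3 :=
  iteratedDerivWithin k γ I s

/-- `|det(γ'(s), γ''(s), γ'''(s))| ≥ c₀ > 0` for all `s ∈ I`. -/
def NonDegenerateCurve (γ : ℝ → E3) (I : Set ℝ) : Prop :=
  ∃ c₀ : ℝ, 0 < c₀ ∧ ∀ s ∈ I,
    c₀ ≤ |(Matrix.of fun i j : Fin 3 => curveDeriv γ I (j.val + 1) s i).det|

/-- The Frenet frame: Gram--Schmidt applied to `γ'(s), γ''(s), γ'''(s)`.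
The index is zero-based: `frenet γ I j` is the vector usually called `e_{j+1}`. -/
def frenet (γ : ℝ → E3) (I : Set ℝ) (j : Fin 3) (s : ℝ) : E3 :=
  InnerProductSpace.gramSchmidtNormed ℝ (fun k : Fin 3 => curveDeriv γ I (k.val + 1) s) j

/-- The `(0,r)`-Frenet box `π_{0,γ}(s;r)`. -/
def frenetBox (γ : ℝ → E3) (I : Set ℝ) (r s : ℝ) : Set E3 :=
  {ξ | |inner ℝ (frenet γ I 0 s) ξ| ≤ r ∧
    1 / 2 ≤ |inner ℝ (frenet γ I 1 s) ξ| ∧ |inner ℝ (frenet γ I 1 s) ξ| ≤ 2 ∧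
    |inner ℝ (frenet γ I 2 s) ξ| ≤ 1}

/-- A `(0,r)`-Frenet box decomposition along `γ : I → ℝ³`: the `(0,r)`-Frenet boxes
`π_{0,γ}(s;r)` for `s` varying over an `r`-separated subset of `I`. It is recorded by that
subset, i.e. as a family of boxes indexed by their base points. -/
structure FrenetBoxDecomposition (γ : ℝ → E3) (I : Set ℝ) (r : ℝ) where
  points : Set ℝ
  subset : points ⊆ I
  separated : points.Pairwise fun s t => r ≤ |s - t|

/-- The boxes of a Frenet box decomposition. -/
def FrenetBoxDecomposition.box {γ : ℝ → E3} {I : Set ℝ} {r : ℝ}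
    (P : FrenetBoxDecomposition γ I r) (s : P.points) : Set E3 :=
  frenetBox γ I r s

/-- `η ∈ C_c^∞(ℝ)` non-negative, `η = 1` on `[-1,1]`, `supp η ⊆ [-2,2]`. -/
structure IsCutoff (η : ℝ → ℝ) : Prop where
  smooth : ContDiff ℝ ∞ η
  nonneg : ∀ u, 0 ≤ η u
  eq_one : ∀ u ∈ Icc (-1 : ℝ) 1, η u = 1
  supp : tsupport η ⊆ Icc (-2) 2

/-- `η(u/2) - η(4u)`. -/
def betaTilde (η : ℝ → ℝ) (u : ℝ) : ℝ := η (2⁻¹ * u) - η (4 * u)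

/-- The smooth cutoff `χ_π` adapted to the Frenet box `π = π_{0,γ}(s;r)`. -/
def boxCutoff (γ : ℝ → E3) (I : Set ℝ) (η : ℝ → ℝ) (r s : ℝ) (ξ : E3) : ℝ :=
  η (r⁻¹ * inner ℝ (frenet γ I 0 s) ξ) * betaTilde η (inner ℝ (frenet γ I 1 s) ξ) *
    η (inner ℝ (frenet γ I 2 s) ξ)

theorem IsCutoff.eq_zero {η : ℝ → ℝ} (hη : IsCutoff η) {u : ℝ} (hu : 2 ≤ |u|) : η u = 0 := by
  by_contra h
  have hopen : IsOpen (Function.support η) :=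
    isOpen_compl_singleton.preimage hη.smooth.continuous
  have hsub : Function.support η ⊆ interior (Icc (-2 : ℝ) 2) :=
    interior_maximal ((subset_tsupport η).trans hη.supp) hopen
  have hmem := hsub (Function.mem_support.mpr h)
  rw [interior_Icc, mem_Ioo, ← abs_lt] at hmem
  exact absurd hu (not_le.mpr hmem)

/-- `χ_π = 1` on the Frenet box `π`. -/
theorem boxCutoff_eq_one {γ : ℝ → E3} {I : Set ℝ} {η : ℝ → ℝ} (hη : IsCutoff η) {r s : ℝ}
    (hr : 0 < r) {ξ : E3} (hξ : ξ ∈ frenetBox γ I r s) : boxCutoff γ I η r s ξ = 1 := by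
  obtain ⟨h1, h2, h3, h4⟩ := hξ
  have one : ∀ u : ℝ, |u| ≤ 1 → η u = 1 := fun u hu => hη.eq_one u (abs_le.mp hu)
  have e1 : η (r⁻¹ * inner ℝ (frenet γ I 0 s) ξ) = 1 := by
    apply one
    rw [abs_mul, abs_of_pos (inv_pos.mpr hr), inv_mul_le_iff₀ hr]
    simpa using h1
  have e2 : η (2⁻¹ * inner ℝ (frenet γ I 1 s) ξ) = 1 := by
    apply one
    rw [abs_mul, abs_of_pos (by norm_num : (0 : ℝ) < 2⁻¹)]
    linarith
  have e3 : η (4 * inner ℝ (frenet γ I 1 s) ξ) = 0 := by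
    apply hη.eq_zero
    rw [abs_mul, abs_of_pos (by norm_num : (0 : ℝ) < 4)]
    linarith
  simp [boxCutoff, betaTilde, e1, e2, e3, one _ h4]

/-- The cutoff `χ_π` for the box `π` of the decomposition with base point `s`. -/
def FrenetBoxDecomposition.cutoff {γ : ℝ → E3} {I : Set ℝ} {r : ℝ}
    (P : FrenetBoxDecomposition γ I r) (η : ℝ → ℝ) (s : P.points) : E3 → ℝ :=
  boxCutoff γ I η r s

theorem FrenetBoxDecomposition.cutoff_eq_one {γ : ℝ → E3} {I : Set ℝ} {r : ℝ}
    (P : FrenetBoxDecomposition γ I r) {η : ℝ → ℝ} (hη : IsCutoff η) (hr : 0 < r)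
    (s : P.points) {ξ : E3} (hξ : ξ ∈ P.box s) : P.cutoff η s ξ = 1 :=
  boxCutoff_eq_one hη hr hξ

/-- The Fourier multiplier operator
`m(D)f(x) = (2π)⁻³ ∫ e^{i⟨x,ξ⟩} m(ξ) (∫ e^{-i⟨y,ξ⟩} f(y) dy) dξ` on `L²(ℝ³)`, for `m` bounded with
compact support. Mathlib's Fourier transform has the phase `e^{-2πi⟨y,ζ⟩}`, so the frequency is
written `ξ = 2πζ`. -/
def multiplierOp (m : E3 → ℝ) (f : Lp ℂ 2 (volume : Measure E3)) : E3 → ℂ :=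
  𝓕⁻ (fun ζ : E3 => (m ((2 * Real.pi) • ζ) : ℂ) * (𝓕 f : Lp ℂ 2 (volume : Measure E3)) ζ)

/-- The weight `ψ_{T_{e,ρ}(s)}`, adapted to the parallelepiped
`T_{e,ρ}(s) = {y : |⟨e_j(s), y⟩| ≤ ρ_j⁻¹ for all j}`. -/
def plateWeight (e : Fin 3 → ℝ → E3) (ρ : Fin 3 → ℝ) (s : ℝ) (y : E3) : ℝ :=
  (∏ j, ρ j) * ((1 + ∑ j, ρ j * |inner ℝ (e j s) y|) ^ 300)⁻¹

/-- The weighted average `∫ g(x - y) ψ_{T_{e,ρ}(s)}(y) dy` of a non-negative function `g`. -/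
def nikodymAvg (e : Fin 3 → ℝ → E3) (ρ : Fin 3 → ℝ) (g : E3 → ℝ≥0∞) (x : E3) (s : ℝ) : ℝ≥0∞ :=
  ∫⁻ y, g (x - y) * ENNReal.ofReal (plateWeight e ρ s y)

/-- The Nikodym-type maximal operator `g ↦ sup_{s ∈ I} ∫ g(x - y) ψ_{T_{e,ρ}(s)}(y) dy`, for
non-negative `g`. As the weight is positive, its values on `|g|` dominate those on a signed `g`. -/
def nikodymMax (I : Set ℝ) (e : Fin 3 → ℝ → E3) (ρ : Fin 3 → ℝ) (g : E3 → ℝ≥0∞) (x : E3) : ℝ≥0∞ :=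
  ⨆ s ∈ I, nikodymAvg e ρ g x s

/-- The scales `(K^m r, K⁻¹, K⁻¹)`. -/
def nikodymScale (r K : ℝ) (m : ℕ) : Fin 3 → ℝ := ![K ^ m * r, K⁻¹, K⁻¹]

/-- The composition `N_{m-1} ∘ N_{m-1} ∘ ⋯ ∘ N_0 ∘ N_0 ∘ N_*`, where `N_i` has the scales
`(K^i r, K⁻¹, K⁻¹)` and `N_*` has the scales `(r, 1, 1)`. -/
def nikodymIter (I : Set ℝ) (e : Fin 3 → ℝ → E3) (r K : ℝ) :
    ℕ → (E3 → ℝ≥0∞) → (E3 → ℝ≥0∞)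
  | 0 => nikodymMax I e ![r, 1, 1]
  | m + 1 => nikodymMax I e (nikodymScale r K m) ∘ nikodymMax I e (nikodymScale r K m) ∘
      nikodymIter I e r K m

/-- The iterated maximal operator `Ñ_{γ,r}^{(ε)} = N_M ∘ (N_{M-1} ∘ N_{M-1}) ∘ ⋯ ∘ (N_0 ∘ N_0) ∘ N_*`
with `K = r^{-ε/8}` and `M = max(⌊8/ε⌋ - 1, 0)` (truncated subtraction is intended), built on the
Frenet frame. -/
def forwardMax (γ : ℝ → E3) (I : Set ℝ) (r ε : ℝ) : (E3 → ℝ≥0∞) → (E3 → ℝ≥0∞) :=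
  let K : ℝ := r ^ (-(ε / 8))
  let M : ℕ := ⌊8 / ε⌋₊ - 1
  nikodymMax I (frenet γ I) (nikodymScale r K M) ∘ nikodymIter I (frenet γ I) r K M

end

section

open scoped SchwartzMap LineDeriv Topology

/-! ### Square-integrable functions -/

/-! Write e_0, e_1, e_2 for the frame, zero-based as in the code.

Estimate (1) is an induction on scales with ratio K. A cone piece of width R at s is a smooth cutoff
to |⟨e_0(s),ξ⟩| ≲ R, |ξ| ≲ 1 and |⟨e_1(t₀),ξ⟩| ≳ 1, where t₀ is the left end of a short arc
containing s. A box multiplier factors through a cone piece of width about Kr at a nearby grid point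
(`exists_initial_step`), and a cone piece of width R factors through one of width about KR
(`exists_inductive_step`). For R-separated points s with |s - σ| ≤ KR, the square function of the
pieces of width R is bounded on L² with weight an average over the plate of scales (R, K⁻¹, K⁻¹) at
σ, without loss in K (`exists_sum_coneKernel_le`). Two facts give this. First, d/ds⟨e_0,ξ⟩ =
a⟨e_1,ξ⟩ stays away from 0, so the pieces overlap boundedly (`card_le_of_cone`). Second, the weight
is built from factors |1 + i⟨x - z, v⟩|⁻², and commuting such a factor past a convolution
differentiates the symbol along v (`sconv_linFactor`); the derivatives along the plate are bounded
(`norm_coneMap_le`), so the weighted estimate reduces to Plancherel.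

At each step the new weight is a maximum of plate averages of the old one, hence controlled by
`nikodymMax`, and averages are essentially constant on smaller plates
(`exists_lconv_le_lconv_lconv`), which allows the plates to be changed from scale to scale. Powers
of K are lost only at the start, K⁴, and at the end, when about K² pieces are summed trivially; K⁸ =
r^{-ε} is allowed. If M = 0 then K²r ≥ 1 and a trivial summation suffices.

Estimate (2) follows from an L² bound with logarithmic loss for a single maximal operator
(`exists_nikodymMax_le`), as the composition has 2M + 2 factors. The polynomial weight is dominated
by a geometric series of dilated Gaussians, and the supremum over s by a maximum over a dyadic net
of 2^J + 1 points with J of order log(1/r). Chaining in the manner of Rademacher and Menshov, with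
Plancherel, reduces the bound to one statement: for fixed ξ the Gaussian symbol, as a function of s,
has total variation bounded uniformly in ξ and in the scales (`exists_eVariationOn_le`). Two of the
scales coincide, so the symbol is exp(Au² + B) with u = ⟨e_0(s),ξ⟩. The Frenet equations bound the
number of monotone pieces of u, except where ⟨e_0,ξ⟩ and ⟨e_2,ξ⟩ are both comparable to |ξ|; there
the derivative of the symbol is bounded directly. -/

theorem eLpNorm_two_sq {α F : Type*} [MeasurableSpace α] [ENorm F] [TopologicalSpace F]
    (μ : Measure α) (g : α → F) :
    eLpNorm g 2 μ ^ 2 = ∫⁻ x, ‖g x‖ₑ ^ 2 ∂μ := by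
  rw [eLpNorm_eq_lintegral_rpow_enorm_toReal (by simp) (by simp)]
  simp only [ENNReal.toReal_ofNat, ENNReal.rpow_ofNat]
  rw [← ENNReal.rpow_natCast, ← ENNReal.rpow_mul]
  norm_num

theorem lintegral_mul_sq_le {α : Type*} [MeasurableSpace α] (μ : Measure α) {f g : α → ℝ≥0∞}
    (hf : AEMeasurable f μ) (hg : AEMeasurable g μ) :
    (∫⁻ x, f x * g x ∂μ) ^ 2 ≤ (∫⁻ x, f x ^ 2 ∂μ) * ∫⁻ x, g x ^ 2 ∂μ := by
  have h := ENNReal.lintegral_mul_le_Lp_mul_Lq μ Real.HolderConjugate.two_two hf hg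
  calc (∫⁻ x, f x * g x ∂μ) ^ 2
      ≤ ((∫⁻ x, f x ^ (2 : ℝ) ∂μ) ^ (1 / (2 : ℝ)) * (∫⁻ x, g x ^ (2 : ℝ) ∂μ) ^ (1 / (2 : ℝ))) ^ 2 := by
        gcongr; exact h
    _ = _ := by
        rw [mul_pow, ← ENNReal.rpow_natCast, ← ENNReal.rpow_natCast, ← ENNReal.rpow_mul,
          ← ENNReal.rpow_mul]
        norm_num

theorem MeasureTheory.MemLp.lintegral_sq_lt_top {g : E3 → ℂ} (hg : MemLp g 2 volume) :
    ∫⁻ x, ‖g x‖ₑ ^ 2 < ⊤ := by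
  rw [← eLpNorm_two_sq]
  exact ENNReal.pow_lt_top hg.2

/-- Schwartz functions are dense in `L²`. -/
theorem exists_schwartz_seq {g : E3 → ℂ} (hg : MemLp g 2 volume) :
    ∃ u : ℕ → 𝓢(E3, ℂ), Filter.Tendsto (fun n => ∫⁻ x, ‖g x - u n x‖ₑ ^ 2) Filter.atTop (𝓝 0) := by
  have hd := SchwartzMap.denseRange_toLpCLM (E := E3) (F := ℂ) (p := 2) (μ := volume)
    ENNReal.ofNat_ne_top
  have h1 : ∀ n : ℕ, ∃ u : 𝓢(E3, ℂ), eLpNorm (fun x => g x - u x) 2 volume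
      ≤ ENNReal.ofReal (1 / (n + 1)) := by
    intro n
    have hn : (0 : ℝ) < 1 / (n + 1) := by positivity
    obtain ⟨u, hu⟩ := hd.exists_dist_lt (hg.toLp g) hn
    rw [SchwartzMap.toLpCLM_apply] at hu
    refine ⟨u, ?_⟩
    have : (fun x => g x - u x) =ᵐ[volume]
        ((hg.toLp g - u.toLp 2 volume : Lp ℂ 2 (volume : Measure E3)) : E3 → ℂ) := by
      filter_upwards [hg.coeFn_toLp, u.coeFn_toLp 2 volume,
        Lp.coeFn_sub (hg.toLp g) (u.toLp 2 volume)] with x h1 h2 h3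
      rw [h3, Pi.sub_apply, h1, h2]
    rw [eLpNorm_congr_ae this, ← Lp.enorm_def, ← ofReal_norm]
    apply ENNReal.ofReal_le_ofReal
    rw [dist_eq_norm] at hu
    exact hu.le
  choose u hu using h1
  refine ⟨u, ?_⟩
  have h2 : Filter.Tendsto (fun n : ℕ => ENNReal.ofReal (1 / ((n : ℝ) + 1)) ^ 2) Filter.atTop
      (𝓝 0) := by
    have h3 := ENNReal.tendsto_ofReal (tendsto_one_div_add_atTop_nhds_zero_nat (𝕜 := ℝ))
    have h4 := ((ENNReal.continuous_pow 2).tendsto _).comp h3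
    simpa [Function.comp_def] using h4
  refine tendsto_of_tendsto_of_tendsto_of_le_of_le tendsto_const_nhds h2 (fun _ => zero_le) ?_
  intro n
  simp only
  rw [← eLpNorm_two_sq volume (fun x => g x - u n x)]
  exact pow_le_pow_left₀ (zero_le) (hu n) 2

theorem SchwartzMap.lintegral_sq_fourier (f : 𝓢(E3, ℂ)) :
    ∫⁻ ξ, ‖(𝓕 f : 𝓢(E3, ℂ)) ξ‖ₑ ^ 2 = ∫⁻ x, ‖f x‖ₑ ^ 2 := by
  rw [← eLpNorm_two_sq, ← eLpNorm_two_sq]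
  have h := SchwartzMap.norm_fourier_toL2_eq f
  rw [SchwartzMap.norm_toLp, SchwartzMap.norm_toLp] at h
  rw [(ENNReal.toReal_eq_toReal_iff' (SchwartzMap.eLpNorm_lt_top _ _ _).ne
    (SchwartzMap.eLpNorm_lt_top _ _ _).ne).1 h]

/-! ### Convolution with a Schwartz kernel -/

/-- The convolution of a Schwartz kernel with a function. -/
noncomputable def sconv (k : 𝓢(E3, ℂ)) (g : E3 → ℂ) (x : E3) : ℂ := ∫ y, k (x - y) * g y

theorem SchwartzMap.memLp_comp_sub (k : 𝓢(E3, ℂ)) (x : E3) :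
    MemLp (fun y => k (x - y)) 2 volume :=
  (k.memLp 2 volume).comp_measurePreserving (Measure.measurePreserving_sub_left volume x)

theorem sconv_integrable (k : 𝓢(E3, ℂ)) {g : E3 → ℂ} (hg : MemLp g 2 volume) (x : E3) :
    Integrable (fun y => k (x - y) * g y) :=
  (k.memLp_comp_sub x).integrable_mul hg

theorem sconv_sub (k : 𝓢(E3, ℂ)) {g h : E3 → ℂ} (hg : MemLp g 2 volume) (hh : MemLp h 2 volume)
    (x : E3) : sconv k (fun y => g y - h y) x = sconv k g x - sconv k h x := by
  simp only [sconv, mul_sub]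
  exact integral_sub (sconv_integrable k hg x) (sconv_integrable k hh x)

theorem enorm_sconv_sq_le (k : 𝓢(E3, ℂ)) {g : E3 → ℂ} (hg : MemLp g 2 volume) (x : E3) :
    ‖sconv k g x‖ₑ ^ 2 ≤ (∫⁻ y, ‖k y‖ₑ ^ 2) * ∫⁻ y, ‖g y‖ₑ ^ 2 := by
  have h1 : ‖sconv k g x‖ₑ ≤ ∫⁻ y, ‖k (x - y)‖ₑ * ‖g y‖ₑ := by
    refine (enorm_integral_le_lintegral_enorm _).trans_eq ?_
    simp [enorm_mul]
  calc ‖sconv k g x‖ₑ ^ 2 ≤ (∫⁻ y, ‖k (x - y)‖ₑ * ‖g y‖ₑ) ^ 2 := by gcongr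
    _ ≤ (∫⁻ y, ‖k (x - y)‖ₑ ^ 2) * ∫⁻ y, ‖g y‖ₑ ^ 2 :=
        lintegral_mul_sq_le _ (k.memLp_comp_sub x).1.enorm hg.1.enorm
    _ = _ := by
        rw [lintegral_sub_left_eq_self (fun y => ‖k y‖ₑ ^ 2) x]

/-- By Cauchy–Schwarz the value of k * g at each point is continuous in g ∈ L². Facts about Schwartz
g thus extend to L² at every point, with no exceptional null set. -/
theorem tendsto_sconv (k : 𝓢(E3, ℂ)) {g : E3 → ℂ} (hg : MemLp g 2 volume) {u : ℕ → E3 → ℂ}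
    (hu : ∀ n, MemLp (u n) 2 volume)
    (h : Filter.Tendsto (fun n => ∫⁻ x, ‖g x - u n x‖ₑ ^ 2) Filter.atTop (𝓝 0)) (x : E3) :
    Filter.Tendsto (fun n => sconv k (u n) x) Filter.atTop (𝓝 (sconv k g x)) := by
  have hk : ∫⁻ y, ‖k y‖ₑ ^ 2 ≠ ⊤ := ((k.memLp 2 volume).lintegral_sq_lt_top).ne
  have h1 : Filter.Tendsto (fun n => ‖sconv k g x - sconv k (u n) x‖ₑ ^ 2) Filter.atTop (𝓝 0) := by
    have h2 := ENNReal.Tendsto.const_mul h (Or.inr hk)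
    rw [mul_zero] at h2
    refine tendsto_of_tendsto_of_tendsto_of_le_of_le tendsto_const_nhds h2 (fun _ => zero_le) ?_
    intro n
    simp only
    rw [← sconv_sub k hg (hu n)]
    exact enorm_sconv_sq_le k (hg.sub (hu n)) x
  rw [tendsto_iff_edist_tendsto_0]
  have h3 := ((ENNReal.continuous_rpow_const (y := (1 / 2 : ℝ))).tendsto _).comp h1
  simp only [Function.comp_def] at h3
  have h4 : ∀ a : ℝ≥0∞, (a ^ 2) ^ (1 / 2 : ℝ) = a := fun a => by
    rw [← ENNReal.rpow_natCast, ← ENNReal.rpow_mul]; norm_num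
  simp only [h4] at h3
  simp only [edist_comm _ (sconv k g x), edist_eq_enorm_sub]
  simpa using h3

theorem sconv_schwartz (k f : 𝓢(E3, ℂ)) (x : E3) :
    sconv k f x = SchwartzMap.convolution (ContinuousLinearMap.mul ℂ ℂ) k f x := by
  rw [SchwartzMap.convolution_apply, convolution_def, sconv]
  rw [← integral_sub_left_eq_self _ volume x]
  simp

theorem fourier_sconv (k f : 𝓢(E3, ℂ)) (ξ : E3) :
    (𝓕 (SchwartzMap.convolution (ContinuousLinearMap.mul ℂ ℂ) k f) : 𝓢(E3, ℂ)) ξ =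
      (𝓕 k : 𝓢(E3, ℂ)) ξ * (𝓕 f : 𝓢(E3, ℂ)) ξ := by
  rw [SchwartzMap.fourier_convolution]
  simp

theorem sconv_continuous_of_schwartz (k f : 𝓢(E3, ℂ)) : Continuous (sconv k f) := by
  rw [funext (sconv_schwartz k f)]
  exact SchwartzMap.continuous _

theorem sconv_stronglyMeasurable (k : 𝓢(E3, ℂ)) {g : E3 → ℂ} (hg : MemLp g 2 volume) :
    StronglyMeasurable (sconv k g) := by
  obtain ⟨u, hu⟩ := exists_schwartz_seq hg
  refine stronglyMeasurable_of_tendsto (u := Filter.atTop)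
    (fun n => (sconv_continuous_of_schwartz k (u n)).stronglyMeasurable) ?_
  rw [tendsto_pi_nhds]
  exact fun x => tendsto_sconv k hg (fun n => (u n).memLp 2 volume) hu x

theorem sum_lintegral_sconv_schwartz_le {ι : Type*} (s : Finset ι) (k : ι → 𝓢(E3, ℂ)) {B : ℝ≥0∞}
    (hB : ∀ ξ, ∑ i ∈ s, ‖(𝓕 (k i) : 𝓢(E3, ℂ)) ξ‖ₑ ^ 2 ≤ B) (f : 𝓢(E3, ℂ)) :
    ∑ i ∈ s, ∫⁻ x, ‖sconv (k i) f x‖ₑ ^ 2 ≤ B * ∫⁻ x, ‖f x‖ₑ ^ 2 := by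
  have h1 : ∀ i, ∫⁻ x, ‖sconv (k i) f x‖ₑ ^ 2 =
      ∫⁻ ξ, ‖(𝓕 (k i) : 𝓢(E3, ℂ)) ξ‖ₑ ^ 2 * ‖(𝓕 f : 𝓢(E3, ℂ)) ξ‖ₑ ^ 2 := by
    intro i
    simp only [sconv_schwartz]
    rw [← SchwartzMap.lintegral_sq_fourier]
    simp only [fourier_sconv, enorm_mul, mul_pow]
  simp only [h1]
  rw [← lintegral_finsetSum]
  · rw [← SchwartzMap.lintegral_sq_fourier f, ← lintegral_const_mul]
    · refine lintegral_mono fun ξ => ?_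
      simp only
      rw [← Finset.sum_mul]
      gcongr
      exact hB ξ
    · have := SchwartzMap.continuous (𝓕 f : 𝓢(E3, ℂ))
      fun_prop
  · intro i _
    have := SchwartzMap.continuous (𝓕 f : 𝓢(E3, ℂ))
    have := SchwartzMap.continuous (𝓕 (k i) : 𝓢(E3, ℂ))
    fun_prop

theorem tendsto_lintegral_sq {g : E3 → ℂ} (hg : MemLp g 2 volume) {u : ℕ → E3 → ℂ}
    (hu : ∀ n, MemLp (u n) 2 volume)
    (h : Filter.Tendsto (fun n => ∫⁻ x, ‖g x - u n x‖ₑ ^ 2) Filter.atTop (𝓝 0)) :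
    Filter.Tendsto (fun n => ∫⁻ x, ‖u n x‖ₑ ^ 2) Filter.atTop (𝓝 (∫⁻ x, ‖g x‖ₑ ^ 2)) := by
  have h4 : ∀ a : ℝ≥0∞, (a ^ 2) ^ (1 / 2 : ℝ) = a := fun a => by
    rw [← ENNReal.rpow_natCast, ← ENNReal.rpow_mul]; norm_num
  have h3 := ((ENNReal.continuous_rpow_const (y := (1 / 2 : ℝ))).tendsto _).comp h
  have e1 : ∀ n, ∫⁻ x, ‖g x - u n x‖ₑ ^ 2 = eLpNorm (g - u n) 2 volume ^ 2 := fun n => by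
    rw [eLpNorm_two_sq]; rfl
  simp only [Function.comp_def, e1, h4] at h3
  norm_num at h3
  simp only [← eLpNorm_two_sq]
  refine ((ENNReal.continuous_pow 2).tendsto _).comp ?_
  have hg' : eLpNorm g 2 volume ≠ ⊤ := hg.2.ne
  refine tendsto_of_tendsto_of_tendsto_of_le_of_le
    (g := fun n => eLpNorm g 2 volume - eLpNorm (g - u n) 2 volume)
    (h := fun n => eLpNorm g 2 volume + eLpNorm (g - u n) 2 volume) ?_ ?_ ?_ ?_
  · have := ENNReal.Tendsto.sub (tendsto_const_nhds (x := eLpNorm g 2 volume) (f := Filter.atTop (α := ℕ)))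
      h3 (Or.inl hg')
    simpa using this
  · have := (tendsto_const_nhds (x := eLpNorm g 2 volume) (f := Filter.atTop (α := ℕ))).add h3
    simpa using this
  · intro n
    simp only
    rw [tsub_le_iff_right]
    calc eLpNorm g 2 volume = eLpNorm (u n + (g - u n)) 2 volume := by congr 1; ext x; simp
      _ ≤ _ := eLpNorm_add_le (hu n).1 (hg.1.sub (hu n).1) (by norm_num)
  · intro n
    calc eLpNorm (u n) 2 volume = eLpNorm (g - (g - u n)) 2 volume := by congr 1; ext x; simp
      _ ≤ _ := eLpNorm_sub_le hg.1 (hg.1.sub (hu n).1) (by norm_num)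

/-- A finite family of Fourier multipliers with bounded square function is bounded on `L²`. -/
theorem sum_lintegral_sconv_le {ι : Type*} (s : Finset ι) (k : ι → 𝓢(E3, ℂ)) {B : ℝ≥0∞}
    (hBt : B ≠ ⊤)
    (hB : ∀ ξ, ∑ i ∈ s, ‖(𝓕 (k i) : 𝓢(E3, ℂ)) ξ‖ₑ ^ 2 ≤ B) {g : E3 → ℂ} (hg : MemLp g 2 volume) :
    ∑ i ∈ s, ∫⁻ x, ‖sconv (k i) g x‖ₑ ^ 2 ≤ B * ∫⁻ x, ‖g x‖ₑ ^ 2 := by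
  obtain ⟨u, hu⟩ := exists_schwartz_seq hg
  have hm : ∀ n, MemLp (u n) 2 volume := fun n => (u n).memLp 2 volume
  have hmeas : ∀ i n, Measurable fun x => ‖sconv (k i) (u n) x‖ₑ ^ 2 := fun i n => by
    have := sconv_continuous_of_schwartz (k i) (u n)
    fun_prop
  rw [← lintegral_finsetSum' _ (fun i _ =>
    ((sconv_stronglyMeasurable (k i) hg).enorm.pow_const 2).aemeasurable)]
  have h1 : ∀ x, ∑ i ∈ s, ‖sconv (k i) g x‖ₑ ^ 2 =
      Filter.liminf (fun n => ∑ i ∈ s, ‖sconv (k i) (u n) x‖ₑ ^ 2) Filter.atTop := by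
    intro x
    refine (Filter.Tendsto.liminf_eq ?_).symm
    refine tendsto_finsetSum _ fun i _ => ?_
    exact ((ENNReal.continuous_pow 2).tendsto _).comp
      ((continuous_enorm.tendsto _).comp (tendsto_sconv (k i) hg hm hu x))
  simp only [h1]
  -- Fatou's lemma: the convolutions converge pointwise along a Schwartz sequence.
  refine (lintegral_liminf_le fun n => Finset.measurable_fun_sum s fun i _ => hmeas i n).trans ?_
  have h2 := ENNReal.Tendsto.const_mul (tendsto_lintegral_sq hg hm hu) (Or.inr hBt)
  rw [← h2.liminf_eq]
  refine Filter.liminf_le_liminf (Filter.Eventually.of_forall fun n => ?_)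
  rw [lintegral_finsetSum _ fun i _ => hmeas i n]
  exact sum_lintegral_sconv_schwartz_le s k hB (u n)

theorem SchwartzMap.exists_bound (k : 𝓢(E3, ℂ)) : ∃ C : ℝ≥0∞, C ≠ ⊤ ∧ ∀ x, ‖k x‖ₑ ≤ C := by
  refine ⟨ENNReal.ofReal (SchwartzMap.seminorm ℝ 0 0 k), ENNReal.ofReal_ne_top, fun x => ?_⟩
  rw [← ofReal_norm]
  exact ENNReal.ofReal_le_ofReal (SchwartzMap.norm_le_seminorm ℝ k x)

theorem sconv_memLp (k : 𝓢(E3, ℂ)) {g : E3 → ℂ} (hg : MemLp g 2 volume) :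
    MemLp (sconv k g) 2 volume := by
  refine ⟨(sconv_stronglyMeasurable k hg).aestronglyMeasurable, ?_⟩
  obtain ⟨C, hC, h⟩ := SchwartzMap.exists_bound (𝓕 k : 𝓢(E3, ℂ))
  have h1 := sum_lintegral_sconv_le (ι := Unit) {()} (fun _ => k) (B := C ^ 2)
    (ENNReal.pow_ne_top hC) (fun ξ => by simpa using pow_le_pow_left₀ (zero_le) (h ξ) 2) hg
  simp only [Finset.sum_singleton] at h1
  rw [← eLpNorm_two_sq] at h1
  have h2 : eLpNorm (sconv k g) 2 volume ^ 2 < ⊤ :=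
    h1.trans_lt (ENNReal.mul_lt_top (ENNReal.pow_lt_top hC.lt_top) hg.lintegral_sq_lt_top)
  exact (ENNReal.pow_lt_top_iff.1 h2).resolve_right (by norm_num)

/-- Composition of multiplier operators. -/
theorem sconv_sconv {k₁ k₂ k₃ : 𝓢(E3, ℂ)}
    (h : ∀ ξ, (𝓕 k₁ : 𝓢(E3, ℂ)) ξ * (𝓕 k₂ : 𝓢(E3, ℂ)) ξ = (𝓕 k₃ : 𝓢(E3, ℂ)) ξ)
    {g : E3 → ℂ} (hg : MemLp g 2 volume) (x : E3) : sconv k₁ (sconv k₂ g) x = sconv k₃ g x := by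
  obtain ⟨u, hu⟩ := exists_schwartz_seq hg
  have hm : ∀ n, MemLp (u n) 2 volume := fun n => (u n).memLp 2 volume
  obtain ⟨C, hC, hb⟩ := SchwartzMap.exists_bound (𝓕 k₂ : 𝓢(E3, ℂ))
  have h1 : Filter.Tendsto (fun n => ∫⁻ x, ‖sconv k₂ g x - sconv k₂ (u n) x‖ₑ ^ 2) Filter.atTop
      (𝓝 0) := by
    have h2 := ENNReal.Tendsto.const_mul hu (Or.inr (ENNReal.pow_ne_top (n := 2) hC))
    rw [mul_zero] at h2
    refine tendsto_of_tendsto_of_tendsto_of_le_of_le tendsto_const_nhds h2 (fun _ => zero_le) ?_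
    intro n
    have h1 := sum_lintegral_sconv_le (ι := Unit) {()} (fun _ => k₂) (B := C ^ 2)
      (ENNReal.pow_ne_top hC) (fun ξ => by simpa using pow_le_pow_left₀ (zero_le) (hb ξ) 2)
      (hg.sub (hm n))
    simp only [Finset.sum_singleton] at h1
    have h3 : ∀ x, sconv k₂ (g - ⇑(u n)) x = sconv k₂ g x - sconv k₂ (u n) x :=
      fun x => sconv_sub k₂ hg (hm n) x
    simp only [h3] at h1
    exact h1
  have h4 := tendsto_sconv k₁ (sconv_memLp k₂ hg) (fun n => sconv_memLp k₂ (hm n)) h1 x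
  refine tendsto_nhds_unique h4 ?_
  convert tendsto_sconv k₃ hg hm hu x using 2 with n
  -- For Schwartz data both sides are Schwartz functions with the same Fourier transform.
  rw [funext (sconv_schwartz k₂ (u n)), sconv_schwartz, sconv_schwartz]
  congr 1
  apply (FourierTransform.fourierEquiv ℂ 𝓢(E3, ℂ)).injective
  ext ξ
  simp only [FourierTransform.fourierEquiv_apply, fourier_sconv]
  rw [← mul_assoc, h]

/-- The multiplier operator is convolution with the inverse Fourier transform of the symbol. -/
theorem multiplierOp_eq_sconv {m : E3 → ℝ} {k : 𝓢(E3, ℂ)}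
    (h : ∀ ζ, (𝓕 k : 𝓢(E3, ℂ)) ζ = (m ((2 * Real.pi) • ζ) : ℂ))
    (f : Lp ℂ 2 (volume : Measure E3)) (x : E3) : multiplierOp m f x = sconv k f x := by
  -- With b(y) the conjugate of k(x - y), the value (k * f)(x) is the L² pairing of b with f.
  -- Plancherel turns it into the pairing of 𝓕 b with 𝓕 f, which is the inverse Fourier integral at
  -- x.
  let b : 𝓢(E3, ℂ) := SchwartzMap.postcompCLM (𝕜 := ℝ) (Complex.conjCLE : ℂ →L[ℝ] ℂ)
    (SchwartzMap.compSubConstCLM ℝ x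
      (SchwartzMap.compCLMOfContinuousLinearEquiv ℝ (ContinuousLinearEquiv.neg ℝ : E3 ≃L[ℝ] E3) k))
  have hb : ∀ y, b y = (starRingEnd ℂ) (k (x - y)) := fun y => by
    simp [b, SchwartzMap.postcompCLM_apply]
  have hFb : ∀ v, (𝓕 b : 𝓢(E3, ℂ)) v =
      (starRingEnd ℂ) (Real.fourierChar (inner ℝ v x) • (𝓕 k : 𝓢(E3, ℂ)) v) := by
    intro v
    rw [SchwartzMap.fourier_coe, SchwartzMap.fourier_coe, Real.fourier_eq, Real.fourier_eq,
      Circle.smul_def, smul_eq_mul, map_mul, ← integral_conj, ← integral_const_mul,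
      ← integral_sub_left_eq_self _ volume x]
    refine integral_congr_ae (Filter.Eventually.of_forall fun y => ?_)
    simp only [hb, sub_sub_cancel, Circle.smul_def, smul_eq_mul, map_mul, ← mul_assoc]
    congr 1
    rw [← Circle.coe_inv_eq_conj, ← Circle.coe_inv_eq_conj, ← Circle.coe_mul, ← AddChar.map_neg_eq_inv,
      ← AddChar.map_neg_eq_inv, ← AddChar.map_add_eq_mul]
    congr 2
    rw [inner_sub_left, real_inner_comm v x]
    ring
  have h1 := MeasureTheory.Lp.inner_fourier_eq (b.toLp 2 volume) f
  rw [SchwartzMap.toLp_fourier_eq, L2.inner_def, L2.inner_def] at h1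
  rw [multiplierOp, Real.fourierInv_eq, sconv]
  refine Eq.trans ?_ (h1.trans ?_)
  · refine integral_congr_ae ?_
    filter_upwards [(𝓕 b : 𝓢(E3, ℂ)).coeFn_toLp 2 volume] with v hv
    rw [hv, hFb, RCLike.inner_apply, ← h]
    simp [Circle.smul_def]
    ring
  · refine integral_congr_ae ?_
    filter_upwards [b.coeFn_toLp 2 volume] with v hv
    rw [hv, hb, RCLike.inner_apply]
    simp [mul_comm]

end

section

open scoped SchwartzMap LineDeriv Topology

/-! ### Anisotropic dilations adapted to an orthonormal frame -/

/-- The linear map `y ↦ (ρ_j ⟨b_j, y⟩)_j`. -/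
noncomputable def plateMap (b : OrthonormalBasis (Fin 3) ℝ E3) (ρ : Fin 3 → ℝ)
    (hρ : ∀ j, 0 < ρ j) : E3 ≃L[ℝ] E3 :=
  LinearEquiv.toContinuousLinearEquiv
    { toFun := fun y => WithLp.toLp 2 fun j => ρ j * inner ℝ (b j) y
      map_add' := fun x y => by ext j; simp [inner_add_right, mul_add]
      map_smul' := fun c x => by ext j; simp [inner_smul_right]; ring
      invFun := fun u => ∑ j, ((ρ j)⁻¹ * u j) • b j
      left_inv := fun y => by
        conv_rhs => rw [← b.sum_repr' y]
        refine Finset.sum_congr rfl fun j _ => ?_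
        rw [WithLp.ofLp_toLp, inv_mul_cancel_left₀ (hρ j).ne']
      right_inv := fun u => by
        ext j
        simp [inner_sum, inner_smul_right, b.inner_eq_ite, mul_inv_cancel_left₀ (hρ j).ne'] }

variable (b : OrthonormalBasis (Fin 3) ℝ E3) (ρ : Fin 3 → ℝ) (hρ : ∀ j, 0 < ρ j)

@[simp]
theorem plateMap_apply (y : E3) (j : Fin 3) : plateMap b ρ hρ y j = ρ j * inner ℝ (b j) y := rfl

/-- The map with inverse scales is the inverse transpose, so rescaling a kernel by ρ rescales its
frequency variable by ρ⁻¹. -/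
theorem inner_plateMap (y ξ : E3) :
    inner ℝ (plateMap b ρ hρ y) (plateMap b (fun j => (ρ j)⁻¹) (fun j => inv_pos.2 (hρ j)) ξ) =
      inner ℝ y ξ := by
  rw [← b.sum_inner_mul_inner y ξ, PiLp.inner_apply]
  refine Finset.sum_congr rfl fun j _ => ?_
  have := (hρ j).ne'
  simp only [plateMap_apply, RCLike.inner_apply, conj_trivial]
  rw [real_inner_comm y (b j)]
  field_simp

theorem norm_plateMap_sq (y : E3) :
    ‖plateMap b ρ hρ y‖ ^ 2 = ∑ j, (ρ j * inner ℝ (b j) y) ^ 2 := by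
  rw [EuclideanSpace.norm_sq_eq]
  simp only [plateMap_apply, Real.norm_eq_abs, sq_abs]

theorem det_plateMap : LinearMap.det ((plateMap b ρ hρ : E3 →L[ℝ] E3) : E3 →ₗ[ℝ] E3) =
    (∏ j, ρ j) * LinearMap.det (b.repr.toLinearEquiv : E3 →ₗ[ℝ] E3) := by
  have h : ((plateMap b ρ hρ : E3 →L[ℝ] E3) : E3 →ₗ[ℝ] E3) =
      Matrix.toLin (EuclideanSpace.basisFun (Fin 3) ℝ).toBasis
        (EuclideanSpace.basisFun (Fin 3) ℝ).toBasis (Matrix.diagonal ρ) ∘ₗ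
        (b.repr.toLinearEquiv : E3 →ₗ[ℝ] E3) := by
    ext y j
    simp [Matrix.toLin_apply, Matrix.mulVec_diagonal, b.repr_apply_apply, Finset.sum_apply,
      Pi.single_apply]
  rw [h, LinearMap.det_comp, LinearMap.det_toLin, Matrix.det_diagonal]

theorem map_plateMap_volume :
    Measure.map (plateMap b ρ hρ) volume = ENNReal.ofReal (∏ j, ρ j)⁻¹ • (volume : Measure E3) := by
  have hpos : 0 < ∏ j, ρ j := Finset.prod_pos fun j _ => hρ j
  have hU := b.repr.measurePreserving.map_eq
  have hd : LinearMap.det (b.repr.toLinearEquiv : E3 →ₗ[ℝ] E3) ≠ 0 :=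
    (LinearEquiv.isUnit_det' b.repr.toLinearEquiv).ne_zero
  have h1 := Measure.map_linearMap_addHaar_eq_smul_addHaar (volume : Measure E3) hd
  have h2 := Measure.map_linearMap_addHaar_eq_smul_addHaar (volume : Measure E3)
    (f := ((plateMap b ρ hρ : E3 →L[ℝ] E3) : E3 →ₗ[ℝ] E3)) (by
      rw [det_plateMap]; exact mul_ne_zero hpos.ne' hd)
  -- The change of frame is an isometry and preserves volume; comparing measures of the unit ball
  -- forces its determinant to be ±1.
  have h3 : |(LinearMap.det (b.repr.toLinearEquiv : E3 →ₗ[ℝ] E3))⁻¹| = 1 := by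
    have h4 : ENNReal.ofReal |(LinearMap.det (b.repr.toLinearEquiv : E3 →ₗ[ℝ] E3))⁻¹| •
        (volume : Measure E3) = volume := h1.symm.trans hU
    have h5 := congrArg (fun μ : Measure E3 => μ (Metric.ball 0 1)) h4
    simp only [Measure.smul_apply, smul_eq_mul] at h5
    have h6 : (volume : Measure E3) (Metric.ball 0 1) ≠ 0 :=
      (Metric.measure_ball_pos _ _ one_pos).ne'
    have h7 := (ENNReal.mul_eq_right h6 measure_ball_lt_top.ne).1 h5
    rwa [ENNReal.ofReal_eq_one] at h7
  rw [det_plateMap, mul_inv, abs_mul, h3, mul_one, abs_of_pos (inv_pos.2 hpos)] at h2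
  exact h2

theorem lintegral_comp_plateMap (G : E3 → ℝ≥0∞) :
    ∫⁻ y, G (plateMap b ρ hρ y) = ENNReal.ofReal (∏ j, ρ j)⁻¹ * ∫⁻ u, G u := by
  have h := lintegral_map_equiv (μ := volume) G (plateMap b ρ hρ).toHomeomorph.toMeasurableEquiv
  have e : Measure.map (plateMap b ρ hρ).toHomeomorph.toMeasurableEquiv volume =
    Measure.map (plateMap b ρ hρ) volume := rfl
  rw [e, map_plateMap_volume, lintegral_smul_measure] at h
  exact h.symm

theorem integral_comp_plateMap (G : E3 → ℂ) :
    ∫ y, G (plateMap b ρ hρ y) = ((∏ j, ρ j : ℝ) : ℂ)⁻¹ * ∫ u, G u := by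
  have hpos : 0 < ∏ j, ρ j := Finset.prod_pos fun j _ => hρ j
  have h := integral_map_equiv (μ := volume) (plateMap b ρ hρ).toHomeomorph.toMeasurableEquiv G
  have e : Measure.map (plateMap b ρ hρ).toHomeomorph.toMeasurableEquiv volume =
    Measure.map (plateMap b ρ hρ) volume := rfl
  rw [e, map_plateMap_volume, integral_smul_measure,
    ENNReal.toReal_ofReal (inv_pos.2 hpos).le] at h
  rw [← Complex.ofReal_inv, ← Complex.real_smul]
  exact h.symm

/-- The `L¹`-normalised rescaling of a Schwartz function to a plate. -/
noncomputable def plateKernel (F : 𝓢(E3, ℂ)) : 𝓢(E3, ℂ) :=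
  ((∏ j, ρ j : ℝ) : ℂ) • SchwartzMap.compCLMOfContinuousLinearEquiv ℂ (plateMap b ρ hρ) F

theorem plateKernel_apply (F : 𝓢(E3, ℂ)) (y : E3) :
    plateKernel b ρ hρ F y = ((∏ j, ρ j : ℝ) : ℂ) * F (plateMap b ρ hρ y) := rfl

theorem fourier_plateKernel (F : 𝓢(E3, ℂ)) (ξ : E3) :
    (𝓕 (plateKernel b ρ hρ F) : 𝓢(E3, ℂ)) ξ =
      (𝓕 F : 𝓢(E3, ℂ)) (plateMap b (fun j => (ρ j)⁻¹) (fun j => inv_pos.2 (hρ j)) ξ) := by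
  have hpos : 0 < ∏ j, ρ j := Finset.prod_pos fun j _ => hρ j
  set η := plateMap b (fun j => (ρ j)⁻¹) (fun j => inv_pos.2 (hρ j)) ξ with hη
  rw [SchwartzMap.fourier_coe, SchwartzMap.fourier_coe, Real.fourier_eq, Real.fourier_eq]
  have h := integral_comp_plateMap b ρ hρ fun u => Real.fourierChar (-inner ℝ u η) • F u
  have hne : ((∏ j, ρ j : ℝ) : ℂ) ≠ 0 := by exact_mod_cast hpos.ne'
  rw [eq_inv_mul_iff_mul_eq₀ hne, ← integral_const_mul] at h
  rw [← h]
  refine integral_congr_ae (Filter.Eventually.of_forall fun y => ?_)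
  simp only [hη, inner_plateMap, plateKernel_apply, Circle.smul_def, smul_eq_mul]
  ring

/-! ### The Gaussian -/

theorem one_add_pow_mul_exp_le (N : ℕ) :
    ∃ C : ℝ, ∀ t : ℝ, 0 ≤ t → (1 + t) ^ N * Real.exp (-Real.pi * t ^ 2) ≤ C := by
  -- (1 + t)^N ≤ N! e^{1+t}, and 1 + t - πt² ≤ 2.
  refine ⟨N.factorial * Real.exp 2, fun t ht => ?_⟩
  have h1 := Real.pow_div_factorial_le_exp (1 + t) (by positivity) N
  rw [div_le_iff₀ (by positivity)] at h1
  have h2 : Real.exp (1 + t) * Real.exp (-Real.pi * t ^ 2) ≤ Real.exp 2 := by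
    rw [← Real.exp_add]
    apply Real.exp_le_exp.2
    nlinarith [Real.pi_gt_three, sq_nonneg (t - 1), sq_nonneg t]
  calc (1 + t) ^ N * Real.exp (-Real.pi * t ^ 2)
      ≤ (Real.exp (1 + t) * N.factorial) * Real.exp (-Real.pi * t ^ 2) := by gcongr
    _ = N.factorial * (Real.exp (1 + t) * Real.exp (-Real.pi * t ^ 2)) := by ring
    _ ≤ _ := by gcongr

/-- Every derivative of exp at -π‖x‖² equals the Gaussian itself, and the exponent has temperate
growth. The bound for derivatives of a composition then gives a polynomial in ‖x‖ times the
Gaussian. -/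
theorem decay_gaussian (k n : ℕ) : ∃ C : ℝ, ∀ x : E3,
    ‖x‖ ^ k * ‖iteratedFDeriv ℝ n (fun x : E3 => Real.exp (-Real.pi * ‖x‖ ^ 2)) x‖ ≤ C := by
  have hq : (fun x : E3 => -Real.pi * ‖x‖ ^ 2).HasTemperateGrowth :=
    (Function.HasTemperateGrowth.const _).mul (Function.hasTemperateGrowth_norm_sq E3)
  obtain ⟨m, D, hD0, hD⟩ := hq.norm_iteratedFDeriv_le_uniform n
  obtain ⟨C, hC⟩ := one_add_pow_mul_exp_le (k + m * n)
  refine ⟨n.factorial * (1 + D) ^ n * C, fun x => ?_⟩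
  have h1 := norm_iteratedFDeriv_comp_le (𝕜 := ℝ) (n := n) (N := (n : ℕ∞ω))
    (g := Real.exp) (f := fun x : E3 => -Real.pi * ‖x‖ ^ 2) Real.contDiff_exp
    (hq.1.of_le (by exact_mod_cast le_top)) le_rfl x (C := Real.exp (-Real.pi * ‖x‖ ^ 2))
    (D := (1 + D) * (1 + ‖x‖) ^ m) (fun i _ => by
      rw [norm_iteratedFDeriv_eq_norm_iteratedDeriv, iteratedDeriv_eq_iterate,
        Real.iter_deriv_exp, Real.norm_eq_abs, Real.abs_exp]) (fun i hi hin => by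
      have h2 : D * (1 + ‖x‖) ^ m ≤ (1 + D) * (1 + ‖x‖) ^ m := by gcongr; linarith
      have h3 : 1 ≤ (1 + D) * (1 + ‖x‖) ^ m :=
        one_le_mul_of_one_le_of_one_le (by linarith) (one_le_pow₀ (by simp))
      exact ((hD i hin x).trans h2).trans (le_self_pow₀ h3 (by omega)))
  have h2 : ‖x‖ ^ k ≤ (1 + ‖x‖) ^ k := by gcongr; simp
  calc ‖x‖ ^ k * ‖iteratedFDeriv ℝ n (fun x : E3 => Real.exp (-Real.pi * ‖x‖ ^ 2)) x‖
      ≤ (1 + ‖x‖) ^ k * (n.factorial * Real.exp (-Real.pi * ‖x‖ ^ 2) *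
          ((1 + D) * (1 + ‖x‖) ^ m) ^ n) := by
        gcongr
        exact h1
    _ = n.factorial * (1 + D) ^ n *
          ((1 + ‖x‖) ^ (k + m * n) * Real.exp (-Real.pi * ‖x‖ ^ 2)) := by
        rw [mul_pow, ← pow_mul, pow_add]; ring
    _ ≤ _ := by gcongr; exact hC _ (norm_nonneg _)

/-- The standard Gaussian, as a Schwartz function. -/
noncomputable def gaussian : 𝓢(E3, ℂ) :=
  SchwartzMap.postcompCLM (𝕜 := ℝ) Complex.ofRealCLM
    { toFun := fun x : E3 => Real.exp (-Real.pi * ‖x‖ ^ 2)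
      smooth' := by
        have : ContDiff ℝ ∞ fun x : E3 => ‖x‖ ^ 2 := contDiff_norm_sq ℝ
        fun_prop
      decay' := decay_gaussian }

theorem gaussian_apply (x : E3) : gaussian x = (Real.exp (-Real.pi * ‖x‖ ^ 2) : ℂ) := by
  rw [gaussian, SchwartzMap.postcompCLM_apply]
  rfl

theorem fourier_gaussian (ξ : E3) :
    (𝓕 gaussian : 𝓢(E3, ℂ)) ξ = (Real.exp (-Real.pi * ‖ξ‖ ^ 2) : ℂ) := by
  have h := fourier_gaussian_innerProductSpace (V := E3) (b := (Real.pi : ℂ))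
    (by simpa using Real.pi_pos) ξ
  have hpi : (Real.pi : ℂ) ≠ 0 := by exact_mod_cast Real.pi_ne_zero
  rw [SchwartzMap.fourier_coe]
  have e : (gaussian : E3 → ℂ) = fun v => Complex.exp (-(Real.pi : ℂ) * (‖v‖ : ℂ) ^ 2) := by
    ext v
    rw [gaussian_apply]
    push_cast
    ring_nf
  rw [e, h, div_self hpi, Complex.one_cpow, one_mul]
  push_cast
  congr 1
  field_simp

end

section

open scoped SchwartzMap LineDeriv Topology

/-! ### Weights adapted to plates -/

/-- The norm `∑_j ρ_j |⟨b_j, y⟩|`. -/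
noncomputable def gauge3 (b : OrthonormalBasis (Fin 3) ℝ E3) (ρ : Fin 3 → ℝ) (y : E3) : ℝ :=
  ∑ j, ρ j * |inner ℝ (b j) y|

/-- The weight `plateWeight` at a fixed frame. -/
noncomputable def frameWeight (b : OrthonormalBasis (Fin 3) ℝ E3) (ρ : Fin 3 → ℝ) (y : E3) : ℝ :=
  (∏ j, ρ j) * ((1 + gauge3 b ρ y) ^ 300)⁻¹

/-- A weight of product form, comparable from below with a power of `frameWeight`. -/
noncomputable def prodWeight (b : OrthonormalBasis (Fin 3) ℝ E3) (ρ : Fin 3 → ℝ) (y : E3) : ℝ :=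
  (∏ j, ρ j) * ∏ j, ((1 + (ρ j * inner ℝ (b j) y) ^ 2) ^ 150)⁻¹

/-- Convolution of a non-negative function with a weight. -/
noncomputable def lconv (w : E3 → ℝ≥0∞) (φ : E3 → ℝ) (x : E3) : ℝ≥0∞ :=
  ∫⁻ y, w (x - y) * ENNReal.ofReal (φ y)

theorem lconv_mono {w w' : E3 → ℝ≥0∞} {φ : E3 → ℝ} (h : ∀ x, w x ≤ w' x) (x : E3) :
    lconv w φ x ≤ lconv w' φ x :=
  lintegral_mono fun y => by gcongr; exact h _

theorem lconv_mono_right {w : E3 → ℝ≥0∞} {φ φ' : E3 → ℝ} {C : ℝ} (hC : 0 ≤ C)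
    (h : ∀ x, φ x ≤ C * φ' x) (hφ : Continuous φ') (x : E3) (hw : AEMeasurable w volume) :
    lconv w φ x ≤ ENNReal.ofReal C * lconv w φ' x := by
  rw [lconv, lconv, ← lintegral_const_mul'' _ ?_]
  · refine lintegral_mono fun y => ?_
    simp only
    rw [mul_left_comm, ← ENNReal.ofReal_mul hC]
    gcongr
    exact h y
  · have h1 : AEMeasurable (fun y => w (x - y)) volume :=
      hw.comp_quasiMeasurePreserving (Measure.measurePreserving_sub_left volume x).quasiMeasurePreserving
    exact h1.mul (by fun_prop)

theorem measurable_lconv {w : E3 → ℝ≥0∞} {φ : E3 → ℝ} (hw : Measurable w) (hφ : Continuous φ) :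
    Measurable (lconv w φ) := by
  refine Measurable.lintegral_prod_right' (f := fun p : E3 × E3 => w (p.1 - p.2) *
    ENNReal.ofReal (φ p.2)) ?_
  fun_prop

theorem lconv_congr_ae {w w' : E3 → ℝ≥0∞} {φ : E3 → ℝ} (h : w =ᵐ[volume] w') (x : E3) :
    lconv w φ x = lconv w' φ x := by
  refine lintegral_congr_ae ?_
  have := (Measure.measurePreserving_sub_left volume x).quasiMeasurePreserving.ae_eq_comp h
  filter_upwards [this] with y hy
  simp only [Function.comp_apply] at hy
  rw [hy]

variable (b : OrthonormalBasis (Fin 3) ℝ E3) (ρ : Fin 3 → ℝ)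

theorem frameWeight_continuous (hρ : ∀ j, 0 < ρ j) : Continuous (frameWeight b ρ) := by
  unfold frameWeight gauge3
  refine continuous_const.mul (Continuous.inv₀ (by fun_prop) fun y => ?_)
  have : 0 ≤ ∑ j, ρ j * |inner ℝ (b j) y| :=
    Finset.sum_nonneg fun j _ => mul_nonneg (hρ j).le (abs_nonneg _)
  positivity

theorem prodWeight_continuous : Continuous (prodWeight b ρ) := by
  unfold prodWeight
  refine continuous_const.mul (continuous_finsetProd _ fun j _ =>
    Continuous.inv₀ (by fun_prop) fun y => by positivity)

theorem gauge3_neg (y : E3) : gauge3 b ρ (-y) = gauge3 b ρ y := by simp [gauge3]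

theorem frameWeight_neg (y : E3) : frameWeight b ρ (-y) = frameWeight b ρ y := by
  simp [frameWeight, gauge3_neg]

variable {ρ} (hρ : ∀ j, 0 < ρ j)

include hρ

theorem gauge3_nonneg (y : E3) : 0 ≤ gauge3 b ρ y :=
  Finset.sum_nonneg fun j _ => mul_nonneg (hρ j).le (abs_nonneg _)

theorem gauge3_sub_le (y z : E3) : gauge3 b ρ (y - z) ≤ gauge3 b ρ y + gauge3 b ρ z := by
  rw [gauge3, gauge3, gauge3, ← Finset.sum_add_distrib]
  refine Finset.sum_le_sum fun j _ => ?_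
  rw [← mul_add, inner_sub_right]
  exact mul_le_mul_of_nonneg_left (abs_sub _ _) (hρ j).le

theorem abs_coord_le_gauge3 (y : E3) (j : Fin 3) : |ρ j * inner ℝ (b j) y| ≤ gauge3 b ρ y := by
  rw [abs_mul, abs_of_pos (hρ j)]
  exact Finset.single_le_sum (f := fun j => ρ j * |inner ℝ (b j) y|)
    (fun i _ => mul_nonneg (hρ i).le (abs_nonneg _)) (Finset.mem_univ j)

theorem abs_coord_le_norm_plateMap (y : E3) (j : Fin 3) :
    |ρ j * inner ℝ (b j) y| ≤ ‖plateMap b ρ hρ y‖ := by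
  simpa using PiLp.norm_apply_le (plateMap b ρ hρ y) j

theorem gauge3_le_norm_plateMap (y : E3) : gauge3 b ρ y ≤ 3 * ‖plateMap b ρ hρ y‖ := by
  calc gauge3 b ρ y ≤ ∑ _j : Fin 3, ‖plateMap b ρ hρ y‖ := by
        refine Finset.sum_le_sum fun j _ => ?_
        have := abs_coord_le_norm_plateMap b hρ y j
        rwa [abs_mul, abs_of_pos (hρ j)] at this
    _ = _ := by simp

/-- In the gauge, 1 + |y - z| ≤ (1 + |y|)(1 + |z|), so a translation of bounded gauge changes the
weight by a bounded factor only. -/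
theorem frameWeight_le_shift (y z : E3) :
    frameWeight b ρ y ≤ (1 + gauge3 b ρ z) ^ 300 * frameWeight b ρ (y - z) := by
  have hpos : 0 < ∏ j, ρ j := Finset.prod_pos fun j _ => hρ j
  have hy := gauge3_nonneg b hρ y
  have hz := gauge3_nonneg b hρ z
  have hyz := gauge3_nonneg b hρ (y - z)
  have h1 : 1 + gauge3 b ρ (y - z) ≤ (1 + gauge3 b ρ y) * (1 + gauge3 b ρ z) := by
    have := gauge3_sub_le b hρ y z
    nlinarith
  rw [frameWeight, frameWeight, mul_left_comm]
  refine mul_le_mul_of_nonneg_left ?_ hpos.le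
  rw [← div_eq_mul_inv, le_div_iff₀ (by positivity), inv_mul_le_iff₀ (by positivity), ← mul_pow]
  gcongr

/-- Coordinatewise 1 + (u - v)² ≤ 2(1 + u²)(1 + v²). Three factors to the power 150 give 2^450, and
1 + v² ≤ (1 + gauge)² gives the exponent 900. -/
theorem prodWeight_le_shift (y z : E3) :
    prodWeight b ρ y ≤ 2 ^ 450 * (1 + gauge3 b ρ z) ^ 900 * prodWeight b ρ (y - z) := by
  have hpos : 0 < ∏ j, ρ j := Finset.prod_pos fun j _ => hρ j
  have hz := gauge3_nonneg b hρ z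
  have h1 : ∀ j, ((1 + (ρ j * inner ℝ (b j) y) ^ 2) ^ 150)⁻¹ ≤
      (2 * (1 + gauge3 b ρ z) ^ 2) ^ 150 * ((1 + (ρ j * inner ℝ (b j) (y - z)) ^ 2) ^ 150)⁻¹ := by
    intro j
    rw [← div_eq_mul_inv, le_div_iff₀ (by positivity), inv_mul_le_iff₀ (by positivity), ← mul_pow]
    gcongr
    have h2 : (ρ j * inner ℝ (b j) z) ^ 2 ≤ gauge3 b ρ z ^ 2 :=
      sq_le_sq.2 (by rw [abs_of_nonneg hz]; exact abs_coord_le_gauge3 b hρ z j)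
    rw [inner_sub_right, mul_sub]
    set u := ρ j * inner ℝ (b j) y
    set v := ρ j * inner ℝ (b j) z
    have h3 : 1 + v ^ 2 ≤ (1 + gauge3 b ρ z) ^ 2 := by nlinarith
    calc 1 + (u - v) ^ 2 ≤ (1 + u ^ 2) * (2 * (1 + v ^ 2)) := by
          nlinarith [sq_nonneg (u + v), sq_nonneg (u * v)]
      _ ≤ _ := by gcongr
  calc prodWeight b ρ y ≤ (∏ j, ρ j) * ∏ j, ((2 * (1 + gauge3 b ρ z) ^ 2) ^ 150 *
        ((1 + (ρ j * inner ℝ (b j) (y - z)) ^ 2) ^ 150)⁻¹) := by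
        refine mul_le_mul_of_nonneg_left ?_ hpos.le
        exact Finset.prod_le_prod (fun j _ => by positivity) fun j _ => h1 j
    _ = _ := by
        rw [Finset.prod_mul_distrib, Finset.prod_const, Finset.card_univ, Fintype.card_fin,
          ← pow_mul, mul_pow, ← pow_mul, prodWeight, mul_left_comm, ← mul_assoc]

/-- Two weights are carried along: `frameWeight` defines the maximal operators, while `prodWeight`
splits into linear factors that can be commuted past convolutions. The passage between them is (1 +
u + v + t)² ≤ 4(1 + u²)(1 + v²)(1 + t²) to the power 150. -/
theorem prodWeight_le_frameWeight (y : E3) : prodWeight b ρ y ≤ 4 ^ 150 * frameWeight b ρ y := by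
  have hpos : 0 < ∏ j, ρ j := Finset.prod_pos fun j _ => hρ j
  have hy := gauge3_nonneg b hρ y
  rw [prodWeight, frameWeight, mul_left_comm]
  refine mul_le_mul_of_nonneg_left ?_ hpos.le
  rw [Finset.prod_inv_distrib, ← div_eq_mul_inv, le_div_iff₀ (by positivity),
    inv_mul_le_iff₀ (by positivity), Finset.prod_pow, ← mul_pow]
  calc (1 + gauge3 b ρ y) ^ 300 = ((1 + gauge3 b ρ y) ^ 2) ^ 150 := by rw [← pow_mul]
    _ ≤ _ := by
      gcongr
      have e : gauge3 b ρ y = |ρ 0 * inner ℝ (b 0) y| + |ρ 1 * inner ℝ (b 1) y| +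
          |ρ 2 * inner ℝ (b 2) y| := by
        simp [gauge3, Fin.sum_univ_three, abs_mul, abs_of_pos (hρ _)]
      rw [e, Fin.prod_univ_three, ← sq_abs (ρ 0 * _), ← sq_abs (ρ 1 * _), ← sq_abs (ρ 2 * _)]
      set u := |ρ 0 * inner ℝ (b 0) y|
      set v := |ρ 1 * inner ℝ (b 1) y|
      set t := |ρ 2 * inner ℝ (b 2) y|
      have h1 : (1 + (u + v + t)) ^ 2 ≤ 4 * (1 + u ^ 2 + v ^ 2 + t ^ 2) := by
        nlinarith [sq_nonneg (1 - u), sq_nonneg (1 - v), sq_nonneg (1 - t), sq_nonneg (u - v),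
          sq_nonneg (u - t), sq_nonneg (v - t)]
      have h2 : 1 + u ^ 2 + v ^ 2 + t ^ 2 ≤ (1 + u ^ 2) * (1 + v ^ 2) * (1 + t ^ 2) := by
        have := sq_nonneg (u * v)
        have := sq_nonneg (u * t)
        have := sq_nonneg (t * v)
        have := sq_nonneg (u * v * t)
        nlinarith
      rw [mul_comm _ (4 : ℝ)]
      exact h1.trans (mul_le_mul_of_nonneg_left h2 (by norm_num))

theorem frameWeight_lower {y : E3} (hy : ‖plateMap b ρ hρ y‖ ≤ 1) :
    (∏ j, ρ j) * (4 ^ 300)⁻¹ ≤ frameWeight b ρ y := by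
  have hpos : 0 < ∏ j, ρ j := Finset.prod_pos fun j _ => hρ j
  have h1 := gauge3_nonneg b hρ y
  have h2 := gauge3_le_norm_plateMap b hρ y
  unfold frameWeight
  gcongr
  linarith

theorem prodWeight_lower {y : E3} (hy : ‖plateMap b ρ hρ y‖ ≤ 1) :
    (∏ j, ρ j) * (4 ^ 300)⁻¹ ≤ prodWeight b ρ y := by
  have hpos : 0 < ∏ j, ρ j := Finset.prod_pos fun j _ => hρ j
  unfold prodWeight
  gcongr
  have h1 : ∀ j, ((2 : ℝ) ^ 150)⁻¹ ≤ ((1 + (ρ j * inner ℝ (b j) y) ^ 2) ^ 150)⁻¹ := by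
    intro j
    gcongr
    have := (abs_coord_le_norm_plateMap b hρ y j).trans hy
    rw [← sq_abs]
    nlinarith [abs_nonneg (ρ j * inner ℝ (b j) y)]
  calc ((4 : ℝ) ^ 300)⁻¹ ≤ ∏ _j : Fin 3, ((2 : ℝ) ^ 150)⁻¹ := by
        rw [Finset.prod_const, Finset.card_univ, Fintype.card_fin, inv_pow, ← pow_mul]
        refine inv_anti₀ (by positivity) ?_
        rw [show (4 : ℝ) = 2 ^ 2 by norm_num, ← pow_mul]
        exact pow_le_pow_right₀ (by norm_num) (by norm_num)
    _ ≤ _ := Finset.prod_le_prod (fun j _ => by positivity) fun j _ => h1 j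

omit hρ in
theorem lconv_le_shift {w : E3 → ℝ≥0∞} {φ : E3 → ℝ} {z : E3} {D : ℝ} (hD : 0 ≤ D)
    (h : ∀ y, φ y ≤ D * φ (y - z)) (x : E3) :
    lconv w φ x ≤ ENNReal.ofReal D * lconv w φ (x - z) := by
  have e : lconv w φ (x - z) = ∫⁻ y, w (x - y) * ENNReal.ofReal (φ (y - z)) := by
    rw [lconv, ← lintegral_sub_right_eq_self _ z]
    simp
  rw [e, lconv, ← lintegral_const_mul' _ _ ENNReal.ofReal_ne_top]
  refine lintegral_mono fun y => ?_
  simp only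
  rw [mul_left_comm, ← ENNReal.ofReal_mul hD]
  gcongr
  exact h y

/-- A function that is essentially constant on a plate is bounded by its average over it. -/
theorem le_lconv_of_le_shift {G : E3 → ℝ≥0∞} {Φ : E3 → ℝ} {D c : ℝ} (hD : 0 ≤ D) (hc : 0 < c)
    (hΦ : ∀ z, ‖plateMap b ρ hρ z‖ ≤ 1 → (∏ j, ρ j) * c ≤ Φ z) {x : E3}
    (hG : ∀ z, ‖plateMap b ρ hρ z‖ ≤ 1 → G x ≤ ENNReal.ofReal D * G (x - z)) :
    G x ≤ ENNReal.ofReal (D * (c * (volume (Metric.closedBall (0 : E3) 1)).toReal)⁻¹) *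
      lconv G Φ x := by
  have hpos : 0 < ∏ j, ρ j := Finset.prod_pos fun j _ => hρ j
  set v := volume (Metric.closedBall (0 : E3) 1) with hv
  have hv0 : v ≠ 0 := (Metric.measure_closedBall_pos _ _ one_pos).ne'
  have hvt : v ≠ ⊤ := measure_closedBall_lt_top.ne
  have hvr : 0 < v.toReal := ENNReal.toReal_pos hv0 hvt
  have hS : MeasurableSet (plateMap b ρ hρ ⁻¹' Metric.closedBall 0 1) :=
    Metric.isClosed_closedBall.measurableSet.preimage (plateMap b ρ hρ).continuous.measurable
  -- Integrate the constant G x over the unit plate, of volume v / ∏ ρ_j. There Φ ≥ c ∏ ρ_j, so the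
  -- scales cancel.
  have h1 : G x * ENNReal.ofReal (c * v.toReal) ≤ ENNReal.ofReal D * lconv G Φ x := by
    have h2 := lintegral_comp_plateMap b ρ hρ ((Metric.closedBall 0 1).indicator fun _ =>
      G x * ENNReal.ofReal ((∏ j, ρ j) * c))
    rw [lintegral_indicator Metric.isClosed_closedBall.measurableSet, setLIntegral_const, ← hv] at h2
    have h3 : ENNReal.ofReal (∏ j, ρ j)⁻¹ * (G x * ENNReal.ofReal ((∏ j, ρ j) * c) * v) =
        G x * ENNReal.ofReal (c * v.toReal) := by
      rw [← ENNReal.ofReal_toReal hvt, mul_assoc, ← ENNReal.ofReal_mul (by positivity),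
        mul_left_comm, ← ENNReal.ofReal_mul (by positivity), ENNReal.ofReal_toReal hvt]
      congr 2
      field_simp
    rw [h3] at h2
    rw [← h2, lconv, ← lintegral_const_mul' _ _ ENNReal.ofReal_ne_top]
    refine lintegral_mono fun z => ?_
    simp only
    by_cases hz : ‖plateMap b ρ hρ z‖ ≤ 1
    · rw [indicator_of_mem (by simpa using hz), ← mul_assoc]
      gcongr
      · exact hG z hz
      · exact hΦ z hz
    · rw [indicator_of_notMem (by simpa using hz)]
      exact zero_le
  have h4 : ENNReal.ofReal (D * (c * v.toReal)⁻¹) * lconv G Φ x =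
      (ENNReal.ofReal D * lconv G Φ x) * ENNReal.ofReal (c * v.toReal)⁻¹ := by
    rw [ENNReal.ofReal_mul hD]; ring
  rw [h4]
  calc G x = G x * ENNReal.ofReal (c * v.toReal) * ENNReal.ofReal (c * v.toReal)⁻¹ := by
        rw [mul_assoc, ← ENNReal.ofReal_mul (by positivity), mul_inv_cancel₀ (by positivity)]
        simp
    _ ≤ _ := by gcongr

/-- A weight is one of the two standard weights of a plate. -/
def IsPlateWeight (b : OrthonormalBasis (Fin 3) ℝ E3) (ρ : Fin 3 → ℝ) (φ : E3 → ℝ) : Prop :=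
  φ = frameWeight b ρ ∨ φ = prodWeight b ρ

omit hρ in
/-- Averages over a plate are essentially constant on smaller plates. -/
theorem exists_lconv_le_lconv_lconv (A : ℝ) (hA : 0 ≤ A) : ∃ C : ℝ, 0 < C ∧
    ∀ (b b' : OrthonormalBasis (Fin 3) ℝ E3) (ρ ρ' : Fin 3 → ℝ), (∀ j, 0 < ρ j) → (∀ j, 0 < ρ' j) →
    (∀ z, gauge3 b ρ z ≤ A * gauge3 b' ρ' z) → ∀ φ φ' : E3 → ℝ, IsPlateWeight b ρ φ →
    IsPlateWeight b' ρ' φ' → ∀ (w : E3 → ℝ≥0∞) (x : E3),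
    lconv w φ x ≤ ENNReal.ofReal C * lconv (lconv w φ) φ' x := by
  have hv0 : volume (Metric.closedBall (0 : E3) 1) ≠ 0 :=
    (Metric.measure_closedBall_pos _ _ one_pos).ne'
  have hvr : 0 < (volume (Metric.closedBall (0 : E3) 1)).toReal :=
    ENNReal.toReal_pos hv0 measure_closedBall_lt_top.ne
  -- On the unit plate of (b', ρ') the gauge of (b', ρ') is at most 3, hence that of (b, ρ) is at
  -- most 3A. D dominates both shift constants at this value.
  obtain ⟨D, hD0, hD1, hD2⟩ : ∃ D : ℝ, 0 < D ∧ (1 + A * 3) ^ 300 ≤ D ∧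
      2 ^ 450 * (1 + A * 3) ^ 900 ≤ D :=
    ⟨(1 + A * 3) ^ 300 + 2 ^ 450 * (1 + A * 3) ^ 900, by positivity,
      le_add_of_nonneg_right (by positivity), le_add_of_nonneg_left (by positivity)⟩
  refine ⟨D * (((4 : ℝ) ^ 300)⁻¹ * (volume (Metric.closedBall (0 : E3) 1)).toReal)⁻¹, by positivity, ?_⟩
  intro b b' ρ ρ' hρ hρ' hg φ φ' hφ hφ' w x
  refine le_lconv_of_le_shift b' hρ' hD0.le (by positivity) (fun z hz => ?_) (fun z hz => ?_)
  · rcases hφ' with rfl | rfl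
    · exact frameWeight_lower b' hρ' hz
    · exact prodWeight_lower b' hρ' hz
  · have h1 : gauge3 b ρ z ≤ A * 3 := by
      refine (hg z).trans (mul_le_mul_of_nonneg_left ?_ hA)
      have := gauge3_le_norm_plateMap b' hρ' z
      linarith
    have h0 := gauge3_nonneg b hρ z
    refine lconv_le_shift hD0.le (fun y => ?_) x
    rcases hφ with rfl | rfl
    · refine (frameWeight_le_shift b hρ y z).trans ?_
      have hnn : 0 ≤ frameWeight b ρ (y - z) := by
        unfold frameWeight
        have := gauge3_nonneg b hρ (y - z)
        have hpos : 0 < ∏ j, ρ j := Finset.prod_pos fun j _ => hρ j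
        positivity
      refine mul_le_mul_of_nonneg_right ?_ hnn
      exact (pow_le_pow_left₀ (by linarith) (by linarith) 300).trans hD1
    · refine (prodWeight_le_shift b hρ y z).trans ?_
      have hnn : 0 ≤ prodWeight b ρ (y - z) := by
        unfold prodWeight
        have hpos : 0 < ∏ j, ρ j := Finset.prod_pos fun j _ => hρ j
        positivity
      refine mul_le_mul_of_nonneg_right ?_ hnn
      refine le_trans (mul_le_mul_of_nonneg_left ?_ (by positivity)) hD2
      exact pow_le_pow_left₀ (by linarith) (by linarith) 900

omit hρ in
/-- Tonelli's theorem for weighted integrals. -/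
theorem lintegral_mul_lconv {G w : E3 → ℝ≥0∞} {φ : E3 → ℝ} (hG : AEMeasurable G volume)
    (hw : AEMeasurable w volume) (hφ : Continuous φ) :
    ∫⁻ x, G x * lconv w φ x = ∫⁻ z, w z * ∫⁻ x, G x * ENNReal.ofReal (φ (x - z)) := by
  have h1 : ∀ x, lconv w φ x = ∫⁻ z, w z * ENNReal.ofReal (φ (x - z)) := by
    intro x
    rw [lconv, ← lintegral_sub_left_eq_self _ x]
    simp
  have m1 : AEMeasurable (fun p : E3 × E3 => G p.1 * (w p.2 * ENNReal.ofReal (φ (p.1 - p.2))))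
      (volume.prod volume) := by
    have hG' : AEMeasurable (fun p : E3 × E3 => G p.1) (volume.prod volume) :=
      hG.comp_quasiMeasurePreserving Measure.quasiMeasurePreserving_fst
    have hw' : AEMeasurable (fun p : E3 × E3 => w p.2) (volume.prod volume) :=
      hw.comp_quasiMeasurePreserving Measure.quasiMeasurePreserving_snd
    have hφ' : Continuous fun p : E3 × E3 => ENNReal.ofReal (φ (p.1 - p.2)) :=
      ENNReal.continuous_ofReal.comp (by fun_prop)
    exact hG'.mul (hw'.mul hφ'.measurable.aemeasurable)
  have mφ : ∀ x, AEMeasurable (fun z => w z * ENNReal.ofReal (φ (x - z))) volume := fun x =>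
    hw.mul (ENNReal.continuous_ofReal.comp (by fun_prop)).measurable.aemeasurable
  have mφ' : ∀ z, AEMeasurable (fun x => G x * ENNReal.ofReal (φ (x - z))) volume := fun z =>
    hG.mul (ENNReal.continuous_ofReal.comp (by fun_prop)).measurable.aemeasurable
  calc ∫⁻ x, G x * lconv w φ x = ∫⁻ x, ∫⁻ z, G x * (w z * ENNReal.ofReal (φ (x - z))) := by
        refine lintegral_congr fun x => ?_
        rw [h1, lintegral_const_mul'' _ (mφ x)]
    _ = ∫⁻ z, ∫⁻ x, G x * (w z * ENNReal.ofReal (φ (x - z))) := lintegral_lintegral_swap m1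
    _ = _ := by
        refine lintegral_congr fun z => ?_
        rw [← lintegral_const_mul'' _ (mφ' z)]
        refine lintegral_congr fun x => ?_
        ring

omit hρ in
-- The factor 3 is that of `gauge3_le_norm_plateMap`, so that the decay takes the form of
-- `frameWeight`.
theorem SchwartzMap.exists_le_inv_pow (F : 𝓢(E3, ℂ)) (N : ℕ) : ∃ C : ℝ, 0 < C ∧
    ∀ x, ‖F x‖ ≤ C * ((1 + 3 * ‖x‖) ^ N)⁻¹ := by
  set S := (2 : ℝ) ^ N * ((Finset.Iic ((N, 0) : ℕ × ℕ)).sup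
    fun m => SchwartzMap.seminorm ℝ m.1 m.2) F with hS
  have hS0 : 0 ≤ S := mul_nonneg (by positivity) (apply_nonneg _ _)
  refine ⟨3 ^ N * (S + 1), by positivity, fun x => ?_⟩
  have h := SchwartzMap.one_add_le_sup_seminorm_apply (𝕜 := ℝ) (m := (N, 0)) le_rfl le_rfl F x
  simp only [norm_iteratedFDeriv_zero, ← hS] at h
  rw [← div_eq_mul_inv, le_div_iff₀ (by positivity)]
  calc ‖F x‖ * (1 + 3 * ‖x‖) ^ N ≤ ‖F x‖ * (3 * (1 + ‖x‖)) ^ N := by gcongr; linarith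
    _ = 3 ^ N * ((1 + ‖x‖) ^ N * ‖F x‖) := by rw [mul_pow]; ring
    _ ≤ _ := by gcongr; linarith

omit hρ in
theorem exists_plateKernel_le (F : 𝓢(E3, ℂ)) : ∃ C : ℝ, 0 < C ∧
    ∀ (b : OrthonormalBasis (Fin 3) ℝ E3) (ρ : Fin 3 → ℝ) (hρ : ∀ j, 0 < ρ j) (y : E3),
    ‖plateKernel b ρ hρ F y‖ ≤ C * frameWeight b ρ y := by
  obtain ⟨C, hC, h⟩ := F.exists_le_inv_pow 300
  refine ⟨C, hC, fun b ρ hρ y => ?_⟩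
  have hpos : 0 < ∏ j, ρ j := Finset.prod_pos fun j _ => hρ j
  have h0 := gauge3_nonneg b hρ y
  rw [plateKernel_apply, norm_mul, Complex.norm_real, Real.norm_of_nonneg hpos.le, frameWeight,
    mul_left_comm]
  refine mul_le_mul_of_nonneg_left ((h _).trans ?_) hpos.le
  gcongr
  exact gauge3_le_norm_plateMap b hρ y

omit hρ in
/-- Convolution with a rescaled Schwartz function is bounded on weighted spaces. -/
theorem exists_lintegral_sconv_plateKernel_le (F : 𝓢(E3, ℂ)) : ∃ C : ℝ, 0 < C ∧
    ∀ (b : OrthonormalBasis (Fin 3) ℝ E3) (ρ : Fin 3 → ℝ) (hρ : ∀ j, 0 < ρ j) (g : E3 → ℂ),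
    MemLp g 2 volume → ∀ w : E3 → ℝ≥0∞, AEMeasurable w volume →
    ∫⁻ x, ‖sconv (plateKernel b ρ hρ F) g x‖ₑ ^ 2 * w x ≤
      ENNReal.ofReal C * ∫⁻ x, ‖g x‖ₑ ^ 2 * lconv w (frameWeight b ρ) x := by
  obtain ⟨C, hC, h⟩ := exists_plateKernel_le F
  have hFt : ∫⁻ x, ‖F x‖ₑ ≠ ⊤ := F.integrable.2.ne
  set B := (∫⁻ x, ‖F x‖ₑ).toReal with hB
  refine ⟨(B + 1) * C, by positivity, fun b ρ hρ g hg w hw => ?_⟩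
  have hpos : 0 < ∏ j, ρ j := Finset.prod_pos fun j _ => hρ j
  set k := plateKernel b ρ hρ F with hk
  have hk1 : ∫⁻ y, ‖k y‖ₑ = ENNReal.ofReal B := by
    have e : ∀ y, ‖k y‖ₑ = ENNReal.ofReal (∏ j, ρ j) * ‖F (plateMap b ρ hρ y)‖ₑ := by
      intro y
      rw [hk, plateKernel_apply, enorm_mul, ← ofReal_norm, Complex.norm_real,
        Real.norm_of_nonneg hpos.le]
    simp only [e]
    rw [lintegral_const_mul' _ _ ENNReal.ofReal_ne_top,
      lintegral_comp_plateMap b ρ hρ fun u => ‖F u‖ₑ, ← mul_assoc, ← ENNReal.ofReal_mul hpos.le,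
      mul_inv_cancel₀ hpos.ne', ENNReal.ofReal_one, one_mul, hB, ENNReal.ofReal_toReal hFt]
  have hkm : ∀ x, AEMeasurable (fun y => ‖k (x - y)‖ₑ) volume := fun x =>
    (Continuous.measurable (by fun_prop)).aemeasurable
  have hgm : AEMeasurable (fun y => ‖g y‖ₑ) volume := hg.1.enorm
  have hwc := frameWeight_continuous b ρ hρ
  have h2 : ∀ x, ‖sconv k g x‖ₑ ^ 2 ≤ ENNReal.ofReal (B * C) *
      ∫⁻ y, ‖g y‖ₑ ^ 2 * ENNReal.ofReal (frameWeight b ρ (y - x)) := by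
    intro x
    -- Splitting |k| = |k|^{1/2}|k|^{1/2}, Cauchy–Schwarz gives |k * g|² ≤ ‖k‖₁ (|k| * |g|²), and
    -- ‖k‖₁ does not depend on the plate.
    have h3 : ‖sconv k g x‖ₑ ≤ ∫⁻ y, ‖k (x - y)‖ₑ ^ (1 / 2 : ℝ) *
        (‖k (x - y)‖ₑ ^ (1 / 2 : ℝ) * ‖g y‖ₑ) := by
      refine (enorm_integral_le_lintegral_enorm _).trans_eq ?_
      refine lintegral_congr fun y => ?_
      rw [enorm_mul, ← mul_assoc, ← ENNReal.rpow_add_of_nonneg _ _ (by norm_num) (by norm_num)]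
      norm_num
    have e2 : ∀ a : ℝ≥0∞, (a ^ (1 / 2 : ℝ)) ^ 2 = a := fun a => by
      rw [← ENNReal.rpow_natCast, ← ENNReal.rpow_mul]; norm_num
    calc ‖sconv k g x‖ₑ ^ 2 ≤ _ := pow_le_pow_left₀ zero_le h3 2
      _ ≤ _ := lintegral_mul_sq_le _ ((hkm x).pow_const _) (((hkm x).pow_const _).mul hgm)
      _ = ENNReal.ofReal B * ∫⁻ y, ‖k (x - y)‖ₑ * ‖g y‖ₑ ^ 2 := by
          simp only [mul_pow, e2]
          rw [lintegral_sub_left_eq_self (fun y => ‖k y‖ₑ) x, hk1]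
      _ ≤ _ := by
          rw [ENNReal.ofReal_mul (by positivity), mul_assoc]
          gcongr
          rw [← lintegral_const_mul' _ _ ENNReal.ofReal_ne_top]
          refine lintegral_mono fun y => ?_
          simp only
          rw [mul_left_comm, ← ENNReal.ofReal_mul hC.le, mul_comm]
          gcongr
          rw [← ofReal_norm]
          refine ENNReal.ofReal_le_ofReal ((h b ρ hρ _).trans_eq ?_)
          rw [← frameWeight_neg b ρ (y - x), neg_sub]
  calc ∫⁻ x, ‖sconv k g x‖ₑ ^ 2 * w x
      ≤ ∫⁻ x, ENNReal.ofReal (B * C) *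
          (w x * ∫⁻ y, ‖g y‖ₑ ^ 2 * ENNReal.ofReal (frameWeight b ρ (y - x))) := by
        refine lintegral_mono fun x => ?_
        simp only
        rw [mul_left_comm, mul_comm]
        gcongr
        exact h2 x
    _ = ENNReal.ofReal (B * C) * ∫⁻ x, ‖g x‖ₑ ^ 2 * lconv w (frameWeight b ρ) x := by
        rw [lintegral_const_mul' _ _ ENNReal.ofReal_ne_top,
          lintegral_mul_lconv (hgm.pow_const 2) hw hwc]
    _ ≤ _ := by gcongr; linarith

end

section

open scoped SchwartzMap LineDeriv Topology

/-! ### Square functions of multiplier families on weighted spaces -/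

/-- Multiplication of a Schwartz function by a linear functional. -/
noncomputable def mulInner (v : E3) (k : 𝓢(E3, ℂ)) : 𝓢(E3, ℂ) :=
  SchwartzMap.smulLeftCLM ℂ (fun x : E3 => inner ℝ x v) k

theorem mulInner_apply (v : E3) (k : 𝓢(E3, ℂ)) (x : E3) :
    mulInner v k x = ((inner ℝ x v : ℝ) : ℂ) * k x := by
  rw [mulInner, SchwartzMap.smulLeftCLM_apply_apply (by fun_prop), Complex.real_smul]

/-- Multiplication by a product of linear functionals. -/
noncomputable def mulInnerList : List E3 → 𝓢(E3, ℂ) → 𝓢(E3, ℂ)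
  | [], k => k
  | v :: vs, k => mulInnerList vs (mulInner v k)

/-- The weight `∏_v (1 + ⟨y, v⟩²)⁻¹`. -/
noncomputable def listWeight : List E3 → E3 → ℝ
  | [], _ => 1
  | v :: vs, y => (1 + inner ℝ y v ^ 2)⁻¹ * listWeight vs y

theorem listWeight_continuous (vs : List E3) : Continuous (listWeight vs) := by
  induction vs with
  | nil => exact continuous_const
  | cons v vs ih =>
    exact (Continuous.inv₀ (f := fun y : E3 => 1 + inner ℝ y v ^ 2) (by fun_prop)
      fun y => by positivity).mul ih

theorem listWeight_append (vs ws : List E3) (y : E3) :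
    listWeight (vs ++ ws) y = listWeight vs y * listWeight ws y := by
  induction vs with
  | nil => simp [listWeight]
  | cons v vs ih => simp [listWeight, ih, mul_assoc]

theorem listWeight_replicate (n : ℕ) (v : E3) (y : E3) :
    listWeight (List.replicate n v) y = ((1 + inner ℝ y v ^ 2) ^ n)⁻¹ := by
  induction n with
  | zero => simp [listWeight]
  | succ n ih => rw [List.replicate_succ, listWeight, ih, ← mul_inv, ← pow_succ']

/-- The linear factor `1 + i⟨x - z, v⟩`. -/
noncomputable def linFactor (v z x : E3) : ℂ := 1 + Complex.I * (inner ℝ (x - z) v : ℝ)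

theorem normSq_linFactor (v z x : E3) : ‖linFactor v z x‖ ^ 2 = 1 + inner ℝ (x - z) v ^ 2 := by
  rw [linFactor, ← Complex.normSq_eq_norm_sq, Complex.normSq_apply]
  simp
  ring

theorem linFactor_ne_zero (v z x : E3) : linFactor v z x ≠ 0 := by
  intro h
  have := normSq_linFactor v z x
  rw [h] at this
  simp at this
  nlinarith [sq_nonneg (inner ℝ (x - z) v)]

theorem enorm_inv_linFactor_sq (v z x : E3) :
    ‖(linFactor v z x)⁻¹‖ₑ ^ 2 = ENNReal.ofReal (1 + inner ℝ (x - z) v ^ 2)⁻¹ := by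
  rw [← ofReal_norm, ← ENNReal.ofReal_pow (norm_nonneg _), norm_inv, inv_pow, normSq_linFactor]

theorem memLp_inv_linFactor_mul (v z : E3) {g : E3 → ℂ} (hg : MemLp g 2 volume) :
    MemLp (fun x => (linFactor v z x)⁻¹ * g x) 2 volume := by
  have hc : Continuous fun x => (linFactor v z x)⁻¹ := by
    refine Continuous.inv₀ ?_ (linFactor_ne_zero v z)
    unfold linFactor
    fun_prop
  refine hg.of_le (hc.aestronglyMeasurable.mul hg.1) (Filter.Eventually.of_forall fun x => ?_)
  rw [norm_mul, norm_inv]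
  refine mul_le_of_le_one_left (norm_nonneg _) (inv_le_one_of_one_le₀ ?_)
  have := normSq_linFactor v z x
  nlinarith [norm_nonneg (linFactor v z x), sq_nonneg (inner ℝ (x - z) v)]

/-- With ℓ(x) = 1 + i⟨x - z, v⟩ one has ℓ(y) = ℓ(x) - i⟨x - y, v⟩, so the commutator of ℓ with
convolution by k is convolution by a multiple of ⟨·, v⟩k. Dividing by ℓ moves the weight |ℓ|⁻² from
the output to the input, at the price of this second kernel. -/
theorem sconv_linFactor (k : 𝓢(E3, ℂ)) (v z : E3) {g : E3 → ℂ} (hg : MemLp g 2 volume) (x : E3) :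
    (linFactor v z x)⁻¹ * sconv k g x =
      sconv k (fun y => (linFactor v z y)⁻¹ * g y) x -
        (linFactor v z x)⁻¹ * Complex.I *
          sconv (mulInner v k) (fun y => (linFactor v z y)⁻¹ * g y) x := by
  have hh := memLp_inv_linFactor_mul v z hg
  have h1 : sconv k g x = linFactor v z x * sconv k (fun y => (linFactor v z y)⁻¹ * g y) x -
      Complex.I * sconv (mulInner v k) (fun y => (linFactor v z y)⁻¹ * g y) x := by
    simp only [sconv]
    rw [← integral_const_mul, ← integral_const_mul, ← integral_sub]
    · refine integral_congr_ae (Filter.Eventually.of_forall fun y => ?_)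
      simp only
      rw [mulInner_apply]
      have h2 : linFactor v z y = linFactor v z x - Complex.I * (inner ℝ (x - y) v : ℝ) := by
        simp only [linFactor, inner_sub_left]
        push_cast
        ring
      have h3 : g y = linFactor v z y * ((linFactor v z y)⁻¹ * g y) := by
        rw [mul_inv_cancel_left₀ (linFactor_ne_zero v z y)]
      conv_lhs => rw [h3]
      generalize (linFactor v z y)⁻¹ * g y = t
      rw [h2]
      ring
    · exact (sconv_integrable k hh x).const_mul _
    · exact (sconv_integrable (mulInner v k) hh x).const_mul _
  rw [h1]
  have := linFactor_ne_zero v z x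
  field_simp

theorem enorm_sub_sq_le (a c : ℂ) : ‖a - c‖ₑ ^ 2 ≤ 2 * ‖a‖ₑ ^ 2 + 2 * ‖c‖ₑ ^ 2 := by
  have h : ‖a - c‖ ^ 2 ≤ 2 * ‖a‖ ^ 2 + 2 * ‖c‖ ^ 2 := by
    have h1 := norm_sub_le a c
    nlinarith [sq_nonneg (‖a‖ - ‖c‖), norm_nonneg (a - c), norm_nonneg a, norm_nonneg c]
  simp only [← ofReal_norm]
  rw [← ENNReal.ofReal_pow (norm_nonneg _), ← ENNReal.ofReal_pow (norm_nonneg _),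
    ← ENNReal.ofReal_pow (norm_nonneg _)]
  refine (ENNReal.ofReal_le_ofReal h).trans_eq ?_
  rw [ENNReal.ofReal_add (by positivity) (by positivity), ENNReal.ofReal_mul (by norm_num),
    ENNReal.ofReal_mul (by norm_num)]
  norm_num

theorem enorm_sconv_sq_mul_le (k : 𝓢(E3, ℂ)) (v z : E3) {g : E3 → ℂ} (hg : MemLp g 2 volume)
    (x : E3) :
    ‖sconv k g x‖ₑ ^ 2 * ENNReal.ofReal (1 + inner ℝ (x - z) v ^ 2)⁻¹ ≤
      2 * ‖sconv k (fun y => (linFactor v z y)⁻¹ * g y) x‖ₑ ^ 2 +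
        2 * ‖sconv (mulInner v k) (fun y => (linFactor v z y)⁻¹ * g y) x‖ₑ ^ 2 := by
  rw [← enorm_inv_linFactor_sq, ← mul_pow, mul_comm, ← enorm_mul, sconv_linFactor k v z hg x]
  refine (enorm_sub_sq_le _ _).trans ?_
  gcongr
  rw [enorm_mul, enorm_mul]
  have h1 : ‖(linFactor v z x)⁻¹‖ₑ ≤ 1 := by
    have h2 := enorm_inv_linFactor_sq v z x
    have h3 : ENNReal.ofReal (1 + inner ℝ (x - z) v ^ 2)⁻¹ ≤ 1 := by
      rw [ENNReal.ofReal_le_one]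
      exact inv_le_one_of_one_le₀ (by nlinarith [sq_nonneg (inner ℝ (x - z) v)])
    rw [← h2] at h3
    exact (pow_le_one_iff two_ne_zero).1 h3
  have h4 : ‖Complex.I‖ₑ = 1 := by rw [← ofReal_norm]; simp
  rw [h4, mul_one]
  exact mul_le_of_le_one_left zero_le h1

/-- Peeling off one factor of the weight replaces g by ℓ⁻¹g and each kernel k by the pair k, ⟨·,
v⟩k, with constant 2 for each, hence 4 per factor. The kernels met on the way are indexed by
sublists; at the empty list Plancherel applies. -/
theorem sum_lintegral_sconv_listWeight_le {ι : Type*} (s : Finset ι) {B : ℝ≥0∞} (hBt : B ≠ ⊤)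
    (z : E3) (vs : List E3) (k : ι → 𝓢(E3, ℂ))
    (hB : ∀ ws, ws.Sublist vs → ∀ ξ,
      ∑ i ∈ s, ‖(𝓕 (mulInnerList ws (k i)) : 𝓢(E3, ℂ)) ξ‖ₑ ^ 2 ≤ B)
    {g : E3 → ℂ} (hg : MemLp g 2 volume) :
    ∑ i ∈ s, ∫⁻ x, ‖sconv (k i) g x‖ₑ ^ 2 * ENNReal.ofReal (listWeight vs (x - z)) ≤
      4 ^ vs.length * B * ∫⁻ x, ‖g x‖ₑ ^ 2 * ENNReal.ofReal (listWeight vs (x - z)) := by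
  induction vs generalizing k g with
  | nil =>
    simp only [listWeight, ENNReal.ofReal_one, mul_one, List.length_nil, pow_zero, one_mul]
    exact sum_lintegral_sconv_le s k hBt (fun ξ => hB [] (List.Sublist.refl _) ξ) hg
  | cons v vs ih =>
    set h : E3 → ℂ := fun y => (linFactor v z y)⁻¹ * g y with hh
    have hhm : MemLp h 2 volume := memLp_inv_linFactor_mul v z hg
    have h1 := ih k (fun ws hws => hB ws (hws.trans (List.sublist_cons_self v vs))) hhm
    have h2 := ih (fun i => mulInner v (k i))
      (fun ws hws => hB (v :: ws) (List.cons_sublist_cons.2 hws)) hhm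
    have hw : Measurable fun x : E3 => ENNReal.ofReal (listWeight vs (x - z)) :=
      (ENNReal.continuous_ofReal.comp ((listWeight_continuous vs).comp (by fun_prop))).measurable
    have hm : ∀ k : 𝓢(E3, ℂ), Measurable fun x =>
        ‖sconv k h x‖ₑ ^ 2 * ENNReal.ofReal (listWeight vs (x - z)) := fun k =>
      ((sconv_stronglyMeasurable k hhm).enorm.pow_const 2).mul hw
    have h3 : ∀ i, ∫⁻ x, ‖sconv (k i) g x‖ₑ ^ 2 * ENNReal.ofReal (listWeight (v :: vs) (x - z)) ≤
        2 * (∫⁻ x, ‖sconv (k i) h x‖ₑ ^ 2 * ENNReal.ofReal (listWeight vs (x - z))) +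
        2 * ∫⁻ x, ‖sconv (mulInner v (k i)) h x‖ₑ ^ 2 *
          ENNReal.ofReal (listWeight vs (x - z)) := by
      intro i
      rw [← lintegral_const_mul _ (hm _), ← lintegral_const_mul _ (hm _),
        ← lintegral_add_left ((hm _).const_mul _)]
      refine lintegral_mono fun x => ?_
      simp only
      rw [listWeight, ENNReal.ofReal_mul (by positivity), ← mul_assoc, ← mul_assoc, ← mul_assoc,
        ← add_mul]
      gcongr
      exact enorm_sconv_sq_mul_le (k i) v z hg x
    have h4 : ∫⁻ x, ‖h x‖ₑ ^ 2 * ENNReal.ofReal (listWeight vs (x - z)) =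
        ∫⁻ x, ‖g x‖ₑ ^ 2 * ENNReal.ofReal (listWeight (v :: vs) (x - z)) := by
      refine lintegral_congr fun x => ?_
      rw [hh, listWeight, ENNReal.ofReal_mul (by positivity), enorm_mul, mul_pow,
        enorm_inv_linFactor_sq]
      ring
    rw [h4] at h1 h2
    refine (Finset.sum_le_sum fun i _ => h3 i).trans ?_
    rw [Finset.sum_add_distrib, ← Finset.mul_sum, ← Finset.mul_sum]
    refine (add_le_add (mul_le_mul_right h1 2) (mul_le_mul_right h2 2)).trans_eq ?_
    rw [List.length_cons, pow_succ, ← add_mul]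
    norm_num
    ring

/-- The functionals entering `prodWeight`. -/
noncomputable def plateList (b : OrthonormalBasis (Fin 3) ℝ E3) (ρ : Fin 3 → ℝ) : List E3 :=
  List.replicate 150 (ρ 0 • b 0) ++ (List.replicate 150 (ρ 1 • b 1) ++
    List.replicate 150 (ρ 2 • b 2))

theorem mem_plateList {b : OrthonormalBasis (Fin 3) ℝ E3} {ρ : Fin 3 → ℝ} {v : E3}
    (hv : v ∈ plateList b ρ) : ∃ j, v = ρ j • b j := by
  simp only [plateList, List.mem_append] at hv
  rcases hv with h | h | h
  exacts [⟨0, List.eq_of_mem_replicate h⟩, ⟨1, List.eq_of_mem_replicate h⟩,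
    ⟨2, List.eq_of_mem_replicate h⟩]

theorem length_plateList (b : OrthonormalBasis (Fin 3) ℝ E3) (ρ : Fin 3 → ℝ) :
    (plateList b ρ).length = 450 := by
  rw [plateList, List.length_append, List.length_append, List.length_replicate,
    List.length_replicate, List.length_replicate]

theorem prodWeight_eq_listWeight (b : OrthonormalBasis (Fin 3) ℝ E3) (ρ : Fin 3 → ℝ) (y : E3) :
    prodWeight b ρ y = (∏ j, ρ j) * listWeight (plateList b ρ) y := by
  rw [prodWeight, plateList, listWeight_append, listWeight_append, listWeight_replicate,
    listWeight_replicate, listWeight_replicate, Fin.prod_univ_three (fun j => _⁻¹), mul_assoc]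
  simp only [inner_smul_right, real_inner_comm]

theorem aemeasurable_lintegral_mul_sub {G : E3 → ℝ≥0∞} {φ : E3 → ℝ} (hG : AEMeasurable G volume)
    (hφ : Continuous φ) :
    AEMeasurable (fun z => ∫⁻ x, G x * ENNReal.ofReal (φ (x - z))) volume := by
  refine AEMeasurable.lintegral_prod_right' (f := fun p : E3 × E3 => G p.2 *
    ENNReal.ofReal (φ (p.2 - p.1))) ?_
  have hG' : AEMeasurable (fun p : E3 × E3 => G p.2) (volume.prod volume) :=
    hG.comp_quasiMeasurePreserving Measure.quasiMeasurePreserving_snd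
  have hφ' : Continuous fun p : E3 × E3 => ENNReal.ofReal (φ (p.2 - p.1)) :=
    ENNReal.continuous_ofReal.comp (by fun_prop)
  exact hG'.mul hφ'.measurable.aemeasurable

/-- Weighted square function estimate: a family of multipliers all of whose derivatives adapted to
a plate have bounded square function is bounded with respect to averages over that plate. -/
theorem sum_lintegral_sconv_lconv_prodWeight_le {ι : Type*} (s : Finset ι) {B : ℝ≥0∞}
    (hBt : B ≠ ⊤) (b : OrthonormalBasis (Fin 3) ℝ E3) {ρ : Fin 3 → ℝ} (hρ : ∀ j, 0 < ρ j)
    (k : ι → 𝓢(E3, ℂ))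
    (hB : ∀ ws, ws.Sublist (plateList b ρ) → ∀ ξ,
      ∑ i ∈ s, ‖(𝓕 (mulInnerList ws (k i)) : 𝓢(E3, ℂ)) ξ‖ₑ ^ 2 ≤ B)
    {g : E3 → ℂ} (hg : MemLp g 2 volume) {w : E3 → ℝ≥0∞} (hw : AEMeasurable w volume) :
    ∑ i ∈ s, ∫⁻ x, ‖sconv (k i) g x‖ₑ ^ 2 * lconv w (prodWeight b ρ) x ≤
      4 ^ 450 * B * ∫⁻ x, ‖g x‖ₑ ^ 2 * lconv w (prodWeight b ρ) x := by
  have hpos : 0 < ∏ j, ρ j := Finset.prod_pos fun j _ => hρ j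
  have hc := prodWeight_continuous b ρ
  have hk : ∀ i, AEMeasurable (fun x => ‖sconv (k i) g x‖ₑ ^ 2) volume := fun i =>
    ((sconv_stronglyMeasurable (k i) hg).enorm.pow_const 2).aemeasurable
  have hgm : AEMeasurable (fun x => ‖g x‖ₑ ^ 2) volume := hg.1.enorm.pow_const 2
  -- By Tonelli it suffices to treat the weight `prodWeight` centred at a fixed z and to integrate
  -- the result against w(z).
  simp only [lintegral_mul_lconv (hk _) hw hc]
  rw [lintegral_mul_lconv hgm hw hc, ← lintegral_finsetSum', ← lintegral_const_mul'']
  · refine lintegral_mono fun z => ?_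
    simp only
    rw [← Finset.mul_sum, mul_left_comm]
    gcongr
    have e : ∀ G : E3 → ℝ≥0∞, ∫⁻ x, G x * ENNReal.ofReal (prodWeight b ρ (x - z)) =
        ENNReal.ofReal (∏ j, ρ j) *
          ∫⁻ x, G x * ENNReal.ofReal (listWeight (plateList b ρ) (x - z)) := by
      intro G
      rw [← lintegral_const_mul' _ _ ENNReal.ofReal_ne_top]
      refine lintegral_congr fun x => ?_
      rw [prodWeight_eq_listWeight, ENNReal.ofReal_mul hpos.le]
      ring
    simp only [e]
    rw [← Finset.mul_sum, mul_left_comm]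
    gcongr
    have := sum_lintegral_sconv_listWeight_le s hBt z (plateList b ρ) k hB hg
    rwa [length_plateList] at this
  · exact hw.mul (aemeasurable_lintegral_mul_sub hgm hc)
  · exact fun i _ => hw.mul (aemeasurable_lintegral_mul_sub (hk i) hc)

open LineDeriv in
-- Multiplying the kernel by ⟨·, w⟩ differentiates its Fourier transform along w, up to the factor
-- -(2πi)⁻¹. Only |c| ≤ 1 and the origin of the directions in the list matter later.
theorem exists_fourier_mulInnerList (ws : List E3) (k : 𝓢(E3, ℂ)) :
    ∃ v : Fin ws.length → E3, (∀ i, v i ∈ ws) ∧ ∃ c : ℂ, ‖c‖ ≤ 1 ∧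
      (𝓕 (mulInnerList ws k) : 𝓢(E3, ℂ)) = c • ∂^{v} (𝓕 k : 𝓢(E3, ℂ)) := by
  induction ws generalizing k with
  | nil => exact ⟨Fin.elim0, fun i => i.elim0, 1, by simp, by simp [mulInnerList]⟩
  | cons w ws ih =>
    obtain ⟨v, hv, c, hc, h⟩ := ih (mulInner w k)
    refine ⟨Fin.snoc (α := fun _ => E3) v w, ?_, c * (-(2 * Real.pi * Complex.I))⁻¹, ?_, ?_⟩
    · intro i
      refine Fin.lastCases ?_ (fun j => ?_) i
      · simp
      · simpa using Or.inr (hv j)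
    · rw [norm_mul]
      refine mul_le_one₀ hc (norm_nonneg _) ?_
      rw [norm_inv]
      refine inv_le_one_of_one_le₀ ?_
      simp only [norm_neg, norm_mul, Complex.norm_I, mul_one, Complex.norm_ofNat,
        Complex.norm_real, Real.norm_of_nonneg Real.pi_pos.le]
      nlinarith [Real.pi_gt_three]
    · have h1 : (𝓕 (mulInner w k) : 𝓢(E3, ℂ)) =
          (-(2 * Real.pi * Complex.I))⁻¹ • ∂_{w} (𝓕 k : 𝓢(E3, ℂ)) := by
        rw [SchwartzMap.lineDerivOp_fourier_eq, FourierTransform.fourier_smul, inv_smul_smul₀]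
        · rfl
        · simp [Real.pi_ne_zero]
      rw [mulInnerList, h, h1, mul_smul, iteratedLineDerivOp_smul]
      congr 2
      exact (iteratedLineDerivOp_succ_right (Fin.snoc (α := fun _ => E3) v w) (𝓕 k)).symm ▸ by simp

/-- Weighted square function estimate for a family of symbols that are compositions of one fixed
symbol with linear maps. -/
theorem sum_lintegral_sconv_comp_le {ι G : Type*} [NormedAddCommGroup G] [NormedSpace ℝ G]
    {F : G → ℂ} (hF : ContDiff ℝ ∞ F) {D A : ℝ} (hA : 1 ≤ A)
    (hD : ∀ n ≤ 450, ∀ x, ‖iteratedFDeriv ℝ n F x‖ ≤ D) (N : ℕ) (s : Finset ι)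
    (b : OrthonormalBasis (Fin 3) ℝ E3) {ρ : Fin 3 → ℝ} (hρ : ∀ j, 0 < ρ j)
    (k : ι → 𝓢(E3, ℂ)) (Λ : ι → E3 →L[ℝ] G)
    (hk : ∀ i ∈ s, ∀ ξ, (𝓕 (k i) : 𝓢(E3, ℂ)) ξ = F (Λ i ξ))
    (hΛ : ∀ i ∈ s, ∀ j, ‖Λ i (ρ j • b j)‖ ≤ A)
    (hN : ∀ ξ, ∀ t ⊆ s, (∀ i ∈ t, ξ ∈ tsupport (𝓕 (k i) : 𝓢(E3, ℂ))) → t.card ≤ N)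
    {g : E3 → ℂ} (hg : MemLp g 2 volume) {w : E3 → ℝ≥0∞} (hw : AEMeasurable w volume) :
    ∑ i ∈ s, ∫⁻ x, ‖sconv (k i) g x‖ₑ ^ 2 * lconv w (prodWeight b ρ) x ≤
      4 ^ 450 * ENNReal.ofReal (N * (D * A ^ 450) ^ 2) *
        ∫⁻ x, ‖g x‖ₑ ^ 2 * lconv w (prodWeight b ρ) x := by
  classical
  refine sum_lintegral_sconv_lconv_prodWeight_le s ENNReal.ofReal_ne_top b hρ k ?_ hg hw
  intro ws hws ξ
  have hD0 : 0 ≤ D := (norm_nonneg _).trans (hD 0 (by norm_num) 0)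
  have hlen : ws.length ≤ 450 := (hws.length_le).trans_eq (length_plateList b ρ)
  have h1 : ∀ i ∈ s, ‖(𝓕 (mulInnerList ws (k i)) : 𝓢(E3, ℂ)) ξ‖ ≤ D * A ^ 450 := by
    intro i hi
    obtain ⟨v, hv, c, hc, h⟩ := exists_fourier_mulInnerList ws (k i)
    rw [h, SchwartzMap.smul_apply, norm_smul, SchwartzMap.iteratedLineDerivOp_eq_iteratedFDeriv]
    refine (mul_le_of_le_one_left (norm_nonneg _) hc).trans ?_
    -- By the chain rule, a derivative of F ∘ Λ_i along n ≤ 450 of the vectors ρ_j b_j is at most D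
    -- Aⁿ.
    have e : ((𝓕 (k i) : 𝓢(E3, ℂ)) : E3 → ℂ) = F ∘ Λ i := funext (hk i hi)
    rw [e, ContinuousLinearMap.iteratedFDeriv_comp_right (Λ i) hF ξ (i := ws.length)
      (by exact_mod_cast le_top), ContinuousMultilinearMap.compContinuousLinearMap_apply]
    refine (ContinuousMultilinearMap.le_opNorm _ _).trans ?_
    refine mul_le_mul (hD _ hlen _) ?_ (Finset.prod_nonneg fun _ _ => norm_nonneg _) hD0
    calc ∏ j, ‖Λ i (v j)‖ ≤ ∏ _j : Fin ws.length, A := by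
          refine Finset.prod_le_prod (fun _ _ => norm_nonneg _) fun j _ => ?_
          obtain ⟨l, hl⟩ := mem_plateList (hws.subset (hv j))
          rw [hl]
          exact hΛ i hi l
      _ = A ^ ws.length := by simp
      _ ≤ A ^ 450 := pow_le_pow_right₀ hA hlen
  have h2 : ∀ i, ξ ∉ tsupport (𝓕 (k i) : 𝓢(E3, ℂ)) →
      (𝓕 (mulInnerList ws (k i)) : 𝓢(E3, ℂ)) ξ = 0 := by
    intro i hi
    obtain ⟨v, hv, c, hc, h⟩ := exists_fourier_mulInnerList ws (k i)
    rw [h, SchwartzMap.smul_apply]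
    have := mt (fun h => SchwartzMap.tsupport_iteratedLineDerivOp_subset v (𝓕 (k i)) h) hi
    rw [image_eq_zero_of_notMem_tsupport this, smul_zero]
  -- Derivatives do not enlarge the closed support, so at ξ only the indices with ξ in the
  -- `tsupport` of their symbol contribute, at most N of them.
  set t := s.filter fun i => ξ ∈ tsupport (𝓕 (k i) : 𝓢(E3, ℂ)) with ht
  have h3 : ∑ i ∈ s, ‖(𝓕 (mulInnerList ws (k i)) : 𝓢(E3, ℂ)) ξ‖ₑ ^ 2 =
      ∑ i ∈ t, ‖(𝓕 (mulInnerList ws (k i)) : 𝓢(E3, ℂ)) ξ‖ₑ ^ 2 := by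
    refine (Finset.sum_subset (Finset.filter_subset _ _) fun i hi hit => ?_).symm
    rw [h2 i fun hc => hit (Finset.mem_filter.2 ⟨hi, hc⟩)]
    simp
  rw [h3]
  have hA0 : 0 ≤ D * A ^ 450 := mul_nonneg hD0 (pow_nonneg (by linarith) _)
  calc ∑ i ∈ t, ‖(𝓕 (mulInnerList ws (k i)) : 𝓢(E3, ℂ)) ξ‖ₑ ^ 2
      ≤ ∑ _i ∈ t, ENNReal.ofReal ((D * A ^ 450) ^ 2) := by
        refine Finset.sum_le_sum fun i hi => ?_
        rw [ENNReal.ofReal_pow hA0, ← ofReal_norm]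
        gcongr
        exact h1 i (Finset.mem_filter.1 hi).1
    _ = ENNReal.ofReal (t.card * (D * A ^ 450) ^ 2) := by
        rw [Finset.sum_const, nsmul_eq_mul, ENNReal.ofReal_mul (by positivity),
          ENNReal.ofReal_natCast]
    _ ≤ _ := by
        apply ENNReal.ofReal_le_ofReal
        gcongr
        exact hN ξ t (Finset.filter_subset _ _) fun i hi => (Finset.mem_filter.1 hi).2

end

section

open scoped SchwartzMap LineDeriv Topology

/-! ### The Frenet frame of a non-degenerate curve -/

/-- The Frenet equations `e₁' = a e₂`, `e₂' = -a e₁ + τ e₃` with quantitative bounds. -/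
structure FrenetBounds (I : Set ℝ) (e : Fin 3 → ℝ → E3) (a τ : ℝ → ℝ) (c L : ℝ) : Prop where
  c_pos : 0 < c
  one_le : 1 ≤ L
  orthonormal : ∀ s ∈ I, Orthonormal ℝ fun j => e j s
  deriv_zero : ∀ s ∈ I, HasDerivWithinAt (e 0) (a s • e 1 s) I s
  deriv_one : ∀ s ∈ I, HasDerivWithinAt (e 1) (-a s • e 0 s + τ s • e 2 s) I s
  a_lower : ∀ s ∈ I, c ≤ a s
  τ_lower : ∀ s ∈ I, c ≤ τ s
  a_upper : ∀ s ∈ I, a s ≤ L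
  τ_upper : ∀ s ∈ I, τ s ≤ L
  a_lipschitz : ∀ s ∈ I, ∀ t ∈ I, |a s - a t| ≤ L * |s - t|
  τ_lipschitz : ∀ s ∈ I, ∀ t ∈ I, |τ s - τ t| ≤ L * |s - t|
  lipschitz : ∀ j, ∀ s ∈ I, ∀ t ∈ I, ‖e j s - e j t‖ ≤ L * |s - t|

theorem contDiffOn_curveDeriv {γ : ℝ → E3} {a b : ℝ} (hab : a < b)
    (hγ : ContDiffOn ℝ ∞ γ (Icc a b)) (k : ℕ) : ContDiffOn ℝ ∞ (curveDeriv γ (Icc a b) k) (Icc a b) := by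
  induction k with
  | zero => exact hγ.congr fun s _ => by simp [curveDeriv]
  | succ k ih =>
    refine (ih.derivWithin (uniqueDiffOn_Icc hab) (m := ∞) (by simp)).congr fun s hs => ?_
    simp only [curveDeriv, iteratedDerivWithin_succ]
    rfl

theorem hasDerivWithinAt_curveDeriv {γ : ℝ → E3} {a b : ℝ} (hab : a < b)
    (hγ : ContDiffOn ℝ ∞ γ (Icc a b)) (k : ℕ) {s : ℝ} (hs : s ∈ Icc a b) :
    HasDerivWithinAt (curveDeriv γ (Icc a b) k) (curveDeriv γ (Icc a b) (k + 1) s) (Icc a b) s := by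
  have h := ((contDiffOn_curveDeriv hab hγ k).differentiableOn (by simp) s hs).hasDerivWithinAt
  have e : curveDeriv γ (Icc a b) (k + 1) s =
      derivWithin (curveDeriv γ (Icc a b) k) (Icc a b) s := by
    simp only [curveDeriv, iteratedDerivWithin_succ]
    rfl
  rw [e]
  exact h

theorem exists_lipschitz_of_contDiffOn {F : Type*} [NormedAddCommGroup F] [NormedSpace ℝ F]
    {f : ℝ → F} {a b : ℝ} (hab : a < b) (hf : ContDiffOn ℝ ∞ f (Icc a b)) :
    ∃ L : ℝ, ∀ s ∈ Icc a b, ∀ t ∈ Icc a b, ‖f s - f t‖ ≤ L * |s - t| := by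
  have hc : ContinuousOn (derivWithin f (Icc a b)) (Icc a b) :=
    hf.continuousOn_derivWithin (uniqueDiffOn_Icc hab) (by simp)
  obtain ⟨L, hL⟩ := isCompact_Icc.exists_bound_of_continuousOn hc
  exact ⟨L, fun s hs t ht => (convex_Icc a b).norm_image_sub_le_of_norm_derivWithin_le
    (hf.differentiableOn (by simp)) hL ht hs⟩

theorem linearIndependent_curveDeriv {γ : ℝ → E3} {I : Set ℝ} (hnd : NonDegenerateCurve γ I)
    {s : ℝ} (hs : s ∈ I) : LinearIndependent ℝ fun k : Fin 3 => curveDeriv γ I (k.val + 1) s := by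
  obtain ⟨c₀, hc₀, h⟩ := hnd
  have hdet : IsUnit (Matrix.of fun i j : Fin 3 => curveDeriv γ I (j.val + 1) s i).det := by
    rw [isUnit_iff_ne_zero, ← abs_pos]
    exact hc₀.trans_le (h s hs)
  have h1 := Matrix.linearIndependent_cols_iff_isUnit.2 ((Matrix.isUnit_iff_isUnit_det _).2 hdet)
  have h2 : (fun k : Fin 3 => curveDeriv γ I (k.val + 1) s) =
      (WithLp.linearEquiv 2 ℝ (Fin 3 → ℝ)).symm ∘
        (Matrix.of fun i j : Fin 3 => curveDeriv γ I (j.val + 1) s i).col := by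
    ext k i
    rfl
  rw [h2]
  exact h1.map' ((WithLp.linearEquiv 2 ℝ (Fin 3 → ℝ)).symm : (Fin 3 → ℝ) →ₗ[ℝ] E3)
    (LinearEquiv.ker _)

/-- The unnormalised Gram--Schmidt frame. -/
noncomputable def frenetRaw (γ : ℝ → E3) (I : Set ℝ) (j : Fin 3) (s : ℝ) : E3 :=
  InnerProductSpace.gramSchmidt ℝ (fun k : Fin 3 => curveDeriv γ I (k.val + 1) s) j

theorem frenet_eq (γ : ℝ → E3) (I : Set ℝ) (j : Fin 3) (s : ℝ) :
    frenet γ I j s = ‖frenetRaw γ I j s‖⁻¹ • frenetRaw γ I j s := rfl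

theorem frenetRaw_ne_zero {γ : ℝ → E3} {I : Set ℝ} (hnd : NonDegenerateCurve γ I)
    {s : ℝ} (hs : s ∈ I) (j : Fin 3) : frenetRaw γ I j s ≠ 0 :=
  InnerProductSpace.gramSchmidt_ne_zero j (linearIndependent_curveDeriv hnd hs)

theorem contDiffOn_frenetRaw {γ : ℝ → E3} {a b : ℝ} (hab : a < b)
    (hγ : ContDiffOn ℝ ∞ γ (Icc a b)) (hnd : NonDegenerateCurve γ (Icc a b)) (j : Fin 3) :
    ContDiffOn ℝ ∞ (frenetRaw γ (Icc a b) j) (Icc a b) := by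
  induction j using WellFoundedLT.induction with
  | ind j ih =>
    have e : ∀ s, frenetRaw γ (Icc a b) j s = curveDeriv γ (Icc a b) (j.val + 1) s -
        ∑ i ∈ Finset.Iio j, (inner ℝ (frenetRaw γ (Icc a b) i s) (curveDeriv γ (Icc a b) (j.val + 1) s) /
          ‖frenetRaw γ (Icc a b) i s‖ ^ 2) • frenetRaw γ (Icc a b) i s := by
      intro s
      have := InnerProductSpace.gramSchmidt_def'' ℝ
        (fun k : Fin 3 => curveDeriv γ (Icc a b) (k.val + 1) s) j
      rw [eq_sub_iff_add_eq]
      exact this.symm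
    rw [funext e]
    refine (contDiffOn_curveDeriv hab hγ _).sub (ContDiffOn.sum fun i hi => ?_)
    have hi' := ih i (Finset.mem_Iio.1 hi)
    refine ContDiffOn.smul (ContDiffOn.div (hi'.inner ℝ (contDiffOn_curveDeriv hab hγ _))
      (hi'.norm_sq ℝ) fun s hs => ?_) hi'
    have := norm_pos_iff.2 (frenetRaw_ne_zero hnd hs i)
    positivity

theorem contDiffOn_frenet {γ : ℝ → E3} {a b : ℝ} (hab : a < b)
    (hγ : ContDiffOn ℝ ∞ γ (Icc a b)) (hnd : NonDegenerateCurve γ (Icc a b)) (j : Fin 3) :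
    ContDiffOn ℝ ∞ (frenet γ (Icc a b) j) (Icc a b) := by
  have h := contDiffOn_frenetRaw hab hγ hnd j
  rw [funext (frenet_eq γ (Icc a b) j)]
  exact ContDiffOn.smul ((h.norm ℝ fun s hs => frenetRaw_ne_zero hnd hs j).inv fun s hs =>
    norm_ne_zero_iff.2 (frenetRaw_ne_zero hnd hs j)) h

theorem orthonormal_frenet {γ : ℝ → E3} {I : Set ℝ} (hnd : NonDegenerateCurve γ I)
    {s : ℝ} (hs : s ∈ I) : Orthonormal ℝ fun j => frenet γ I j s :=
  InnerProductSpace.gramSchmidtNormed_orthonormal (linearIndependent_curveDeriv hnd hs)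

theorem inner_frenetRaw {γ : ℝ → E3} {I : Set ℝ} {i j : Fin 3} (hij : i < j) (s : ℝ) :
    inner ℝ (curveDeriv γ I (i.val + 1) s) (frenetRaw γ I j s) = 0 := by
  have := InnerProductSpace.gramSchmidt_inv_triangular (𝕜 := ℝ)
    (fun k : Fin 3 => curveDeriv γ I (k.val + 1) s) hij
  rw [real_inner_comm]
  exact this

theorem inner_frenet_of_lt {γ : ℝ → E3} {I : Set ℝ} {i j : Fin 3} (hij : i < j) (s : ℝ) :
    inner ℝ (curveDeriv γ I (i.val + 1) s) (frenet γ I j s) = 0 := by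
  rw [frenet_eq, inner_smul_right, inner_frenetRaw hij, mul_zero]

/-- The derivative of order j + 1 is its Gram–Schmidt remainder plus a combination of the earlier
orthogonal vectors, so this product is the length of the remainder. -/
theorem inner_frenet_self_pos {γ : ℝ → E3} {I : Set ℝ} (hnd : NonDegenerateCurve γ I) {s : ℝ}
    (hs : s ∈ I) (j : Fin 3) : 0 < inner ℝ (curveDeriv γ I (j.val + 1) s) (frenet γ I j s) := by
  have h0 := norm_pos_iff.2 (frenetRaw_ne_zero hnd hs j)
  have h1 : inner ℝ (curveDeriv γ I (j.val + 1) s) (frenetRaw γ I j s) =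
      ‖frenetRaw γ I j s‖ ^ 2 := by
    have e := InnerProductSpace.gramSchmidt_def'' ℝ
        (fun k : Fin 3 => curveDeriv γ I (k.val + 1) s) j
    rw [e, inner_add_left, sum_inner, Finset.sum_eq_zero, add_zero]
    · exact real_inner_self_eq_norm_sq _
    · intro i hi
      rw [inner_smul_left]
      have := InnerProductSpace.gramSchmidt_orthogonal ℝ
        (fun k : Fin 3 => curveDeriv γ I (k.val + 1) s) (Finset.mem_Iio.1 hi).ne
      rw [frenetRaw, this, mul_zero]
  rw [frenet_eq, inner_smul_right, h1]
  positivity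

theorem inner_deriv_eq_neg {u v : ℝ → E3} {u' v' : E3} {a b s k : ℝ} (hab : a < b)
    (hs : s ∈ Icc a b) (hu : HasDerivWithinAt u u' (Icc a b) s)
    (hv : HasDerivWithinAt v v' (Icc a b) s) (h : ∀ t ∈ Icc a b, inner ℝ (u t) (v t) = k) :
    inner ℝ u' (v s) = -inner ℝ (u s) v' := by
  have h1 := hu.inner ℝ hv
  have h2 : HasDerivWithinAt (fun t => inner ℝ (u t) (v t)) 0 (Icc a b) s :=
    (hasDerivWithinAt_const s (Icc a b) k).congr h (h s hs)
  have h3 := (uniqueDiffOn_Icc hab s hs).eq_deriv _ h1 h2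
  linarith

theorem Orthonormal.eq_sum_three {e : Fin 3 → E3} (he : Orthonormal ℝ e) (y : E3) :
    y = inner ℝ y (e 0) • e 0 + inner ℝ y (e 1) • e 1 + inner ℝ y (e 2) • e 2 := by
  have hs : ⊤ ≤ Submodule.span ℝ (Set.range e) := by
    have := he.linearIndependent.span_eq_top_of_card_eq_finrank' (by simp)
    exact this.ge
  set B := OrthonormalBasis.mk he hs with hB
  have h := B.sum_repr' y
  rw [Fin.sum_univ_three] at h
  simp only [hB, OrthonormalBasis.coe_mk] at h
  rw [real_inner_comm (e 0), real_inner_comm (e 1), real_inner_comm (e 2)]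
  exact h.symm

/-- Differentiating the orthonormality relations makes the matrix of frame derivatives
antisymmetric. Differentiating the vanishing products of γ', γ'' with later frame vectors shows that
the entry (0,2) is zero and that the two others are positive. Compactness of the interval supplies c
and L. -/
theorem exists_frenetBounds {γ : ℝ → E3} {a b : ℝ} (hab : a < b)
    (hγ : ContDiffOn ℝ ∞ γ (Icc a b)) (hnd : NonDegenerateCurve γ (Icc a b)) :
    ∃ (α τ : ℝ → ℝ) (c L : ℝ), FrenetBounds (Icc a b) (frenet γ (Icc a b)) α τ c L := by
  set I := Icc a b with hI
  set e := frenet γ I with he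
  have hsm : ∀ j, ContDiffOn ℝ ∞ (e j) I := contDiffOn_frenet hab hγ hnd
  have hd : ∀ j, ∀ s ∈ I, HasDerivWithinAt (e j) (derivWithin (e j) I s) I s := fun j s hs =>
    ((hsm j).differentiableOn (by simp) s hs).hasDerivWithinAt
  have hon : ∀ s ∈ I, Orthonormal ℝ fun j => e j s := fun s hs => orthonormal_frenet hnd hs
  have horth : ∀ i j, i ≠ j → ∀ s ∈ I, inner ℝ (e i s) (e j s) = 0 := fun i j hij s hs =>
    (hon s hs).2 hij
  have hone : ∀ i, ∀ s ∈ I, inner ℝ (e i s) (e i s) = (1 : ℝ) := fun i s hs => by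
    rw [real_inner_self_eq_norm_sq, (hon s hs).1 i]; norm_num
  have hg := fun k s (hs : s ∈ I) => hasDerivWithinAt_curveDeriv hab hγ k hs
  set α : ℝ → ℝ := fun s => inner ℝ (derivWithin (e 0) I s) (e 1 s) with hα
  set τ : ℝ → ℝ := fun s => inner ℝ (derivWithin (e 1) I s) (e 2 s) with hτ
  have hdsm : ∀ j, ContDiffOn ℝ ∞ (derivWithin (e j) I) I := fun j =>
    (hsm j).derivWithin (uniqueDiffOn_Icc hab) (by simp)
  have hαs : ContDiffOn ℝ ∞ α I := (hdsm 0).inner ℝ (hsm 1)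
  have hτs : ContDiffOn ℝ ∞ τ I := (hdsm 1).inner ℝ (hsm 2)
  have hself : ∀ j, ∀ s ∈ I, inner ℝ (derivWithin (e j) I s) (e j s) = 0 := by
    intro j s hs
    have := inner_deriv_eq_neg hab hs (hd j s hs) (hd j s hs) (hone j)
    rw [real_inner_comm (e j s)] at this
    rw [real_inner_comm (e j s)]
    linarith
  have hanti : ∀ i j, i ≠ j → ∀ s ∈ I, inner ℝ (derivWithin (e i) I s) (e j s) =
      -inner ℝ (derivWithin (e j) I s) (e i s) := by
    intro i j hij s hs
    rw [inner_deriv_eq_neg hab hs (hd i s hs) (hd j s hs) (horth i j hij),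
      real_inner_comm]
  have hlt : ∀ i j : Fin 3, i < j → ∀ s ∈ I,
      inner ℝ (curveDeriv γ I (i.val + 2) s) (e j s) =
        -inner ℝ (curveDeriv γ I (i.val + 1) s) (derivWithin (e j) I s) := fun i j hij s hs =>
    inner_deriv_eq_neg hab hs (hg _ s hs) (hd j s hs) fun t _ => inner_frenet_of_lt hij t
  have hpos : ∀ j, ∀ s ∈ I, 0 < inner ℝ (curveDeriv γ I (j.val + 1) s) (e j s) := fun j s hs =>
    inner_frenet_self_pos hnd hs j
  have hγ1 : ∀ s ∈ I, curveDeriv γ I 1 s = inner ℝ (curveDeriv γ I 1 s) (e 0 s) • e 0 s := by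
    intro s hs
    conv_lhs => rw [(hon s hs).eq_sum_three (curveDeriv γ I 1 s)]
    have h1 := inner_frenet_of_lt (γ := γ) (I := I) (i := 0) (j := 1) (by decide) s
    have h2 := inner_frenet_of_lt (γ := γ) (I := I) (i := 0) (j := 2) (by decide) s
    simp only [Fin.val_zero, zero_add] at h1 h2
    rw [h1, h2]
    simp
  have hγ2 : ∀ s ∈ I, curveDeriv γ I 2 s = inner ℝ (curveDeriv γ I 2 s) (e 0 s) • e 0 s +
      inner ℝ (curveDeriv γ I 2 s) (e 1 s) • e 1 s := by
    intro s hs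
    conv_lhs => rw [(hon s hs).eq_sum_three (curveDeriv γ I 2 s)]
    have h2 := inner_frenet_of_lt (γ := γ) (I := I) (i := 1) (j := 2) (by decide) s
    simp only [Fin.val_one, Nat.reduceAdd] at h2
    rw [h2]
    simp
  have hγ1' : ∀ s ∈ I, ∀ x, inner ℝ (curveDeriv γ I 1 s) x =
      inner ℝ (curveDeriv γ I 1 s) (e 0 s) * inner ℝ x (e 0 s) := by
    intro s hs x
    conv_lhs => rw [hγ1 s hs]
    rw [real_inner_smul_left, real_inner_comm x]
  have hγ2' : ∀ s ∈ I, ∀ x, inner ℝ (curveDeriv γ I 2 s) x =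
      inner ℝ (curveDeriv γ I 2 s) (e 0 s) * inner ℝ x (e 0 s) +
        inner ℝ (curveDeriv γ I 2 s) (e 1 s) * inner ℝ x (e 1 s) := by
    intro s hs x
    conv_lhs => rw [hγ2 s hs]
    rw [inner_add_left, real_inner_smul_left, real_inner_smul_left, real_inner_comm x,
      real_inner_comm x]
  have hp0 : ∀ s ∈ I, 0 < inner ℝ (curveDeriv γ I 1 s) (e 0 s) := fun s hs => hpos 0 s hs
  have hp1 : ∀ s ∈ I, 0 < inner ℝ (curveDeriv γ I 2 s) (e 1 s) := fun s hs => hpos 1 s hs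
  have hp2 : ∀ s ∈ I, 0 < inner ℝ (curveDeriv γ I 3 s) (e 2 s) := fun s hs => hpos 2 s hs
  -- ⟨γ'', e_1⟩ = -⟨γ', e_1'⟩ = ⟨γ', e_0⟩ α, and both products are positive.
  have hαpos : ∀ s ∈ I, 0 < α s := by
    intro s hs
    have h1 : inner ℝ (curveDeriv γ I 2 s) (e 1 s) =
        -inner ℝ (curveDeriv γ I 1 s) (derivWithin (e 1) I s) := hlt 0 1 (by decide) s hs
    have h2 : α s = _ := hanti 0 1 (by decide) s hs
    rw [hγ1' s hs] at h1
    have h3 : inner ℝ (curveDeriv γ I 1 s) (e 0 s) * α s = inner ℝ (curveDeriv γ I 2 s) (e 1 s) := by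
      rw [h1, h2]; ring
    exact pos_of_mul_pos_right (h3 ▸ hp1 s hs) (hp0 s hs).le
  have h02 : ∀ s ∈ I, inner ℝ (derivWithin (e 0) I s) (e 2 s) = 0 := by
    intro s hs
    have h1 : inner ℝ (curveDeriv γ I 2 s) (e 2 s) =
        -inner ℝ (curveDeriv γ I 1 s) (derivWithin (e 2) I s) := hlt 0 2 (by decide) s hs
    have h0 : inner ℝ (curveDeriv γ I 2 s) (e 2 s) = 0 :=
      inner_frenet_of_lt (γ := γ) (I := I) (i := 1) (j := 2) (by decide) s
    rw [h0, hγ1' s hs, zero_eq_neg, mul_eq_zero] at h1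
    rw [hanti 0 2 (by decide) s hs, h1.resolve_left (hp0 s hs).ne', neg_zero]
  -- ⟨γ''', e_2⟩ = -⟨γ'', e_2'⟩ = ⟨γ'', e_1⟩ τ, since e_2' has no e_0 component.
  have hτpos : ∀ s ∈ I, 0 < τ s := by
    intro s hs
    have h1 : inner ℝ (curveDeriv γ I 3 s) (e 2 s) =
        -inner ℝ (curveDeriv γ I 2 s) (derivWithin (e 2) I s) := hlt 1 2 (by decide) s hs
    have h2 : τ s = _ := hanti 1 2 (by decide) s hs
    have h4 := hanti 0 2 (by decide) s hs
    rw [h02 s hs, zero_eq_neg] at h4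
    rw [hγ2' s hs, h4, mul_zero, zero_add] at h1
    have h3 : inner ℝ (curveDeriv γ I 2 s) (e 1 s) * τ s = inner ℝ (curveDeriv γ I 3 s) (e 2 s) := by
      rw [h1, h2]; ring
    exact pos_of_mul_pos_right (h3 ▸ hp2 s hs) (hp1 s hs).le
  have hne : I.Nonempty := nonempty_Icc.2 hab.le
  obtain ⟨s₁, hs₁, hm₁⟩ := isCompact_Icc.exists_isMinOn hne hαs.continuousOn
  obtain ⟨s₂, hs₂, hm₂⟩ := isCompact_Icc.exists_isMinOn hne hτs.continuousOn
  obtain ⟨s₃, hs₃, hm₃⟩ := isCompact_Icc.exists_isMaxOn hne hαs.continuousOn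
  obtain ⟨s₄, hs₄, hm₄⟩ := isCompact_Icc.exists_isMaxOn hne hτs.continuousOn
  obtain ⟨L₁, hL₁⟩ := exists_lipschitz_of_contDiffOn hab hαs
  obtain ⟨L₂, hL₂⟩ := exists_lipschitz_of_contDiffOn hab hτs
  choose L₃ hL₃ using fun j => exists_lipschitz_of_contDiffOn hab (hsm j)
  set L : ℝ := 1 + |α s₃| + |τ s₄| + |L₁| + |L₂| + ∑ j, |L₃ j| with hL
  have hn : ∀ j, |L₃ j| ≤ ∑ j, |L₃ j| := fun j =>
    Finset.single_le_sum (f := fun j => |L₃ j|) (fun _ _ => abs_nonneg _) (Finset.mem_univ j)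
  have hn0 : 0 ≤ ∑ j, |L₃ j| := Finset.sum_nonneg fun _ _ => abs_nonneg _
  have p1 := abs_nonneg (α s₃)
  have p2 := abs_nonneg (τ s₄)
  have p3 := abs_nonneg L₁
  have p4 := abs_nonneg L₂
  refine ⟨α, τ, min (α s₁) (τ s₂), L, ⟨lt_min (hαpos _ hs₁) (hτpos _ hs₂), by linarith, hon,
    fun s hs => ?_, fun s hs => ?_, fun s hs => (min_le_left _ _).trans (hm₁ hs),
    fun s hs => (min_le_right _ _).trans (hm₂ hs),
    fun s hs => (show α s ≤ α s₃ from hm₃ hs).trans (by linarith [le_abs_self (α s₃)]),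
    fun s hs => (show τ s ≤ τ s₄ from hm₄ hs).trans (by linarith [le_abs_self (τ s₄)]),
    fun s hs t ht => (hL₁ s hs t ht).trans (mul_le_mul_of_nonneg_right
      (by linarith [le_abs_self L₁]) (abs_nonneg _)),
    fun s hs t ht => (hL₂ s hs t ht).trans (mul_le_mul_of_nonneg_right
      (by linarith [le_abs_self L₂]) (abs_nonneg _)),
    fun j s hs t ht => (hL₃ j s hs t ht).trans (mul_le_mul_of_nonneg_right
      (by linarith [le_abs_self (L₃ j), hn j]) (abs_nonneg _))⟩⟩
  · have h := (hon s hs).eq_sum_three (derivWithin (e 0) I s)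
    rw [hself 0 s hs, h02 s hs, zero_smul, zero_smul, zero_add, add_zero] at h
    have := hd 0 s hs
    rw [h] at this
    exact this
  · have h := (hon s hs).eq_sum_three (derivWithin (e 1) I s)
    have h1 : α s = _ := hanti 0 1 (by decide) s hs
    have h2 : inner ℝ (derivWithin (e 1) I s) (e 0 s) = -α s := by rw [h1, neg_neg]
    rw [hself 1 s hs, h2, zero_smul, add_zero] at h
    have := hd 1 s hs
    rw [h] at this
    exact this

end

section

open scoped SchwartzMap LineDeriv Topology

/-! ### Orthonormal bases from a frame, and maximal operators -/

open Classical in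
/-- The orthonormal basis given by a frame at a point where it is orthonormal. -/
noncomputable def frameBasis (e : Fin 3 → ℝ → E3) (s : ℝ) : OrthonormalBasis (Fin 3) ℝ E3 :=
  if h : Orthonormal ℝ fun j => e j s then
    OrthonormalBasis.mk h (h.linearIndependent.span_eq_top_of_card_eq_finrank' (by simp)).ge
  else EuclideanSpace.basisFun (Fin 3) ℝ

theorem frameBasis_apply {e : Fin 3 → ℝ → E3} {s : ℝ} (h : Orthonormal ℝ fun j => e j s)
    (j : Fin 3) : frameBasis e s j = e j s := by
  rw [frameBasis, dif_pos h, OrthonormalBasis.coe_mk]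

theorem nikodymAvg_eq_lconv {e : Fin 3 → ℝ → E3} {s : ℝ} (h : Orthonormal ℝ fun j => e j s)
    (ρ : Fin 3 → ℝ) (g : E3 → ℝ≥0∞) (x : E3) :
    nikodymAvg e ρ g x s = lconv g (frameWeight (frameBasis e s) ρ) x := by
  simp only [nikodymAvg, lconv, frameWeight, plateWeight, gauge3, frameBasis_apply h]

theorem lconv_le_nikodymMax {I : Set ℝ} {e : Fin 3 → ℝ → E3} {s : ℝ} (hs : s ∈ I)
    (h : Orthonormal ℝ fun j => e j s) (ρ : Fin 3 → ℝ) (g : E3 → ℝ≥0∞) (x : E3) :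
    lconv g (frameWeight (frameBasis e s) ρ) x ≤ nikodymMax I e ρ g x := by
  rw [← nikodymAvg_eq_lconv h]
  exact le_iSup₂ (f := fun s _ => nikodymAvg e ρ g x s) s hs

theorem nikodymMax_le {I : Set ℝ} {e : Fin 3 → ℝ → E3} (h : ∀ s ∈ I, Orthonormal ℝ fun j => e j s)
    {ρ : Fin 3 → ℝ} {g : E3 → ℝ≥0∞} {x : E3} {B : ℝ≥0∞}
    (hB : ∀ s ∈ I, lconv g (frameWeight (frameBasis e s) ρ) x ≤ B) : nikodymMax I e ρ g x ≤ B :=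
  iSup₂_le fun s hs => by rw [nikodymAvg_eq_lconv (h s hs)]; exact hB s hs

theorem nikodymMax_mono {I : Set ℝ} {e : Fin 3 → ℝ → E3} {ρ : Fin 3 → ℝ} {g g' : E3 → ℝ≥0∞}
    (h : ∀ x, g x ≤ g' x) (x : E3) : nikodymMax I e ρ g x ≤ nikodymMax I e ρ g' x :=
  iSup₂_mono fun _ _ => lintegral_mono fun _ => mul_le_mul_left (h _) _

theorem nikodymMax_const_mul {I : Set ℝ} {e : Fin 3 → ℝ → E3} {ρ : Fin 3 → ℝ} {g : E3 → ℝ≥0∞}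
    {C : ℝ≥0∞} (hC : C ≠ ⊤) (x : E3) :
    nikodymMax I e ρ (fun y => C * g y) x = C * nikodymMax I e ρ g x := by
  simp only [nikodymMax, ENNReal.mul_iSup]
  refine iSup_congr fun s => iSup_congr fun _ => ?_
  simp only [nikodymAvg, mul_assoc]
  exact lintegral_const_mul' _ _ hC

/-- Averages ignore null sets, so an almost everywhere measurable weight can be exchanged for a
measurable one without altering the maximal function at any point. -/
theorem nikodymMax_congr_ae {I : Set ℝ} {e : Fin 3 → ℝ → E3} {ρ : Fin 3 → ℝ} {g g' : E3 → ℝ≥0∞}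
    (h : g =ᵐ[volume] g') : nikodymMax I e ρ g = nikodymMax I e ρ g' := by
  funext x
  exact iSup_congr fun s => iSup_congr fun _ => lconv_congr_ae h x

theorem nikodymIter_congr_ae {I : Set ℝ} {e : Fin 3 → ℝ → E3} {r K : ℝ} (m : ℕ)
    {g g' : E3 → ℝ≥0∞} (h : g =ᵐ[volume] g') :
    nikodymIter I e r K m g = nikodymIter I e r K m g' := by
  induction m with
  | zero => exact nikodymMax_congr_ae h
  | succ m ih => simp only [nikodymIter, Function.comp_apply, ih]

theorem forwardMax_congr_ae {γ : ℝ → E3} {I : Set ℝ} {r ε : ℝ} {g g' : E3 → ℝ≥0∞}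
    (h : g =ᵐ[volume] g') : forwardMax γ I r ε g = forwardMax γ I r ε g' := by
  simp only [forwardMax, Function.comp_apply, nikodymIter_congr_ae _ h]

/-- An average over a plate is essentially constant on that plate, hence bounded by its own average.
This supplies the second copy of each N_m in the composed operator. -/
theorem exists_nikodymMax_le_nikodymMax_nikodymMax : ∃ C : ℝ, 0 < C ∧
    ∀ (I : Set ℝ) (e : Fin 3 → ℝ → E3), (∀ s ∈ I, Orthonormal ℝ fun j => e j s) →
    ∀ ρ : Fin 3 → ℝ, (∀ j, 0 < ρ j) → ∀ (g : E3 → ℝ≥0∞) (x : E3),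
    nikodymMax I e ρ g x ≤ ENNReal.ofReal C * nikodymMax I e ρ (nikodymMax I e ρ g) x := by
  obtain ⟨C, hC, h⟩ := exists_lconv_le_lconv_lconv 1 zero_le_one
  refine ⟨C, hC, fun I e he ρ hρ g x => nikodymMax_le he fun s hs => ?_⟩
  refine (h _ _ ρ ρ hρ hρ (fun z => (one_mul _).ge) _ _ (Or.inl rfl) (Or.inl rfl) g x).trans ?_
  gcongr
  exact (lconv_mono (fun y => lconv_le_nikodymMax hs (he s hs) ρ g y) x).trans
    (lconv_le_nikodymMax hs (he s hs) ρ _ x)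

theorem norm_le_sum_abs_inner (b : OrthonormalBasis (Fin 3) ℝ E3) (z : E3) :
    ‖z‖ ≤ ∑ i, |inner ℝ (b i) z| := by
  conv_lhs => rw [← b.sum_repr' z]
  refine (norm_sum_le _ _).trans (Finset.sum_le_sum fun i _ => ?_)
  rw [norm_smul, b.norm_eq_one, mul_one, Real.norm_eq_abs]

theorem abs_inner_sub_le {I : Set ℝ} {e : Fin 3 → ℝ → E3} {a τ : ℝ → ℝ} {c L : ℝ}
    (hF : FrenetBounds I e a τ c L) {s t : ℝ} (hs : s ∈ I) (ht : t ∈ I) (j : Fin 3) (z : E3) :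
    |inner ℝ (e j s) z - inner ℝ (e j t) z| ≤ L * |s - t| * ‖z‖ := by
  rw [← inner_sub_left]
  exact (abs_real_inner_le_norm _ _).trans
    (mul_le_mul_of_nonneg_right (hF.lipschitz j s hs t ht) (norm_nonneg _))

/-- Turning the frame from t to s moves each coordinate by at most L|s - t|‖z‖. With ‖z‖ expanded in
the frame at t, the hypothesis lets each ρ_i absorb ρ_j|s - t|. -/
theorem FrenetBounds.gauge3_le {I : Set ℝ} {e : Fin 3 → ℝ → E3} {a τ : ℝ → ℝ} {c L : ℝ}
    (hF : FrenetBounds I e a τ c L) {s t : ℝ} (hs : s ∈ I) (ht : t ∈ I) {ρ : Fin 3 → ℝ}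
    (hρ : ∀ j, 0 < ρ j) {B : ℝ} (hB : ∀ i j, ρ j * |s - t| ≤ B * ρ i) (z : E3) :
    gauge3 (frameBasis e s) ρ z ≤ (1 + 3 * L * B) * gauge3 (frameBasis e t) ρ z := by
  have hL : 0 ≤ L := zero_le_one.trans hF.one_le
  have key : ∀ j, ρ j * |inner ℝ (frameBasis e s j) z| ≤
      ρ j * |inner ℝ (frameBasis e t j) z| + L * B * gauge3 (frameBasis e t) ρ z := by
    intro j
    have h1 : |inner ℝ (frameBasis e s j) z| ≤ |inner ℝ (frameBasis e t j) z| +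
        L * |s - t| * ‖z‖ := by
      rw [frameBasis_apply (hF.orthonormal s hs), frameBasis_apply (hF.orthonormal t ht)]
      have := abs_inner_sub_le hF hs ht j z
      have := abs_sub_abs_le_abs_sub (inner ℝ (e j s) z) (inner ℝ (e j t) z)
      linarith
    have h2 : ρ j * (|s - t| * ‖z‖) ≤ B * gauge3 (frameBasis e t) ρ z := by
      calc ρ j * (|s - t| * ‖z‖) ≤ ρ j * |s - t| * ∑ i, |inner ℝ (frameBasis e t i) z| := by
            rw [mul_assoc]
            exact mul_le_mul_of_nonneg_left (mul_le_mul_of_nonneg_left (norm_le_sum_abs_inner _ z)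
              (abs_nonneg _)) (hρ j).le
        _ = ∑ i, ρ j * |s - t| * |inner ℝ (frameBasis e t i) z| := Finset.mul_sum _ _ _
        _ ≤ ∑ i, B * (ρ i * |inner ℝ (frameBasis e t i) z|) := Finset.sum_le_sum fun i _ => by
            rw [← mul_assoc]
            exact mul_le_mul_of_nonneg_right (hB i j) (abs_nonneg _)
        _ = B * gauge3 (frameBasis e t) ρ z := by rw [← Finset.mul_sum]; rfl
    have h3 := mul_le_mul_of_nonneg_left h1 (hρ j).le
    have h4 := mul_le_mul_of_nonneg_left h2 hL
    nlinarith [h3, h4]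
  calc gauge3 (frameBasis e s) ρ z = ∑ j, ρ j * |inner ℝ (frameBasis e s j) z| := rfl
    _ ≤ ∑ j, (ρ j * |inner ℝ (frameBasis e t j) z| + L * B * gauge3 (frameBasis e t) ρ z) :=
        Finset.sum_le_sum fun j _ => key j
    _ = gauge3 (frameBasis e t) ρ z + 3 * (L * B * gauge3 (frameBasis e t) ρ z) := by
        rw [Finset.sum_add_distrib]
        simp [gauge3]
    _ = _ := by ring

theorem FrenetBounds.gauge3_scale_le {I : Set ℝ} {e : Fin 3 → ℝ → E3} {a τ : ℝ → ℝ} {c L : ℝ}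
    (hF : FrenetBounds I e a τ c L) {s t : ℝ} (hs : s ∈ I) (ht : t ∈ I) {R κ : ℝ}
    (hR : 0 < R) (hκ : 0 < κ) (h1 : κ * |s - t| ≤ R) (h2 : R * |s - t| ≤ κ) (h3 : |s - t| ≤ 1)
    (z : E3) :
    gauge3 (frameBasis e s) ![R, κ, κ] z ≤ (1 + 3 * L) * gauge3 (frameBasis e t) ![R, κ, κ] z := by
  have hR' : R * |s - t| ≤ R := mul_le_of_le_one_right hR.le h3
  have hκ' : κ * |s - t| ≤ κ := mul_le_of_le_one_right hκ.le h3
  have := hF.gauge3_le hs ht (ρ := ![R, κ, κ]) (B := 1)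
    (fun j => by fin_cases j <;> simpa) (fun i j => by
      fin_cases i <;> fin_cases j <;> simpa) z
  simpa using this

/-! ### Rounding to a grid -/

/-- The largest point of the grid `t₀ + δℕ` that is at most `s`. -/
noncomputable def gridRound (t₀ δ s : ℝ) : ℝ := t₀ + ⌊(s - t₀) / δ⌋₊ * δ

theorem le_gridRound {t₀ δ s : ℝ} (hδ : 0 < δ) : t₀ ≤ gridRound t₀ δ s := by
  unfold gridRound; have : (0 : ℝ) ≤ ⌊(s - t₀) / δ⌋₊ * δ := by positivity
  linarith

theorem gridRound_le {t₀ δ s : ℝ} (hδ : 0 < δ) (h : t₀ ≤ s) : gridRound t₀ δ s ≤ s := by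
  have := Nat.floor_le (div_nonneg (sub_nonneg.2 h) hδ.le)
  rw [le_div_iff₀ hδ] at this
  unfold gridRound
  linarith

theorem lt_gridRound_add {t₀ δ s : ℝ} (hδ : 0 < δ) : s < gridRound t₀ δ s + δ := by
  have := Nat.lt_floor_add_one ((s - t₀) / δ)
  rw [div_lt_iff₀ hδ] at this
  unfold gridRound
  linarith

theorem abs_sub_gridRound_le {t₀ δ s : ℝ} (hδ : 0 < δ) (h : t₀ ≤ s) :
    |s - gridRound t₀ δ s| ≤ δ := by
  have h1 := gridRound_le hδ h
  have h2 := lt_gridRound_add (t₀ := t₀) (s := s) hδ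
  rw [abs_of_nonneg (by linarith)]
  linarith

theorem gridRound_separated {t₀ δ s t : ℝ} (hδ : 0 < δ)
    (h : gridRound t₀ δ s ≠ gridRound t₀ δ t) : δ ≤ |gridRound t₀ δ s - gridRound t₀ δ t| := by
  unfold gridRound at h ⊢
  have hne : (⌊(s - t₀) / δ⌋₊ : ℤ) ≠ ⌊(t - t₀) / δ⌋₊ := by
    intro e
    apply h
    rw [Int.natCast_inj.1 e]
  have h1 : (1 : ℝ) ≤ |((⌊(s - t₀) / δ⌋₊ : ℤ) : ℝ) - ((⌊(t - t₀) / δ⌋₊ : ℤ) : ℝ)| := by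
    exact_mod_cast Int.one_le_abs (sub_ne_zero.2 hne)
  push_cast at h1
  rw [show t₀ + (⌊(s - t₀) / δ⌋₊ : ℝ) * δ - (t₀ + ⌊(t - t₀) / δ⌋₊ * δ) =
    ((⌊(s - t₀) / δ⌋₊ : ℝ) - ⌊(t - t₀) / δ⌋₊) * δ by ring, abs_mul, abs_of_pos hδ]
  exact le_mul_of_one_le_left hδ.le h1

/-- A half-open cell of length δ contains at most one of the points, and the floor numbers the
cells. -/
theorem card_le_of_separated {T : Finset ℝ} {δ ℓ t₀ : ℝ} (hδ : 0 < δ) (hℓ : 0 ≤ ℓ)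
    (hT : ∀ s ∈ T, t₀ ≤ s ∧ s ≤ t₀ + ℓ) (hsep : (T : Set ℝ).Pairwise fun s t => δ ≤ |s - t|) :
    (T.card : ℝ) ≤ ℓ / δ + 1 := by
  have hmaps : ∀ s ∈ T, ⌊(s - t₀) / δ⌋₊ ∈ Finset.range (⌊ℓ / δ⌋₊ + 1) := by
    intro s hs
    rw [Finset.mem_range, Nat.lt_add_one_iff]
    refine Nat.floor_le_floor (div_le_div_of_nonneg_right ?_ hδ.le)
    linarith [(hT s hs).2]
  have hinj : (T : Set ℝ).InjOn fun s => ⌊(s - t₀) / δ⌋₊ := by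
    intro s hs t ht hst
    by_contra hne
    have h0 := hsep hs ht hne
    have hst' : ⌊(s - t₀) / δ⌋₊ = ⌊(t - t₀) / δ⌋₊ := hst
    have h1 := gridRound_le hδ (hT s hs).1
    have h2 := lt_gridRound_add (t₀ := t₀) (s := s) hδ
    have h3 := gridRound_le hδ (hT t ht).1
    have h4 := lt_gridRound_add (t₀ := t₀) (s := t) hδ
    unfold gridRound at h1 h2 h3 h4
    rw [hst'] at h1 h2
    have : |s - t| < δ := abs_lt.2 ⟨by linarith, by linarith⟩
    linarith
  have h := Finset.card_le_card_of_injOn _ hmaps hinj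
  rw [Finset.card_range] at h
  have h' : (T.card : ℝ) ≤ ⌊ℓ / δ⌋₊ + 1 := by exact_mod_cast h
  linarith [Nat.floor_le (div_nonneg hℓ hδ.le)]

theorem finite_of_separated {T : Set ℝ} {δ a b : ℝ} (hδ : 0 < δ) (hT : T ⊆ Icc a b)
    (hsep : T.Pairwise fun s t => δ ≤ |s - t|) : T.Finite := by
  by_contra hinf
  obtain ⟨S, hS, hcard⟩ := (show T.Infinite from hinf).exists_subset_card_eq
    (⌊|b - a| / δ + 1⌋₊ + 1)
  have h1 := card_le_of_separated (T := S) (t₀ := a) hδ (abs_nonneg (b - a))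
    (fun s hs => ⟨(hT (hS hs)).1, by linarith [(hT (hS hs)).2, le_abs_self (b - a)]⟩)
    (hsep.mono hS)
  rw [hcard] at h1
  push_cast at h1
  linarith [Nat.lt_floor_add_one (|b - a| / δ + 1)]

end

section

open scoped SchwartzMap LineDeriv Topology

/-! ### Multipliers adapted to the cone generated by the first frame vector -/

/-- The profile `η(t) η(‖ζ‖²/4θ) η(u/4) (1 - η(64θu))`. -/
noncomputable def coneSymbol (η : ℝ → ℝ) (θ : ℝ) (p : ℝ × E3 × ℝ) : ℝ :=
  η p.1 * (η (‖p.2.1‖ ^ 2 / (4 * θ)) * η (p.2.2 / 4) * (1 - η (64 * θ * p.2.2)))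

theorem contDiff_coneSymbol {η : ℝ → ℝ} (hη : IsCutoff η) (θ : ℝ) :
    ContDiff ℝ ∞ (coneSymbol η θ) := by
  have h : ContDiff ℝ ∞ fun p : ℝ × E3 × ℝ => ‖p.2.1‖ ^ 2 :=
    (contDiff_fst.comp contDiff_snd).norm_sq ℝ
  have h2 : ContDiff ℝ ∞ fun p : ℝ × E3 × ℝ => p.2.2 := contDiff_snd.comp contDiff_snd
  unfold coneSymbol
  exact (hη.smooth.comp contDiff_fst).mul (((hη.smooth.comp (h.div_const _)).mul
    (hη.smooth.comp (h2.div_const _))).mul (contDiff_const.sub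
      (hη.smooth.comp (contDiff_const.mul h2))))

theorem IsCutoff.abs_lt {η : ℝ → ℝ} (hη : IsCutoff η) {u : ℝ} (hu : η u ≠ 0) : |u| < 2 := by
  by_contra h
  exact hu (hη.eq_zero (not_lt.1 h))

theorem IsCutoff.one_lt_abs {η : ℝ → ℝ} (hη : IsCutoff η) {u : ℝ} (hu : 1 - η u ≠ 0) : 1 < |u| := by
  by_contra h
  exact hu (by rw [hη.eq_one u (abs_le.1 (not_lt.1 h)), sub_self])

theorem coneSymbol_ne_zero {η : ℝ → ℝ} (hη : IsCutoff η) {θ : ℝ} (hθ : 0 < θ) {p : ℝ × E3 × ℝ}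
    (hp : coneSymbol η θ p ≠ 0) :
    |p.1| < 2 ∧ ‖p.2.1‖ ^ 2 < 8 * θ ∧ |p.2.2| < 8 ∧ 1 / (64 * θ) < |p.2.2| := by
  unfold coneSymbol at hp
  simp only [ne_eq, mul_eq_zero, not_or] at hp
  obtain ⟨h1, ⟨h2, h3⟩, h4⟩ := hp
  have h2 := hη.abs_lt h2
  have h3 := hη.abs_lt h3
  have h4 := hη.one_lt_abs h4
  rw [abs_of_nonneg (by positivity), div_lt_iff₀ (by positivity)] at h2
  rw [abs_div, abs_of_pos (by norm_num : (0 : ℝ) < 4), div_lt_iff₀ (by norm_num)] at h3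
  rw [abs_mul, abs_of_pos (by positivity : (0 : ℝ) < 64 * θ)] at h4
  refine ⟨hη.abs_lt h1, by linarith, by linarith, ?_⟩
  rw [div_lt_iff₀ (by positivity), mul_comm]
  exact h4

theorem hasCompactSupport_coneSymbol {η : ℝ → ℝ} (hη : IsCutoff η) {θ : ℝ} (hθ : 0 < θ) :
    HasCompactSupport (coneSymbol η θ) := by
  refine HasCompactSupport.intro (K := Icc (-2) 2 ×ˢ Metric.closedBall (0 : E3) (8 * θ + 1) ×ˢ
    Icc (-8) 8) (isCompact_Icc.prod ((isCompact_closedBall _ _).prod isCompact_Icc)) fun p hp => ?_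
  by_contra h
  obtain ⟨h1, h2, h3, -⟩ := coneSymbol_ne_zero hη hθ h
  refine hp ⟨abs_le.1 h1.le, ?_, abs_le.1 h3.le⟩
  rw [mem_closedBall_zero_iff]
  nlinarith [norm_nonneg p.2.1]

theorem exists_bound_iteratedFDeriv {G : Type*} [NormedAddCommGroup G] [NormedSpace ℝ G]
    {F : G → ℂ} (hF : ContDiff ℝ ∞ F) (hc : HasCompactSupport F) (N : ℕ) :
    ∃ D : ℝ, 0 < D ∧ ∀ n ≤ N, ∀ x, ‖iteratedFDeriv ℝ n F x‖ ≤ D := by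
  choose D hD using fun n => (hc.iteratedFDeriv (𝕜 := ℝ) n).exists_bound_of_continuous
    (hF.continuous_iteratedFDeriv (m := n) (by exact_mod_cast le_top))
  refine ⟨1 + ∑ n ∈ Finset.range (N + 1), |D n|, by positivity, fun n hn x => ?_⟩
  have := Finset.single_le_sum (f := fun n => |D n|) (fun _ _ => abs_nonneg _)
    (Finset.mem_range.2 (Nat.lt_succ_of_le hn))
  linarith [hD n x, le_abs_self (D n)]

/-- The linear map `ξ ↦ (δ⁻¹⟨u,ξ⟩, ξ, ⟨v,ξ⟩)`. -/
noncomputable def coneMap (δ : ℝ) (u v : E3) : E3 →L[ℝ] ℝ × E3 × ℝ :=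
  (δ⁻¹ • innerSL ℝ u).prod ((ContinuousLinearMap.id ℝ E3).prod (innerSL ℝ v))

theorem coneMap_apply (δ : ℝ) (u v ξ : E3) :
    coneMap δ u v ξ = (δ⁻¹ * inner ℝ u ξ, ξ, inner ℝ v ξ) := rfl

theorem exists_fourier_eq {f : E3 → ℂ} (hf : ContDiff ℝ ∞ f) (hc : HasCompactSupport f) :
    ∃ k : 𝓢(E3, ℂ), ∀ ξ, (𝓕 k : 𝓢(E3, ℂ)) ξ = f ξ := by
  refine ⟨𝓕⁻ (hc.toSchwartzMap hf), fun ξ => ?_⟩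
  rw [FourierTransform.fourier_fourierInv_eq]
  rfl

theorem exists_coneKernel {η : ℝ → ℝ} (hη : IsCutoff η) {θ : ℝ} (hθ : 0 < θ) (δ : ℝ) (u v : E3) :
    ∃ k : 𝓢(E3, ℂ), ∀ ξ, (𝓕 k : 𝓢(E3, ℂ)) ξ = (coneSymbol η θ (coneMap δ u v ξ) : ℂ) := by
  refine exists_fourier_eq (f := fun ξ => (coneSymbol η θ (coneMap δ u v ξ) : ℂ))
    (Complex.ofRealCLM.contDiff.comp ((contDiff_coneSymbol hη θ).comp
      (coneMap δ u v).contDiff)) ?_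
  refine HasCompactSupport.intro (isCompact_closedBall (0 : E3) (8 * θ + 1)) fun ξ hξ => ?_
  by_contra h
  have h' : coneSymbol η θ (coneMap δ u v ξ) ≠ 0 := fun e => h (by rw [e, Complex.ofReal_zero])
  obtain ⟨-, h2, -⟩ := coneSymbol_ne_zero hη hθ h'
  rw [coneMap_apply] at h2
  refine hξ ?_
  rw [mem_closedBall_zero_iff]
  nlinarith [norm_nonneg ξ]

/-- A kernel with Fourier transform `coneSymbol η θ (δ⁻¹⟨u,ξ⟩, ξ, ⟨v,ξ⟩)`. -/
noncomputable def coneKernel {η : ℝ → ℝ} (hη : IsCutoff η) {θ : ℝ} (hθ : 0 < θ) (δ : ℝ)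
    (u v : E3) : 𝓢(E3, ℂ) := (exists_coneKernel hη hθ δ u v).choose

theorem fourier_coneKernel {η : ℝ → ℝ} (hη : IsCutoff η) {θ : ℝ} (hθ : 0 < θ) (δ : ℝ) (u v ξ : E3) :
    (𝓕 (coneKernel hη hθ δ u v) : 𝓢(E3, ℂ)) ξ = (coneSymbol η θ (coneMap δ u v ξ) : ℂ) :=
  (exists_coneKernel hη hθ δ u v).choose_spec ξ

/-- Non-strict inequalities survive the closure in `tsupport`, and it is the closed support that the
overlap count must control. -/
theorem mem_tsupport_coneKernel {η : ℝ → ℝ} (hη : IsCutoff η) {θ : ℝ} (hθ : 0 < θ) {δ : ℝ}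
    (hδ : 0 < δ) {u v ξ : E3} (hξ : ξ ∈ tsupport (𝓕 (coneKernel hη hθ δ u v) : 𝓢(E3, ℂ))) :
    |inner ℝ u ξ| ≤ 2 * δ ∧ ‖ξ‖ ^ 2 ≤ 8 * θ ∧ 1 / (64 * θ) ≤ |inner ℝ v ξ| := by
  have hcl : IsClosed {ξ : E3 | |inner ℝ u ξ| ≤ 2 * δ ∧ ‖ξ‖ ^ 2 ≤ 8 * θ ∧
      1 / (64 * θ) ≤ |inner ℝ v ξ|} := by
    have h1 : IsClosed {ξ : E3 | |inner ℝ u ξ| ≤ 2 * δ} :=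
      isClosed_le (by fun_prop) continuous_const
    have h2 : IsClosed {ξ : E3 | ‖ξ‖ ^ 2 ≤ 8 * θ} := isClosed_le (by fun_prop) continuous_const
    have h3 : IsClosed {ξ : E3 | 1 / (64 * θ) ≤ |inner ℝ v ξ|} :=
      isClosed_le continuous_const (by fun_prop)
    exact h1.inter (h2.inter h3)
  refine closure_minimal (fun ζ hζ => ?_) hcl hξ
  rw [Function.mem_support, fourier_coneKernel] at hζ
  obtain ⟨h1, h2, -, h4⟩ := coneSymbol_ne_zero hη hθ
    (p := coneMap δ u v ζ) (fun e => hζ (by rw [e, Complex.ofReal_zero]))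
  rw [coneMap_apply] at h1 h2 h4
  simp only [abs_mul, abs_of_pos (inv_pos.2 hδ)] at h1
  rw [inv_mul_lt_iff₀ hδ] at h1
  exact ⟨by linarith, h2.le, h4.le⟩

theorem mul_sub_le_of_le_hasDerivWithinAt {f f' : ℝ → ℝ} {a b x y C : ℝ}
    (hf : ∀ s ∈ Icc a b, HasDerivWithinAt f (f' s) (Icc a b) s) (hx : a ≤ x) (hy : y ≤ b)
    (hxy : x ≤ y) (hC : ∀ s ∈ Icc x y, C ≤ f' s) : C * (y - x) ≤ f y - f x := by
  have hsub : Icc x y ⊆ Icc a b := Icc_subset_Icc hx hy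
  have hd : ∀ s ∈ interior (Icc x y), HasDerivAt f (f' s) s := fun s hs =>
    (hf s (hsub (interior_subset hs))).hasDerivAt
      (Filter.mem_of_superset (mem_interior_iff_mem_nhds.1 hs) hsub)
  exact (convex_Icc x y).mul_sub_le_image_sub_of_le_deriv
    (fun s hs => (hf s (hsub hs)).continuousWithinAt.mono hsub)
    (fun s hs => (hd s hs).differentiableAt.differentiableWithinAt)
    (fun s hs => by rw [(hd s hs).deriv]; exact hC s (interior_subset hs))
    x (left_mem_Icc.2 hxy) y (right_mem_Icc.2 hxy) hxy

theorem FrenetBounds.hasDerivWithinAt_inner_zero {I : Set ℝ} {e : Fin 3 → ℝ → E3} {α τ : ℝ → ℝ}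
    {c L : ℝ} (hF : FrenetBounds I e α τ c L) (ξ : E3) {s : ℝ} (hs : s ∈ I) :
    HasDerivWithinAt (fun s => inner ℝ (e 0 s) ξ) (α s * inner ℝ (e 1 s) ξ) I s := by
  have := (hF.deriv_zero s hs).inner ℝ (hasDerivWithinAt_const s I ξ)
  simpa [real_inner_smul_left] using this

theorem FrenetBounds.hasDerivWithinAt_inner_one {I : Set ℝ} {e : Fin 3 → ℝ → E3} {α τ : ℝ → ℝ}
    {c L : ℝ} (hF : FrenetBounds I e α τ c L) (ξ : E3) {s : ℝ} (hs : s ∈ I) :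
    HasDerivWithinAt (fun s => inner ℝ (e 1 s) ξ)
      (-α s * inner ℝ (e 0 s) ξ + τ s * inner ℝ (e 2 s) ξ) I s := by
  have := (hF.deriv_one s hs).inner ℝ (hasDerivWithinAt_const s I ξ)
  simpa [real_inner_smul_left, inner_add_left] using this

section
variable {a b : ℝ} {e : Fin 3 → ℝ → E3} {α τ : ℝ → ℝ} {c L : ℝ}

theorem FrenetBounds.le_abs_inner_zero_sub (hF : FrenetBounds (Icc a b) e α τ c L) {x y μ : ℝ}
    (hx : a ≤ x) (hy : y ≤ b) (hxy : x ≤ y) {ξ : E3} (hμ : 0 ≤ μ)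
    (hξ : ∀ s ∈ Icc x y, μ ≤ inner ℝ (e 1 s) ξ) :
    c * μ * (y - x) ≤ inner ℝ (e 0 y) ξ - inner ℝ (e 0 x) ξ :=
  mul_sub_le_of_le_hasDerivWithinAt (fun _ hs => hF.hasDerivWithinAt_inner_zero ξ hs) hx hy hxy
    fun s hs => mul_le_mul (hF.a_lower s ⟨hx.trans hs.1, hs.2.trans hy⟩) (hξ s hs) hμ
      (hF.c_pos.le.trans (hF.a_lower s ⟨hx.trans hs.1, hs.2.trans hy⟩))

/-- Bounded overlap. On the short arc ⟨e_1(s),ξ⟩ differs from its value at t₀ by at most 4/1024, so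
it keeps its sign and has size at least 1/256. By the Frenet equation ⟨e_0(s),ξ⟩ then moves at speed
at least c/256, and the points with |⟨e_0(s),ξ⟩| ≤ 2AR lie in an interval of length 1024AR/c. -/
theorem FrenetBounds.card_le_of_cone (hF : FrenetBounds (Icc a b) e α τ c L) {t₀ t₁ : ℝ}
    (h₀ : a ≤ t₀) (h₁ : t₁ ≤ b) (hJ : L * (t₁ - t₀) ≤ 1 / 1024) {ξ : E3} (hξ : ‖ξ‖ ^ 2 ≤ 16)
    (hv : 1 / 128 ≤ |inner ℝ (e 1 t₀) ξ|) {A R : ℝ} (hA : 0 < A) (hR : 0 < R) {T : Finset ℝ}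
    (hT : ∀ s ∈ T, s ∈ Icc t₀ t₁) (hsep : (T : Set ℝ).Pairwise fun s t => R ≤ |s - t|)
    (hTξ : ∀ s ∈ T, |inner ℝ (e 0 s) ξ| ≤ 2 * (A * R)) :
    (T.card : ℝ) ≤ 1024 * A / c + 1 := by
  have hc := hF.c_pos
  have hL : 0 ≤ L := zero_le_one.trans hF.one_le
  rcases T.eq_empty_or_nonempty with rfl | hne
  · simp; positivity
  have hξ4 : ‖ξ‖ ≤ 4 := by nlinarith [norm_nonneg ξ]
  set m := T.min' hne with hm
  have hmT : m ∈ T := T.min'_mem hne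
  have hclose : ∀ s ∈ Icc t₀ t₁, |inner ℝ (e 1 s) ξ - inner ℝ (e 1 t₀) ξ| ≤ 1 / 256 := by
    intro s hs
    have h1 := abs_inner_sub_le hF (s := s) (t := t₀) ⟨h₀.trans hs.1, hs.2.trans h₁⟩
      ⟨h₀, (hs.1.trans hs.2).trans h₁⟩ 1 ξ
    have h2 : L * |s - t₀| ≤ 1 / 1024 := by
      rw [abs_of_nonneg (by linarith [hs.1])]
      nlinarith [hs.2]
    nlinarith [norm_nonneg ξ]
  have hgap : ∀ s ∈ T, c * (1 / 256) * (s - m) ≤ 4 * (A * R) := by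
    intro s hs
    have hms : m ≤ s := T.min'_le s hs
    have hb1 := abs_le.1 (hTξ s hs)
    have hb2 := abs_le.1 (hTξ m hmT)
    have hx := h₀.trans (hT m hmT).1
    have hy := (hT s hs).2.trans h₁
    have hin : ∀ z ∈ Icc m s, z ∈ Icc t₀ t₁ := fun z hz =>
      ⟨(hT m hmT).1.trans hz.1, hz.2.trans (hT s hs).2⟩
    rcases le_abs.1 hv with h | h
    · have := hF.le_abs_inner_zero_sub hx hy hms (ξ := ξ) (μ := 1 / 256) (by norm_num)
        fun z hz => by linarith [(abs_le.1 (hclose z (hin z hz))).1]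
      linarith
    · have := hF.le_abs_inner_zero_sub hx hy hms (ξ := -ξ) (μ := 1 / 256) (by norm_num)
        fun z hz => by
          rw [inner_neg_right]
          linarith [(abs_le.1 (hclose z (hin z hz))).2]
      simp only [inner_neg_right] at this
      linarith
  have h := card_le_of_separated (T := T) (t₀ := m) (ℓ := 1024 * A / c * R) hR (by positivity)
    (fun s hs => ⟨T.min'_le s hs, ?_⟩) hsep
  · rwa [mul_div_assoc, div_self hR.ne', mul_one] at h
  · have := hgap s hs
    rw [show 1024 * A / c * R = 1024 * A * R / c by ring, ← sub_le_iff_le_add', le_div_iff₀ hc]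
    nlinarith

/-- This controls the derivatives of the symbol along the plate. The delicate coordinate is the
first: along e_0(σ) it is at most R/(AR), and for j ≠ 0 orthogonality at σ gives |⟨e_0(s), e_j(σ)⟩|
≤ LKR, which the scale K⁻¹ reduces to LR before the division by AR. -/
theorem norm_coneMap_le (hF : FrenetBounds (Icc a b) e α τ c L) {t₀ σ s : ℝ}
    (ht₀ : t₀ ∈ Icc a b) (hσ : σ ∈ Icc a b) (hs : s ∈ Icc a b) {A R K : ℝ} (hA : 1 ≤ A)
    (hR : 0 < R) (hR1 : R ≤ 1) (hK : 1 ≤ K) (hsσ : |s - σ| ≤ K * R) (j : Fin 3) :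
    ‖coneMap (A * R) (e 0 s) (e 1 t₀) ((![R, K⁻¹, K⁻¹] : Fin 3 → ℝ) j • frameBasis e σ j)‖ ≤ L := by
  have hL := hF.one_le
  have hK0 : 0 < K := by linarith
  have hKi : K⁻¹ ≤ 1 := inv_le_one_of_one_le₀ hK
  have hρ0 : 0 < (![R, K⁻¹, K⁻¹] : Fin 3 → ℝ) j := by
    fin_cases j <;> simp <;> linarith
  have hρ1 : (![R, K⁻¹, K⁻¹] : Fin 3 → ℝ) j ≤ 1 := by
    fin_cases j <;> simp <;> linarith
  have hAR : 0 < A * R := by positivity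
  have hb : ‖frameBasis e σ j‖ = 1 := (frameBasis e σ).norm_eq_one j
  have hunit : ∀ i, ∀ t ∈ Icc a b, ‖e i t‖ = 1 := fun i t ht => (hF.orthonormal t ht).1 i
  rw [map_smul, norm_smul, Real.norm_eq_abs, abs_of_pos hρ0, coneMap_apply]
  have hle : ∀ x : ℝ, |x| ≤ 1 → ∀ y, y = |x| → y ≤ L := by
    intros; linarith
  rw [Prod.norm_def, Prod.norm_def, mul_max_of_nonneg _ _ hρ0.le, mul_max_of_nonneg _ _ hρ0.le]
  refine max_le ?_ (max_le ?_ ?_)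
  · simp only [Real.norm_eq_abs, abs_mul, abs_of_pos (inv_pos.2 hAR)]
    have hin : |inner ℝ (e 0 s) (frameBasis e σ j)| ≤ 1 := by
      have := abs_real_inner_le_norm (e 0 s) (frameBasis e σ j)
      rwa [hunit 0 s hs, hb, one_mul] at this
    rw [mul_left_comm, inv_mul_le_iff₀ hAR]
    by_cases hj : j = 0
    · subst hj
      simp only [Matrix.cons_val_zero]
      nlinarith [mul_le_mul_of_nonneg_left hin hR.le, mul_le_mul hA hL zero_le_one (by linarith)]
    · have h0 : inner ℝ (e 0 σ) (frameBasis e σ j) = (0 : ℝ) := by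
        rw [frameBasis_apply (hF.orthonormal σ hσ)]
        exact (hF.orthonormal σ hσ).2 (Ne.symm hj)
      have h1 := abs_inner_sub_le hF hs hσ 0 (frameBasis e σ j)
      rw [h0, sub_zero, hb, mul_one] at h1
      have h2 : (![R, K⁻¹, K⁻¹] : Fin 3 → ℝ) j = K⁻¹ := by
        fin_cases j
        · exact absurd rfl hj
        · rfl
        · rfl
      rw [h2, inv_mul_le_iff₀ hK0]
      calc |inner ℝ (e 0 s) (frameBasis e σ j)| ≤ L * (K * R) :=
            h1.trans (mul_le_mul_of_nonneg_left hsσ (by linarith))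
        _ = 1 * (K * R * L) := by ring
        _ ≤ A * (K * R * L) := mul_le_mul_of_nonneg_right hA (by positivity)
        _ = K * (A * R * L) := by ring
  · simp only [hb]
    linarith
  · have := abs_real_inner_le_norm (e 1 t₀) (frameBasis e σ j)
    rw [hunit 1 t₀ ht₀, hb, one_mul] at this
    simp only [Real.norm_eq_abs]
    nlinarith [abs_nonneg (inner ℝ (e 1 t₀) (frameBasis e σ j))]

/-- The weighted square function estimate over an arc. -/
theorem FrenetBounds.exists_sum_coneKernel_le (hF : FrenetBounds (Icc a b) e α τ c L) {η : ℝ → ℝ}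
    (hη : IsCutoff η) {θ : ℝ} (hθ : 0 < θ) (hθ2 : θ ≤ 2) {A : ℝ} (hA : 1 ≤ A) :
    ∃ C : ℝ, 0 < C ∧ ∀ t₀ t₁ : ℝ, a ≤ t₀ → t₁ ≤ b → L * (t₁ - t₀) ≤ 1 / 1024 →
    ∀ R K : ℝ, 0 < R → R ≤ 1 → 1 ≤ K → ∀ S : Finset ℝ, (∀ s ∈ S, s ∈ Icc t₀ t₁) →
    (S : Set ℝ).Pairwise (fun s t => R ≤ |s - t|) → ∀ σ ∈ Icc t₀ t₁,
    (∀ s ∈ S, |s - σ| ≤ K * R) → ∀ g : E3 → ℂ, MemLp g 2 volume →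
    ∀ w : E3 → ℝ≥0∞, AEMeasurable w volume →
    ∑ s ∈ S, ∫⁻ x, ‖sconv (coneKernel hη hθ (A * R) (e 0 s) (e 1 t₀)) g x‖ₑ ^ 2 *
        lconv w (prodWeight (frameBasis e σ) ![R, K⁻¹, K⁻¹]) x ≤
      ENNReal.ofReal C *
        ∫⁻ x, ‖g x‖ₑ ^ 2 * lconv w (prodWeight (frameBasis e σ) ![R, K⁻¹, K⁻¹]) x := by
  obtain ⟨D, hD0, hD⟩ := exists_bound_iteratedFDeriv
    (F := fun p => (coneSymbol η θ p : ℂ))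
    (Complex.ofRealCLM.contDiff.comp (contDiff_coneSymbol hη θ))
    ((hasCompactSupport_coneSymbol hη hθ).comp_left (g := Complex.ofReal) Complex.ofReal_zero) 450
  have hc := hF.c_pos
  -- The overlap bound of `card_le_of_cone`, independent of R and K.
  set N : ℕ := ⌊1024 * A / c + 1⌋₊ with hN
  obtain ⟨Q, hQ⟩ : ∃ Q : ℝ, Q = N * (D * L ^ 450) ^ 2 := ⟨_, rfl⟩
  obtain ⟨q, hq, hq'⟩ : ∃ q : ℝ, 0 < q ∧ (4 : ℝ≥0∞) ^ 450 = ENNReal.ofReal q :=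
    ⟨4 ^ 450, pow_pos (by norm_num) _, by
      rw [ENNReal.ofReal_pow (by norm_num), ENNReal.ofReal_ofNat]⟩
  refine ⟨q * (|Q| + 1), by positivity, fun t₀ t₁ h₀ h₁ hJ R K hR hR1 hK S hS hsep σ hσ hSσ g hg
    w hw => ?_⟩
  have hI : ∀ s ∈ Icc t₀ t₁, s ∈ Icc a b := fun s hs => ⟨h₀.trans hs.1, hs.2.trans h₁⟩
  have ht₀ : t₀ ∈ Icc a b := hI t₀ ⟨le_rfl, hσ.1.trans hσ.2⟩
  have hK0 : 0 < K := by linarith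
  have h := sum_lintegral_sconv_comp_le (F := fun p => (coneSymbol η θ p : ℂ))
    (Complex.ofRealCLM.contDiff.comp (contDiff_coneSymbol hη θ)) hF.one_le hD N S (frameBasis e σ)
    (ρ := ![R, K⁻¹, K⁻¹]) (fun j => by fin_cases j <;> simpa)
    (fun s => coneKernel hη hθ (A * R) (e 0 s) (e 1 t₀))
    (fun s => coneMap (A * R) (e 0 s) (e 1 t₀)) (fun s _ ξ => fourier_coneKernel _ _ _ _ _ _)
    (fun s hs j => norm_coneMap_le hF ht₀ (hI σ hσ) (hI s (hS s hs)) hA hR hR1 hK (hSσ s hs) j)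
    (fun ξ T hT hTξ => ?_) hg hw
  · refine h.trans ?_
    rw [hq', ← hQ, ← ENNReal.ofReal_mul hq.le]
    gcongr
    linarith [le_abs_self Q]
  · rcases T.eq_empty_or_nonempty with rfl | ⟨s₁, hs₁⟩
    · simp
    have hmem := fun s hs => mem_tsupport_coneKernel hη hθ (mul_pos (by linarith) hR) (hTξ s hs)
    obtain ⟨-, h2, h3⟩ := hmem s₁ hs₁
    -- θ ≤ 2 turns the support conditions into ‖ξ‖² ≤ 16 and |⟨e_1(t₀),ξ⟩| ≥ 1/128.
    refine Nat.le_floor (hF.card_le_of_cone h₀ h₁ hJ (ξ := ξ) (by linarith) (le_trans ?_ h3)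
      (by linarith) hR (fun s hs => hS s (hT hs)) (hsep.mono hT) fun s hs => (hmem s hs).1)
    exact one_div_le_one_div_of_le (by positivity) (by linarith)

/-- A narrow cone multiplier factors through a wide one. -/
theorem FrenetBounds.sconv_coneKernel_eq (hF : FrenetBounds (Icc a b) e α τ c L) {η : ℝ → ℝ}
    (hη : IsCutoff η) {t₀ s σ δ δ' : ℝ} (ht₀ : t₀ ∈ Icc a b) (hs : s ∈ Icc a b)
    (hσ : σ ∈ Icc a b) (hδ : 0 < δ) (hδ' : 2 * δ + 3 * L * |s - σ| ≤ δ') {g : E3 → ℂ}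
    (hg : MemLp g 2 volume) (x : E3) :
    sconv (coneKernel hη one_pos δ (e 0 s) (e 1 t₀)) g x =
      sconv (coneKernel hη two_pos δ (e 0 s) (e 1 t₀))
        (sconv (coneKernel hη one_pos δ' (e 0 σ) (e 1 t₀)) g) x := by
  refine (sconv_sconv (fun ξ => ?_) hg x).symm
  rw [fourier_coneKernel, fourier_coneKernel, fourier_coneKernel, ← Complex.ofReal_mul]
  congr 1
  have hL : 0 ≤ L := zero_le_one.trans hF.one_le
  have hδ'0 : 0 < δ' := by have := abs_nonneg (s - σ); nlinarith [mul_nonneg hL this]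
  -- All the symbols share t₀. Where the narrow symbol is non-zero, the cutoffs with θ = 2 in ‖ξ‖
  -- and ⟨e_1(t₀),ξ⟩ equal 1, and so does the wide cutoff in ⟨e_0(σ),ξ⟩; the product is then the
  -- narrow symbol.
  by_cases h : coneSymbol η 1 (coneMap δ (e 0 s) (e 1 t₀) ξ) = 0
  · rw [h]
    simp only [coneSymbol, coneMap_apply] at h ⊢
    rcases mul_eq_zero.1 h with h | h
    · rw [h]; ring
    · rw [h]; ring
  · obtain ⟨h1, h2, h3, h4⟩ := coneSymbol_ne_zero hη one_pos h
    simp only [coneMap_apply] at h1 h2 h3 h4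
    have hn : ‖ξ‖ ≤ 3 := by nlinarith [norm_nonneg ξ]
    rw [abs_mul, abs_of_pos (inv_pos.2 hδ), inv_mul_lt_iff₀ hδ] at h1
    have e1 : η (δ'⁻¹ * inner ℝ (e 0 σ) ξ) = 1 := by
      refine hη.eq_one _ (abs_le.1 ?_)
      rw [abs_mul, abs_of_pos (inv_pos.2 hδ'0), inv_mul_le_iff₀ hδ'0, mul_one]
      have h5 := abs_inner_sub_le hF hs hσ 0 ξ
      have h6 : L * |s - σ| * ‖ξ‖ ≤ L * |s - σ| * 3 :=
        mul_le_mul_of_nonneg_left hn (mul_nonneg hL (abs_nonneg _))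
      have h7 := abs_sub_abs_le_abs_sub (inner ℝ (e 0 σ) ξ) (inner ℝ (e 0 s) ξ)
      rw [abs_sub_comm] at h7
      linarith
    have e2 : η (‖ξ‖ ^ 2 / (4 * 2)) = 1 := by
      refine hη.eq_one _ ⟨by have : 0 ≤ ‖ξ‖ ^ 2 / (4 * 2) := by positivity
                             linarith, by linarith⟩
    have e3 : η (inner ℝ (e 1 t₀) ξ / 4) = 1 := by
      refine hη.eq_one _ (abs_le.1 ?_)
      have := abs_real_inner_le_norm (e 1 t₀) ξ
      rw [(hF.orthonormal t₀ ht₀).1 1, one_mul] at this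
      rw [abs_div, abs_of_pos (by norm_num : (0 : ℝ) < 4)]
      linarith
    have e4 : η (64 * 2 * inner ℝ (e 1 t₀) ξ) = 0 := by
      refine hη.eq_zero ?_
      rw [abs_mul, abs_of_pos (by norm_num : (0 : ℝ) < 64 * 2)]
      linarith
    simp only [coneSymbol, coneMap_apply, e1, e2, e3, e4]
    ring

end

end

section

open scoped SchwartzMap LineDeriv Topology

/-! ### The weighted estimate for the box multipliers -/

theorem gauge3_mono_scale (b : OrthonormalBasis (Fin 3) ℝ E3) {ρ ρ' : Fin 3 → ℝ}
    (h : ∀ j, ρ j ≤ ρ' j) (z : E3) : gauge3 b ρ z ≤ gauge3 b ρ' z :=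
  Finset.sum_le_sum fun j _ => mul_le_mul_of_nonneg_right (h j) (abs_nonneg _)

/-- Enlarging the plate costs only Q, the ratio of the volumes, since the decaying factors can only
grow. -/
theorem prodWeight_le_of_le (b : OrthonormalBasis (Fin 3) ℝ E3) {ρ ρ' : Fin 3 → ℝ} {Q : ℝ}
    (hρ' : ∀ j, 0 < ρ' j) (h : ∀ j, ρ' j ≤ ρ j) (hQ : ∏ j, ρ j = Q * ∏ j, ρ' j) (y : E3) :
    prodWeight b ρ y ≤ Q * prodWeight b ρ' y := by
  unfold prodWeight
  rw [← mul_assoc, ← hQ]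
  refine mul_le_mul_of_nonneg_left (Finset.prod_le_prod (fun j _ => by positivity) fun j _ => ?_)
    (Finset.prod_nonneg fun j _ => (hρ' j).le.trans (h j))
  refine inv_anti₀ (by positivity) (pow_le_pow_left₀ (by positivity) ?_ _)
  rw [mul_pow, mul_pow]
  have := pow_le_pow_left₀ (hρ' j).le (h j) 2
  have := mul_le_mul_of_nonneg_right this (sq_nonneg (inner ℝ (b j) y))
  linarith

theorem frameWeight_le_of_le (b : OrthonormalBasis (Fin 3) ℝ E3) {ρ ρ' : Fin 3 → ℝ} {Q : ℝ}
    (hρ' : ∀ j, 0 < ρ' j) (h : ∀ j, ρ' j ≤ ρ j) (hQ : ∏ j, ρ j = Q * ∏ j, ρ' j) (y : E3) :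
    frameWeight b ρ y ≤ Q * frameWeight b ρ' y := by
  unfold frameWeight
  rw [← mul_assoc, ← hQ]
  have h0 : 0 ≤ gauge3 b ρ' y :=
    Finset.sum_nonneg fun j _ => mul_nonneg (hρ' j).le (abs_nonneg _)
  refine mul_le_mul_of_nonneg_left (inv_anti₀ (by positivity)
    (pow_le_pow_left₀ (by positivity) ?_ _))
    (Finset.prod_nonneg fun j _ => (hρ' j).le.trans (h j))
  linarith [gauge3_mono_scale b h y]

theorem exists_lconv_prodWeight_le_nikodymMax : ∃ q : ℝ, 0 < q ∧
    ∀ (I : Set ℝ) (e : Fin 3 → ℝ → E3), (∀ s ∈ I, Orthonormal ℝ fun j => e j s) →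
    ∀ ρ : Fin 3 → ℝ, (∀ j, 0 < ρ j) → ∀ s ∈ I, ∀ w : E3 → ℝ≥0∞, AEMeasurable w volume → ∀ x,
    lconv w (prodWeight (frameBasis e s) ρ) x ≤ ENNReal.ofReal q * nikodymMax I e ρ w x := by
  refine ⟨4 ^ 150, pow_pos (by norm_num) _, fun I e he ρ hρ s hs w hw x => ?_⟩
  refine (lconv_mono_right (pow_nonneg (by norm_num) _)
    (fun y => prodWeight_le_frameWeight (frameBasis e s) hρ y)
    (frameWeight_continuous _ _ hρ) x hw).trans ?_
  gcongr
  exact lconv_le_nikodymMax hs (he s hs) ρ w x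

theorem nikodymScale_pos {r K : ℝ} (hr : 0 < r) (hK : 0 < K) (m : ℕ) (j : Fin 3) :
    0 < nikodymScale r K m j := by
  have := inv_pos.2 hK
  have := mul_pos (pow_pos hK m) hr
  unfold nikodymScale
  fin_cases j <;> simpa

theorem star_pos {r : ℝ} (hr : 0 < r) (j : Fin 3) : 0 < (![r, 1, 1] : Fin 3 → ℝ) j := by
  fin_cases j <;> simp [hr]

theorem betaTilde_ne_zero {η : ℝ → ℝ} (hη : IsCutoff η) {u : ℝ} (hu : betaTilde η u ≠ 0) :
    1 / 4 < |u| ∧ |u| < 4 := by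
  constructor
  · by_contra h
    rw [not_lt] at h
    refine hu ?_
    rw [betaTilde, hη.eq_one _ (abs_le.1 ?_), hη.eq_one _ (abs_le.1 ?_), sub_self]
    · rw [abs_mul, abs_of_pos (by norm_num)]; linarith
    · rw [abs_mul, abs_of_pos (by norm_num)]; linarith
  · by_contra h
    rw [not_lt] at h
    refine hu ?_
    rw [betaTilde, hη.eq_zero, hη.eq_zero, sub_zero]
    · rw [abs_mul, abs_of_pos (by norm_num)]; linarith
    · rw [abs_mul, abs_of_pos (by norm_num)]; linarith

section
variable {a b : ℝ} {e : Fin 3 → ℝ → E3} {α τ : ℝ → ℝ} {c L : ℝ}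

/-- The Fourier-side profile of the box multipliers. -/
theorem exists_boxProfile {η : ℝ → ℝ} (hη : IsCutoff η) : ∃ F : 𝓢(E3, ℂ), ∀ y : E3,
    (𝓕 F : 𝓢(E3, ℂ)) y = ((η (2 * Real.pi * y 0) * betaTilde η (2 * Real.pi * y 1) *
      η (2 * Real.pi * y 2) : ℝ) : ℂ) := by
  have hc : ∀ j : Fin 3, ContDiff ℝ ∞ fun y : E3 => 2 * Real.pi * y j := fun j => by fun_prop
  have hβ : ContDiff ℝ ∞ (betaTilde η) :=
    (hη.smooth.comp (contDiff_const.mul contDiff_id)).sub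
      (hη.smooth.comp (contDiff_const.mul contDiff_id))
  refine exists_fourier_eq (f := fun y : E3 => ((η (2 * Real.pi * y 0) *
    betaTilde η (2 * Real.pi * y 1) * η (2 * Real.pi * y 2) : ℝ) : ℂ))
    (Complex.ofRealCLM.contDiff.comp (((hη.smooth.comp (hc 0)).mul (hβ.comp (hc 1))).mul
      (hη.smooth.comp (hc 2)))) ?_
  refine HasCompactSupport.intro (isCompact_closedBall (0 : E3) 3) fun y hy => ?_
  by_contra h
  have h' : η (2 * Real.pi * y 0) * betaTilde η (2 * Real.pi * y 1) *
      η (2 * Real.pi * y 2) ≠ 0 := fun e => h (by rw [e, Complex.ofReal_zero])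
  simp only [ne_eq, mul_eq_zero, not_or] at h'
  obtain ⟨⟨h0, h1⟩, h2⟩ := h'
  have hπ := Real.pi_gt_three
  have key : ∀ u : ℝ, |2 * Real.pi * u| ≤ 4 → |u| ≤ 1 := by
    intro u hu
    rw [abs_mul, abs_of_pos (by positivity)] at hu
    nlinarith [abs_nonneg u]
  have k0 := key _ ((hη.abs_lt h0).le.trans (by norm_num))
  have k2 := key _ ((hη.abs_lt h2).le.trans (by norm_num))
  have k1 : |y 1| ≤ 1 := key _ (betaTilde_ne_zero hη h1).2.le
  refine hy ?_
  rw [mem_closedBall_zero_iff]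
  have : ‖y‖ ^ 2 ≤ 3 := by
    rw [EuclideanSpace.norm_sq_eq, Fin.sum_univ_three]
    simp only [Real.norm_eq_abs]
    nlinarith [abs_nonneg (y 0), abs_nonneg (y 1), abs_nonneg (y 2)]
  nlinarith [norm_nonneg y]

theorem fourier_boxKernel {η : ℝ → ℝ} {F : 𝓢(E3, ℂ)} (hFη : ∀ y : E3,
    (𝓕 F : 𝓢(E3, ℂ)) y = ((η (2 * Real.pi * y 0) * betaTilde η (2 * Real.pi * y 1) *
      η (2 * Real.pi * y 2) : ℝ) : ℂ)) {s r : ℝ} (hr : 0 < r)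
    (h : Orthonormal ℝ fun j => e j s) (ζ : E3) :
    (𝓕 (plateKernel (frameBasis e s) ![r, 1, 1] (star_pos hr) F) : 𝓢(E3, ℂ)) ζ =
      ((η (r⁻¹ * inner ℝ (e 0 s) ((2 * Real.pi) • ζ)) *
        betaTilde η (inner ℝ (e 1 s) ((2 * Real.pi) • ζ)) *
        η (inner ℝ (e 2 s) ((2 * Real.pi) • ζ)) : ℝ) : ℂ) := by
  rw [fourier_plateKernel, hFη]
  simp only [plateMap_apply, frameBasis_apply h, inner_smul_right]
  simp [mul_left_comm]

/-- On the support of the box symbol every cutoff of the cone symbol equals 1. In the variable ζ =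
ξ/2π one has ‖ζ‖ ≤ 4/3, |⟨e_0(s),ζ⟩| ≤ r/3 and |⟨e_1(s),ζ⟩| ≥ 1/26 there; moving s to σ is absorbed
in δ, and moving s to t₀ leaves |⟨e_1(t₀),ζ⟩| above 1/32. -/
theorem FrenetBounds.sconv_boxKernel_eq (hF : FrenetBounds (Icc a b) e α τ c L) {η : ℝ → ℝ}
    (hη : IsCutoff η) {F : 𝓢(E3, ℂ)} (hFη : ∀ y : E3,
    (𝓕 F : 𝓢(E3, ℂ)) y = ((η (2 * Real.pi * y 0) * betaTilde η (2 * Real.pi * y 1) *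
      η (2 * Real.pi * y 2) : ℝ) : ℂ)) {t₀ s σ r δ : ℝ} (ht₀ : t₀ ∈ Icc a b)
    (hs : s ∈ Icc a b) (hσ : σ ∈ Icc a b) (hst : L * |s - t₀| ≤ 1 / 1024) (hr : 0 < r) (hr1 : r ≤ 1)
    (hδ : r + 2 * L * |s - σ| ≤ δ) {g : E3 → ℂ} (hg : MemLp g 2 volume) (x : E3) :
    sconv (plateKernel (frameBasis e s) ![r, 1, 1] (star_pos hr) F) g x =
      sconv (plateKernel (frameBasis e s) ![r, 1, 1] (star_pos hr) F)
        (sconv (coneKernel hη one_pos δ (e 0 σ) (e 1 t₀)) g) x := by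
  refine (sconv_sconv (fun ζ => ?_) hg x).symm
  rw [fourier_boxKernel hFη hr (hF.orthonormal s hs), fourier_coneKernel, ← Complex.ofReal_mul]
  congr 1
  have hL : 0 ≤ L := zero_le_one.trans hF.one_le
  have hδ0 : 0 < δ := by have := abs_nonneg (s - σ); nlinarith [mul_nonneg hL this]
  set χ := η (r⁻¹ * inner ℝ (e 0 s) ((2 * Real.pi) • ζ)) *
        betaTilde η (inner ℝ (e 1 s) ((2 * Real.pi) • ζ)) *
        η (inner ℝ (e 2 s) ((2 * Real.pi) • ζ)) with hχ
  by_cases h : χ = 0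
  · rw [h, zero_mul]
  simp only [hχ, mul_eq_zero, not_or] at h
  obtain ⟨⟨h0, h1⟩, h2⟩ := h
  have hπ := Real.pi_gt_three
  have hπ4 := Real.pi_lt_d2
  have key : ∀ u B : ℝ, |2 * Real.pi * u| ≤ 6 * B → |u| ≤ B := by
    intro u B hu
    rw [abs_mul, abs_of_pos (by positivity)] at hu
    nlinarith [abs_nonneg u]
  rw [inner_smul_right] at h0 h1 h2
  have h0' := (hη.abs_lt h0).le
  rw [abs_mul, abs_of_pos (inv_pos.2 hr), inv_mul_le_iff₀ hr] at h0'
  have k0 : |inner ℝ (e 0 s) ζ| ≤ r / 3 := key _ _ (by linarith)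
  have k2 : |inner ℝ (e 2 s) ζ| ≤ 1 / 3 := key _ _ ((hη.abs_lt h2).le.trans (by norm_num))
  have k1 : |inner ℝ (e 1 s) ζ| ≤ 2 / 3 :=
    key _ _ ((betaTilde_ne_zero hη h1).2.le.trans (by norm_num))
  have k1' : 1 / 26 ≤ |inner ℝ (e 1 s) ζ| := by
    have := (betaTilde_ne_zero hη h1).1
    rw [abs_mul, abs_of_pos (by positivity)] at this
    nlinarith [abs_nonneg (inner ℝ (e 1 s) ζ)]
  have hn : ‖ζ‖ ≤ 4 / 3 := by
    have := norm_le_sum_abs_inner (frameBasis e s) ζ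
    rw [Fin.sum_univ_three] at this
    simp only [frameBasis_apply (hF.orthonormal s hs)] at this
    linarith
  have e1 : η (δ⁻¹ * inner ℝ (e 0 σ) ζ) = 1 := by
    refine hη.eq_one _ (abs_le.1 ?_)
    rw [abs_mul, abs_of_pos (inv_pos.2 hδ0), inv_mul_le_iff₀ hδ0, mul_one]
    have h5 := abs_inner_sub_le hF hs hσ 0 ζ
    have h6 : L * |s - σ| * ‖ζ‖ ≤ L * |s - σ| * (4 / 3) :=
      mul_le_mul_of_nonneg_left hn (mul_nonneg hL (abs_nonneg _))
    have h7 := abs_sub_abs_le_abs_sub (inner ℝ (e 0 σ) ζ) (inner ℝ (e 0 s) ζ)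
    rw [abs_sub_comm] at h7
    nlinarith [mul_nonneg hL (abs_nonneg (s - σ))]
  have e2 : η (‖ζ‖ ^ 2 / (4 * 1)) = 1 := by
    refine hη.eq_one _ ⟨by have : 0 ≤ ‖ζ‖ ^ 2 / (4 * 1) := by positivity
                           linarith, by nlinarith [norm_nonneg ζ]⟩
  have h8 := abs_inner_sub_le hF hs ht₀ 1 ζ
  have h9 : L * |s - t₀| * ‖ζ‖ ≤ 1 / 1024 * (4 / 3) :=
    mul_le_mul hst hn (norm_nonneg _) (by norm_num)
  have e3 : η (inner ℝ (e 1 t₀) ζ / 4) = 1 := by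
    refine hη.eq_one _ (abs_le.1 ?_)
    have := abs_real_inner_le_norm (e 1 t₀) ζ
    rw [(hF.orthonormal t₀ ht₀).1 1, one_mul] at this
    rw [abs_div, abs_of_pos (by norm_num : (0 : ℝ) < 4)]
    linarith
  have e4 : η (64 * 1 * inner ℝ (e 1 t₀) ζ) = 0 := by
    refine hη.eq_zero ?_
    rw [abs_mul, abs_of_pos (by norm_num : (0 : ℝ) < 64 * 1)]
    have := abs_sub_abs_le_abs_sub (inner ℝ (e 1 s) ζ) (inner ℝ (e 1 t₀) ζ)
    linarith
  simp only [coneSymbol, coneMap_apply, e1, e2, e3, e4]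
  ring

/-- The pointwise maximum over a finite set. -/
noncomputable def finsetMax (S : Finset ℝ) (V : ℝ → E3 → ℝ≥0∞) (x : E3) : ℝ≥0∞ := ⨆ s ∈ S, V s x

theorem le_finsetMax {S : Finset ℝ} {V : ℝ → E3 → ℝ≥0∞} {s : ℝ} (hs : s ∈ S) (x : E3) :
    V s x ≤ finsetMax S V x := le_iSup₂ (f := fun s _ => V s x) s hs

theorem finsetMax_le {S : Finset ℝ} {V : ℝ → E3 → ℝ≥0∞} {x : E3} {B : ℝ≥0∞}
    (h : ∀ s ∈ S, V s x ≤ B) : finsetMax S V x ≤ B := iSup₂_le h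

theorem measurable_finsetMax {S : Finset ℝ} {V : ℝ → E3 → ℝ≥0∞} (h : ∀ s ∈ S, Measurable (V s)) :
    Measurable (finsetMax S V) :=
  Measurable.biSup (S : Set ℝ) S.countable_toSet h

/-- Each box multiplier is passed through the cone piece at the grid point below s. Its weight is
averaged over the plate (Kr, 1, 1) and then over the larger plate (r, K⁻¹, K⁻¹), at the cost of the
volume ratio K³. At most 2K points share a grid point, and summing them trivially costs one more K.
-/
theorem FrenetBounds.exists_initial_step (hF : FrenetBounds (Icc a b) e α τ c L) {η : ℝ → ℝ}
    (hη : IsCutoff η) {F : 𝓢(E3, ℂ)} (hFη : ∀ y : E3,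
    (𝓕 F : 𝓢(E3, ℂ)) y = ((η (2 * Real.pi * y 0) * betaTilde η (2 * Real.pi * y 1) *
      η (2 * Real.pi * y 2) : ℝ) : ℂ)) :
    ∃ C A : ℝ, 0 < C ∧ 1 ≤ A ∧ ∀ t₀ t₁ : ℝ, a ≤ t₀ → t₁ ≤ b → L * (t₁ - t₀) ≤ 1 / 1024 →
    ∀ r K : ℝ, ∀ hr : 0 < r, 1 ≤ K → K * r ≤ 1 → ∀ S : Finset ℝ, (∀ s ∈ S, s ∈ Icc t₀ t₁) →
    (S : Set ℝ).Pairwise (fun s t => r ≤ |s - t|) → ∀ f : E3 → ℂ, MemLp f 2 volume →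
    ∀ w : E3 → ℝ≥0∞, Measurable w → ∃ S' : Finset ℝ, (∀ s ∈ S', s ∈ Icc t₀ t₁) ∧
    (S' : Set ℝ).Pairwise (fun s t => K ^ 1 * r ≤ |s - t|) ∧ ∃ W : E3 → ℝ≥0∞, Measurable W ∧
    (∀ x, W x ≤ ENNReal.ofReal C * nikodymIter (Icc a b) e r K 0 w x) ∧
    ∑ s ∈ S, ∫⁻ x, ‖sconv (plateKernel (frameBasis e s) ![r, 1, 1] (star_pos hr) F) f x‖ₑ ^ 2 * w x ≤
      ENNReal.ofReal (C * K ^ 4) * ∑ σ ∈ S',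
        ∫⁻ x, ‖sconv (coneKernel hη one_pos (A * (K ^ 1 * r)) (e 0 σ) (e 1 t₀)) f x‖ₑ ^ 2 *
          lconv W (prodWeight (frameBasis e σ) (nikodymScale r K 0)) x := by
  have hL := hF.one_le
  obtain ⟨C₁, hC₁, h₁⟩ := exists_lintegral_sconv_plateKernel_le F
  obtain ⟨C₂, hC₂, h₂⟩ := exists_lconv_le_lconv_lconv (1 + 3 * L) (by linarith)
  obtain ⟨C, hC⟩ : ∃ C : ℝ, C = max 1 (C₁ * C₂ * 2) := ⟨_, rfl⟩
  have hC1 : 1 ≤ C := hC ▸ le_max_left _ _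
  refine ⟨C, 1 + 2 * L, by linarith, by linarith, fun t₀ t₁ h₀ h₁' hJ r K hr hK hKr S hS hsep f hf
    w hw => ?_⟩
  have hI : ∀ s ∈ Icc t₀ t₁, s ∈ Icc a b := fun s hs => ⟨h₀.trans hs.1, hs.2.trans h₁'⟩
  have hK0 : 0 < K := by linarith
  have hδ : 0 < K * r := mul_pos hK0 hr
  have hr1 : r ≤ 1 := (le_mul_of_one_le_left hr.le hK).trans hKr
  set rd := gridRound t₀ (K * r) with hrd
  have hrdJ : ∀ s ∈ S, rd s ∈ Icc t₀ t₁ := fun s hs =>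
    ⟨le_gridRound hδ, (gridRound_le hδ (hS s hs).1).trans (hS s hs).2⟩
  have hdist : ∀ s ∈ S, |s - rd s| ≤ K * r := fun s hs => abs_sub_gridRound_le hδ (hS s hs).1
  set V : ℝ → E3 → ℝ≥0∞ := fun s => lconv w (frameWeight (frameBasis e s) ![r, 1, 1]) with hV
  have hVm : ∀ s, Measurable (V s) := fun s =>
    measurable_lconv hw (frameWeight_continuous _ _ (star_pos hr))
  set W := finsetMax S V with hW
  set G : ℝ → E3 → ℂ := fun σ =>
    sconv (coneKernel hη one_pos ((1 + 2 * L) * (K ^ 1 * r)) (e 0 σ) (e 1 t₀)) f with hG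
  set T : ℝ → ℝ≥0∞ := fun σ => ∫⁻ x, ‖G σ x‖ₑ ^ 2 *
    lconv W (prodWeight (frameBasis e σ) (nikodymScale r K 0)) x with hT
  refine ⟨S.image rd, ?_, ?_, W, measurable_finsetMax fun s _ => hVm s, fun x => ?_, ?_⟩
  · intro σ hσ
    obtain ⟨s, hs, rfl⟩ := Finset.mem_image.1 hσ
    exact hrdJ s hs
  · intro σ hσ σ' hσ' hne
    obtain ⟨s, hs, rfl⟩ := Finset.mem_image.1 hσ
    obtain ⟨s', hs', rfl⟩ := Finset.mem_image.1 hσ'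
    simp only [pow_one]
    exact gridRound_separated hδ hne
  · refine finsetMax_le fun s hs => ?_
    refine (lconv_le_nikodymMax (hI s (hS s hs)) (hF.orthonormal s (hI s (hS s hs)))
      ![r, 1, 1] w x).trans ?_
    exact le_mul_of_one_le_left' (ENNReal.one_le_ofReal.2 hC1)
  · have hstep : ∀ s ∈ S, ∫⁻ x, ‖sconv (plateKernel (frameBasis e s) ![r, 1, 1] (star_pos hr) F)
        f x‖ₑ ^ 2 * w x ≤ ENNReal.ofReal (C₁ * C₂ * K ^ 3) * T (rd s) := by
      intro s hs
      have hsI := hI s (hS s hs)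
      have hσI := hI _ (hrdJ s hs)
      have hst : L * |s - t₀| ≤ 1 / 1024 := by
        rw [abs_of_nonneg (by linarith [(hS s hs).1])]
        nlinarith [(hS s hs).2]
      have hcomp : ∀ x, V s x ≤ ENNReal.ofReal (C₂ * K ^ 3) *
          lconv W (prodWeight (frameBasis e (rd s)) (nikodymScale r K 0)) x := by
        intro x
        have hρ : ∀ j, 0 < (![K * r, 1, 1] : Fin 3 → ℝ) j := star_pos hδ
        refine (h₂ (frameBasis e s) (frameBasis e (rd s)) ![r, 1, 1] ![K * r, 1, 1] (star_pos hr) hρ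
          (fun z => ?_) _ _ (Or.inl rfl) (Or.inr rfl) w x).trans ?_
        · refine le_trans (gauge3_mono_scale _ (fun j => ?_) z)
            (hF.gauge3_scale_le hsI hσI hδ one_pos ?_ ?_ ?_ z)
          · fin_cases j
            · exact le_mul_of_one_le_left hr.le hK
            · exact le_rfl
            · exact le_rfl
          · rw [one_mul]; exact hdist s hs
          · exact mul_le_one₀ hKr (abs_nonneg _) ((hdist s hs).trans hKr)
          · exact (hdist s hs).trans hKr
        · rw [ENNReal.ofReal_mul hC₂.le, mul_assoc]
          gcongr
          refine (lconv_mono (fun y => le_finsetMax (V := V) hs y) x).trans ?_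
          refine lconv_mono_right (by positivity) (fun y => prodWeight_le_of_le _
            (nikodymScale_pos hr hK0 0) (fun j => ?_) ?_ y) (prodWeight_continuous _ _) x
            (measurable_finsetMax fun s _ => hVm s).aemeasurable
          · have hKi : K⁻¹ ≤ 1 := inv_le_one_of_one_le₀ hK
            fin_cases j
            · simpa [nikodymScale] using le_mul_of_one_le_left hr.le hK
            · simpa [nikodymScale] using hKi
            · simpa [nikodymScale] using hKi
          · simp only [nikodymScale, Fin.prod_univ_three]
            simp
            field_simp
      calc ∫⁻ x, ‖sconv (plateKernel (frameBasis e s) ![r, 1, 1] (star_pos hr) F) f x‖ₑ ^ 2 * w x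
          = ∫⁻ x, ‖sconv (plateKernel (frameBasis e s) ![r, 1, 1] (star_pos hr) F)
              (G (rd s)) x‖ₑ ^ 2 * w x := by
            refine lintegral_congr fun x => ?_
            rw [hF.sconv_boxKernel_eq hη hFη (hI t₀ ⟨le_rfl, (hS s hs).1.trans (hS s hs).2⟩) hsI hσI
              hst hr hr1 (δ := (1 + 2 * L) * (K ^ 1 * r)) ?_ hf x]
            rw [pow_one]
            nlinarith [hdist s hs, le_mul_of_one_le_left hr.le hK]
        _ ≤ ENNReal.ofReal C₁ * ∫⁻ x, ‖G (rd s) x‖ₑ ^ 2 * V s x :=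
            h₁ _ _ _ _ (sconv_memLp _ hf) w hw.aemeasurable
        _ ≤ ENNReal.ofReal C₁ * ∫⁻ x, ENNReal.ofReal (C₂ * K ^ 3) * (‖G (rd s) x‖ₑ ^ 2 *
              lconv W (prodWeight (frameBasis e (rd s)) (nikodymScale r K 0)) x) := by
            refine mul_le_mul_right (lintegral_mono fun x => ?_) _
            rw [mul_left_comm]
            exact mul_le_mul_right (hcomp x) _
        _ = _ := by
            rw [lintegral_const_mul' _ _ ENNReal.ofReal_ne_top, ← mul_assoc,
              ← ENNReal.ofReal_mul hC₁.le, ← mul_assoc C₁]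
    calc _ ≤ ∑ s ∈ S, ENNReal.ofReal (C₁ * C₂ * K ^ 3) * T (rd s) := Finset.sum_le_sum hstep
      _ = ENNReal.ofReal (C₁ * C₂ * K ^ 3) *
          ∑ σ ∈ S.image rd, (S.filter fun s => rd s = σ).card • T σ := by
          rw [← Finset.mul_sum, Finset.sum_comp]
      _ ≤ ENNReal.ofReal (C₁ * C₂ * K ^ 3) * ∑ σ ∈ S.image rd, ENNReal.ofReal (2 * K) * T σ := by
          gcongr with σ hσ
          rw [nsmul_eq_mul]
          gcongr
          rw [← ENNReal.ofReal_natCast]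
          refine ENNReal.ofReal_le_ofReal ?_
          have := card_le_of_separated (T := S.filter fun s => rd s = σ) (t₀ := σ) (ℓ := K * r) hr
            hδ.le (fun s hs => ?_) (hsep.mono fun s hs => (Finset.mem_filter.1 hs).1)
          · rw [mul_div_assoc, div_self hr.ne', mul_one] at this
            linarith
          · obtain ⟨hs', rfl⟩ := Finset.mem_filter.1 hs
            have hs := hs'
            exact ⟨gridRound_le hδ (hS s hs).1, (lt_gridRound_add hδ).le⟩
      _ ≤ _ := by
          rw [← Finset.mul_sum, ← mul_assoc, ← ENNReal.ofReal_mul (by positivity)]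
          refine mul_le_mul_left (ENNReal.ofReal_le_ofReal ?_) _
          have : C₁ * C₂ * 2 ≤ C := hC ▸ le_max_right _ _
          calc C₁ * C₂ * K ^ 3 * (2 * K) = C₁ * C₂ * 2 * K ^ 4 := by ring
            _ ≤ C * K ^ 4 := by gcongr

end

end

/-! ### Induction on scales and the estimate on a short interval -/

section

open scoped SchwartzMap LineDeriv Topology

section
variable {a b : ℝ} {e : Fin 3 → ℝ → E3} {α τ : ℝ → ℝ} {c L : ℝ}

/-- One step of the iteration, passing from arcs of length `K^(n+1) r` to arcs of length
`K^(n+2) r`. -/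
theorem FrenetBounds.exists_inductive_step (hF : FrenetBounds (Icc a b) e α τ c L) {η : ℝ → ℝ}
    (hη : IsCutoff η) {A : ℝ} (hA : 1 ≤ A) :
    ∃ C : ℝ, 0 < C ∧ ∀ t₀ t₁ : ℝ, a ≤ t₀ → t₁ ≤ b → L * (t₁ - t₀) ≤ 1 / 1024 →
    ∀ (r K : ℝ) (n : ℕ), 0 < r → 1 ≤ K → K ^ (n + 2) * r ≤ 1 →
    ∀ S : Finset ℝ, (∀ s ∈ S, s ∈ Icc t₀ t₁) →
    (S : Set ℝ).Pairwise (fun s t => K ^ (n + 1) * r ≤ |s - t|) →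
    ∀ f : E3 → ℂ, MemLp f 2 volume →
    ∀ w : E3 → ℝ≥0∞, Measurable w → ∃ S' : Finset ℝ, (∀ s ∈ S', s ∈ Icc t₀ t₁) ∧
    (S' : Set ℝ).Pairwise (fun s t => K ^ (n + 2) * r ≤ |s - t|) ∧
    ∃ W : E3 → ℝ≥0∞, Measurable W ∧
    (∀ x, W x ≤ ENNReal.ofReal C * nikodymMax (Icc a b) e (nikodymScale r K n) w x) ∧
    ∑ s ∈ S, ∫⁻ x, ‖sconv (coneKernel hη one_pos (A * (K ^ (n + 1) * r)) (e 0 s) (e 1 t₀)) f x‖ₑ ^ 2 *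
        lconv w (prodWeight (frameBasis e s) (nikodymScale r K n)) x ≤
      ENNReal.ofReal C * ∑ σ ∈ S',
        ∫⁻ x, ‖sconv (coneKernel hη one_pos ((2 * A + 3 * L) * (K ^ (n + 2) * r))
          (e 0 σ) (e 1 t₀)) f x‖ₑ ^ 2 *
          lconv W (prodWeight (frameBasis e σ) (nikodymScale r K (n + 1))) x := by
  have hL := hF.one_le
  obtain ⟨C₁, hC₁, h₁⟩ := hF.exists_sum_coneKernel_le hη two_pos le_rfl hA
  obtain ⟨C₂, hC₂, h₂⟩ := exists_lconv_le_lconv_lconv (1 + 3 * L) (by linarith)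
  obtain ⟨q, hq, h₃⟩ := exists_lconv_prodWeight_le_nikodymMax
  obtain ⟨C, hC⟩ : ∃ C : ℝ, C = max q (C₂ * C₁) := ⟨_, rfl⟩
  have hCq : q ≤ C := hC ▸ le_max_left _ _
  have hC12 : C₂ * C₁ ≤ C := hC ▸ le_max_right _ _
  refine ⟨C, by linarith, fun t₀ t₁ h₀ h₁' hJ r K n hr hK hKr S hS hsep f hf w hw => ?_⟩
  have hI : ∀ s ∈ Icc t₀ t₁, s ∈ Icc a b := fun s hs => ⟨h₀.trans hs.1, hs.2.trans h₁'⟩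
  have hK0 : 0 < K := by linarith
  set R := K ^ (n + 1) * r with hR
  have hR0 : 0 < R := by positivity
  have hKR : K ^ (n + 2) * r = K * R := by rw [hR]; ring
  rw [hKR] at hKr ⊢
  have hδ : 0 < K * R := mul_pos hK0 hR0
  have hR1 : R ≤ 1 := (le_mul_of_one_le_left hR0.le hK).trans hKr
  -- The comparison of gauges needs R|s - σ| ≤ K⁻¹ as well as K⁻¹|s - σ| ≤ R.
  have hRK : R ≤ K⁻¹ := by rw [← one_div, le_div_iff₀ hK0, mul_comm]; exact hKr
  set rd := gridRound t₀ (K * R) with hrd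
  have hrdJ : ∀ s ∈ S, rd s ∈ Icc t₀ t₁ := fun s hs =>
    ⟨le_gridRound hδ, (gridRound_le hδ (hS s hs).1).trans (hS s hs).2⟩
  have hdist : ∀ s ∈ S, |s - rd s| ≤ K * R := fun s hs => abs_sub_gridRound_le hδ (hS s hs).1
  set V : ℝ → E3 → ℝ≥0∞ := fun s => lconv w (prodWeight (frameBasis e s) (nikodymScale r K n)) with hV
  have hVm : ∀ s, Measurable (V s) := fun s => measurable_lconv hw (prodWeight_continuous _ _)
  set W := finsetMax S V with hW
  have hWm : Measurable W := measurable_finsetMax fun s _ => hVm s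
  refine ⟨S.image rd, ?_, ?_, W, hWm, fun x => ?_, ?_⟩
  · intro σ hσ
    obtain ⟨s, hs, rfl⟩ := Finset.mem_image.1 hσ
    exact hrdJ s hs
  · intro σ hσ σ' hσ' hne
    obtain ⟨s, hs, rfl⟩ := Finset.mem_image.1 hσ
    obtain ⟨s', hs', rfl⟩ := Finset.mem_image.1 hσ'
    exact gridRound_separated hδ hne
  · refine finsetMax_le fun s hs => (h₃ (Icc a b) e hF.orthonormal _ (nikodymScale_pos hr hK0 n) s
      (hI s (hS s hs)) w hw.aemeasurable x).trans ?_
    gcongr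
  · have hscale : nikodymScale r K (n + 1) = ![R, K⁻¹, K⁻¹] := rfl
    -- As |s - σ| ≤ KR, the plate (R, K⁻¹, K⁻¹) at σ lies, up to a constant, inside the plate of the
    -- previous scale at s. An average over the latter is bounded by its own average over the
    -- former, with no power of K lost.
    have hcomp : ∀ s ∈ S, ∀ x, V s x ≤ ENNReal.ofReal C₂ *
        lconv W (prodWeight (frameBasis e (rd s)) (nikodymScale r K (n + 1))) x := by
      intro s hs x
      refine (h₂ (frameBasis e s) (frameBasis e (rd s)) (nikodymScale r K n)
        (nikodymScale r K (n + 1)) (nikodymScale_pos hr hK0 n) (nikodymScale_pos hr hK0 (n + 1))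
        (fun z => ?_) _ _ (Or.inr rfl) (Or.inr rfl) w x).trans ?_
      · refine le_trans (gauge3_mono_scale _ (fun j => ?_) z)
          (hF.gauge3_scale_le (hI s (hS s hs)) (hI _ (hrdJ s hs)) hR0 (inv_pos.2 hK0) ?_ ?_ ?_ z)
        · fin_cases j
          · exact mul_le_mul_of_nonneg_right (pow_le_pow_right₀ hK (Nat.le_succ n)) hr.le
          · exact le_rfl
          · exact le_rfl
        · rw [inv_mul_le_iff₀ hK0]; exact hdist s hs
        · exact (mul_le_of_le_one_right hR0.le ((hdist s hs).trans hKr)).trans hRK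
        · exact (hdist s hs).trans hKr
      · exact mul_le_mul_right (lconv_mono (fun y => le_finsetMax (V := V) hs y) x) _
    set G : ℝ → E3 → ℂ := fun σ =>
      sconv (coneKernel hη one_pos ((2 * A + 3 * L) * (K * R)) (e 0 σ) (e 1 t₀)) f with hG
    have hstep : ∀ s ∈ S, ∫⁻ x, ‖sconv (coneKernel hη one_pos (A * R) (e 0 s) (e 1 t₀)) f x‖ₑ ^ 2 *
        V s x ≤ ENNReal.ofReal C₂ *
        ∫⁻ x, ‖sconv (coneKernel hη two_pos (A * R) (e 0 s) (e 1 t₀)) (G (rd s)) x‖ₑ ^ 2 *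
          lconv W (prodWeight (frameBasis e (rd s)) (nikodymScale r K (n + 1))) x := by
      intro s hs
      rw [← lintegral_const_mul' _ _ ENNReal.ofReal_ne_top]
      refine lintegral_mono fun x => ?_
      rw [hF.sconv_coneKernel_eq hη (hI t₀ ⟨le_rfl, (hS s hs).1.trans (hS s hs).2⟩)
        (hI s (hS s hs)) (hI _ (hrdJ s hs)) (mul_pos (by linarith) hR0)
        (δ' := (2 * A + 3 * L) * (K * R)) ?_ hf x, mul_left_comm (ENNReal.ofReal C₂)]
      · exact mul_le_mul_right (hcomp s hs x) _
      · have h4 : A * R ≤ A * (K * R) :=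
          mul_le_mul_of_nonneg_left (le_mul_of_one_le_left hR0.le hK) (by linarith)
        have h5 : L * |s - rd s| ≤ L * (K * R) :=
          mul_le_mul_of_nonneg_left (hdist s hs) (by linarith)
        linarith
    calc _ ≤ ∑ s ∈ S, ENNReal.ofReal C₂ *
          ∫⁻ x, ‖sconv (coneKernel hη two_pos (A * R) (e 0 s) (e 1 t₀)) (G (rd s)) x‖ₑ ^ 2 *
          lconv W (prodWeight (frameBasis e (rd s)) (nikodymScale r K (n + 1))) x :=
          Finset.sum_le_sum hstep
      _ = ENNReal.ofReal C₂ * ∑ σ ∈ S.image rd, ∑ s ∈ S with rd s = σ,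
          ∫⁻ x, ‖sconv (coneKernel hη two_pos (A * R) (e 0 s) (e 1 t₀)) (G (rd s)) x‖ₑ ^ 2 *
          lconv W (prodWeight (frameBasis e (rd s)) (nikodymScale r K (n + 1))) x := by
          rw [← Finset.mul_sum, Finset.sum_fiberwise_of_maps_to fun s hs =>
            Finset.mem_image_of_mem rd hs]
      _ ≤ ENNReal.ofReal C₂ * ∑ σ ∈ S.image rd, ENNReal.ofReal C₁ * ∫⁻ x, ‖G σ x‖ₑ ^ 2 *
          lconv W (prodWeight (frameBasis e σ) (nikodymScale r K (n + 1))) x := by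
          -- All s in a group act on the same function G σ with the same weight, so the square
          -- function estimate over an arc applies to the group.
          refine mul_le_mul_right (Finset.sum_le_sum fun σ hσ => ?_) _
          obtain ⟨s₀, hs₀, hs₀'⟩ := Finset.mem_image.1 hσ
          have hσJ : σ ∈ Icc t₀ t₁ := hs₀' ▸ hrdJ s₀ hs₀
          refine le_trans (le_of_eq (Finset.sum_congr rfl fun s hs => ?_))
            (h₁ t₀ t₁ h₀ h₁' hJ R K hR0 hR1 hK (S.filter fun s => rd s = σ)
            (fun s hs => hS s (Finset.mem_filter.1 hs).1)
            (hsep.mono fun s hs => (Finset.mem_filter.1 hs).1) σ hσJ (fun s hs => ?_) (G σ)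
            (sconv_memLp _ hf) W hWm.aemeasurable)
          · rw [(Finset.mem_filter.1 hs).2, hscale]
          · rw [← (Finset.mem_filter.1 hs).2]
            exact hdist s (Finset.mem_filter.1 hs).1
      _ ≤ _ := by
          rw [← Finset.mul_sum, ← mul_assoc, ← ENNReal.ofReal_mul hC₂.le]
          gcongr

/-- The power K⁴ remains that of the initial step, because the inductive step loses only a constant.
C and A depend on n but not on r, K or the arc; A grows by A ↦ 2A + 3L. -/
theorem FrenetBounds.exists_iterated_step (hF : FrenetBounds (Icc a b) e α τ c L) {η : ℝ → ℝ}
    (hη : IsCutoff η) {F : 𝓢(E3, ℂ)} (hFη : ∀ y : E3,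
    (𝓕 F : 𝓢(E3, ℂ)) y = ((η (2 * Real.pi * y 0) * betaTilde η (2 * Real.pi * y 1) *
      η (2 * Real.pi * y 2) : ℝ) : ℂ)) (n : ℕ) :
    ∃ C A : ℝ, 0 < C ∧ 1 ≤ A ∧ ∀ t₀ t₁ : ℝ, a ≤ t₀ → t₁ ≤ b → L * (t₁ - t₀) ≤ 1 / 1024 →
    ∀ r K : ℝ, ∀ hr : 0 < r, 1 ≤ K → K ^ (n + 1) * r ≤ 1 → ∀ S : Finset ℝ,
    (∀ s ∈ S, s ∈ Icc t₀ t₁) →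
    (S : Set ℝ).Pairwise (fun s t => r ≤ |s - t|) → ∀ f : E3 → ℂ, MemLp f 2 volume →
    ∀ w : E3 → ℝ≥0∞, Measurable w → ∃ S' : Finset ℝ, (∀ s ∈ S', s ∈ Icc t₀ t₁) ∧
    (S' : Set ℝ).Pairwise (fun s t => K ^ (n + 1) * r ≤ |s - t|) ∧
    ∃ W : E3 → ℝ≥0∞, Measurable W ∧
    (∀ x, W x ≤ ENNReal.ofReal C * nikodymIter (Icc a b) e r K n w x) ∧
    ∑ s ∈ S, ∫⁻ x, ‖sconv (plateKernel (frameBasis e s) ![r, 1, 1] (star_pos hr) F) f x‖ₑ ^ 2 * w x ≤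
      ENNReal.ofReal (C * K ^ 4) * ∑ σ ∈ S',
        ∫⁻ x, ‖sconv (coneKernel hη one_pos (A * (K ^ (n + 1) * r)) (e 0 σ) (e 1 t₀)) f x‖ₑ ^ 2 *
          lconv W (prodWeight (frameBasis e σ) (nikodymScale r K n)) x := by
  induction n with
  | zero =>
    obtain ⟨C, A, hC, hA, h⟩ := hF.exists_initial_step hη hFη
    exact ⟨C, A, hC, hA, fun t₀ t₁ h₀ h₁ hJ r K hr hK hKr => h t₀ t₁ h₀ h₁ hJ r K hr hK
      (by simpa using hKr)⟩
  | succ n ih =>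
    obtain ⟨C, A, hC, hA, h⟩ := ih
    obtain ⟨C₁, hC₁, h₁⟩ := hF.exists_inductive_step hη hA
    obtain ⟨C₂, hC₂, h₂⟩ := exists_nikodymMax_le_nikodymMax_nikodymMax
    have hL := hF.one_le
    obtain ⟨D, hD⟩ : ∃ D : ℝ, D = max (C₁ * C * C₂) (C * C₁) := ⟨_, rfl⟩
    have hD1 : C₁ * C * C₂ ≤ D := hD ▸ le_max_left _ _
    have hD2 : C * C₁ ≤ D := hD ▸ le_max_right _ _
    refine ⟨D, 2 * A + 3 * L, lt_of_lt_of_le (by positivity) hD2, by linarith,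
      fun t₀ t₁ h₀ h₁' hJ r K hr hK hKr S hS hsep f hf w hw => ?_⟩
    have hKr' : K ^ (n + 1) * r ≤ 1 :=
      (mul_le_mul_of_nonneg_right (pow_le_pow_right₀ hK (Nat.le_succ _)) hr.le).trans hKr
    obtain ⟨S₁, hS₁, hsep₁, W₁, hW₁, hW₁', hle₁⟩ :=
      h t₀ t₁ h₀ h₁' hJ r K hr hK hKr' S hS hsep f hf w hw
    obtain ⟨S₂, hS₂, hsep₂, W₂, hW₂, hW₂', hle₂⟩ :=
      h₁ t₀ t₁ h₀ h₁' hJ r K n hr hK hKr S₁ hS₁ hsep₁ f hf W₁ hW₁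
    refine ⟨S₂, hS₂, hsep₂, W₂, hW₂, fun x => ?_, ?_⟩
    · have hK0 : 0 < K := by linarith
      calc W₂ x ≤ ENNReal.ofReal C₁ * nikodymMax (Icc a b) e (nikodymScale r K n) W₁ x := hW₂' x
        _ ≤ ENNReal.ofReal C₁ * (ENNReal.ofReal C * nikodymMax (Icc a b) e (nikodymScale r K n)
              (nikodymIter (Icc a b) e r K n w) x) := by
            refine mul_le_mul_right ?_ _
            rw [← nikodymMax_const_mul ENNReal.ofReal_ne_top]
            exact nikodymMax_mono hW₁' x
        _ ≤ ENNReal.ofReal C₁ * (ENNReal.ofReal C * (ENNReal.ofReal C₂ *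
              nikodymIter (Icc a b) e r K (n + 1) w x)) :=
            mul_le_mul_right (mul_le_mul_right (h₂ (Icc a b) e hF.orthonormal _
              (nikodymScale_pos hr hK0 n) _ x) _) _
        _ ≤ _ := by
            rw [← mul_assoc, ← mul_assoc, ← ENNReal.ofReal_mul hC₁.le,
              ← ENNReal.ofReal_mul (by positivity)]
            gcongr
    · refine hle₁.trans ((mul_le_mul_right hle₂ _).trans ?_)
      rw [← mul_assoc, ← ENNReal.ofReal_mul (by positivity)]
      refine mul_le_mul_left (ENNReal.ofReal_le_ofReal ?_) _
      calc C * K ^ 4 * C₁ = C * C₁ * K ^ 4 := by ring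
        _ ≤ D * K ^ 4 := by gcongr

/-- The weighted estimate on a short interval with the composed maximal operator. -/
theorem FrenetBounds.exists_short_interval_le (hF : FrenetBounds (Icc a b) e α τ c L) {η : ℝ → ℝ}
    (hη : IsCutoff η) {F : 𝓢(E3, ℂ)} (hFη : ∀ y : E3,
    (𝓕 F : 𝓢(E3, ℂ)) y = ((η (2 * Real.pi * y 0) * betaTilde η (2 * Real.pi * y 1) *
      η (2 * Real.pi * y 2) : ℝ) : ℂ)) (n : ℕ) :
    ∃ C : ℝ, 0 < C ∧ ∀ t₀ t₁ : ℝ, a ≤ t₀ → t₁ ≤ b → L * (t₁ - t₀) ≤ 1 / 1024 →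
    ∀ r K : ℝ, ∀ hr : 0 < r, 1 ≤ K → K ^ (n + 1) * r ≤ 1 → 1 ≤ K ^ (n + 3) * r → ∀ S : Finset ℝ,
    (∀ s ∈ S, s ∈ Icc t₀ t₁) →
    (S : Set ℝ).Pairwise (fun s t => r ≤ |s - t|) → ∀ f : E3 → ℂ, MemLp f 2 volume →
    ∀ w : E3 → ℝ≥0∞, Measurable w →
    ∑ s ∈ S, ∫⁻ x, ‖sconv (plateKernel (frameBasis e s) ![r, 1, 1] (star_pos hr) F) f x‖ₑ ^ 2 * w x ≤
      ENNReal.ofReal (C * K ^ 6) * ∫⁻ x, ‖f x‖ₑ ^ 2 *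
        nikodymMax (Icc a b) e (nikodymScale r K (n + 1)) (nikodymIter (Icc a b) e r K (n + 1) w) x := by
  have hL := hF.one_le
  obtain ⟨C₀, A, hC₀, hA, h₀⟩ := hF.exists_iterated_step hη hFη n
  obtain ⟨C₁, hC₁, h₁⟩ := hF.exists_sum_coneKernel_le hη one_pos one_le_two hA
  obtain ⟨C₂, hC₂, h₂⟩ := exists_lconv_le_lconv_lconv 1 zero_le_one
  obtain ⟨q, hq, h₃⟩ := exists_lconv_prodWeight_le_nikodymMax
  obtain ⟨C₄, hC₄, h₄⟩ := exists_nikodymMax_le_nikodymMax_nikodymMax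
  obtain ⟨C₅, hC₅⟩ : ∃ C : ℝ, C = C₂ * C₁ * (q * (q * C₀ * C₄)) := ⟨_, rfl⟩
  have hC₅0 : 0 < C₅ := by rw [hC₅]; positivity
  refine ⟨C₀ * (2 * C₅), by positivity, fun t₀ t₁ h₀' h₁' hJ r K hr hK hKr hKr' S hS hsep f hf w hw => ?_⟩
  obtain ⟨S₁, hS₁, hsep₁, W, hW, hW', hle⟩ :=
    h₀ t₀ t₁ h₀' h₁' hJ r K hr hK hKr S hS hsep f hf w hw
  have hI : ∀ s ∈ Icc t₀ t₁, s ∈ Icc a b := fun s hs => ⟨h₀'.trans hs.1, hs.2.trans h₁'⟩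
  have hK0 : 0 < K := by linarith
  set R := K ^ (n + 1) * r with hR
  have hR0 : 0 < R := by positivity
  set N := nikodymMax (Icc a b) e (nikodymScale r K (n + 1))
    (nikodymIter (Icc a b) e r K (n + 1) w) with hN
  have hone : ∀ σ ∈ S₁, ∫⁻ x, ‖sconv (coneKernel hη one_pos (A * R) (e 0 σ) (e 1 t₀)) f x‖ₑ ^ 2 *
      lconv W (prodWeight (frameBasis e σ) (nikodymScale r K n)) x ≤
      ENNReal.ofReal C₅ * ∫⁻ x, ‖f x‖ₑ ^ 2 * N x := by
    intro σ hσ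
    have hσI := hI σ (hS₁ σ hσ)
    set V := lconv W (prodWeight (frameBasis e σ) (nikodymScale r K n)) with hV
    have hVm : Measurable V := measurable_lconv hW (prodWeight_continuous _ _)
    -- One more average, over the smaller plate of index n + 1, makes the weight admissible for the
    -- last pieces and produces the outermost operator N_{n+1}.
    have hVle : ∀ x, V x ≤ ENNReal.ofReal C₂ *
        lconv V (prodWeight (frameBasis e σ) (nikodymScale r K (n + 1))) x := fun x =>
      h₂ _ _ _ _ (nikodymScale_pos hr hK0 n) (nikodymScale_pos hr hK0 (n + 1)) (fun z => by
        rw [one_mul]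
        refine gauge3_mono_scale _ (fun j => ?_) z
        fin_cases j
        · exact mul_le_mul_of_nonneg_right (pow_le_pow_right₀ hK (Nat.le_succ n)) hr.le
        · exact le_rfl
        · exact le_rfl) _ _ (Or.inr rfl) (Or.inr rfl) W x
    have hV2 : ∀ x, V x ≤ ENNReal.ofReal (q * C₀ * C₄) *
        nikodymIter (Icc a b) e r K (n + 1) w x := fun x => by
      calc V x ≤ ENNReal.ofReal q * nikodymMax (Icc a b) e (nikodymScale r K n) W x :=
            h₃ _ _ hF.orthonormal _ (nikodymScale_pos hr hK0 n) σ hσI W hW.aemeasurable x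
        _ ≤ ENNReal.ofReal q * (ENNReal.ofReal C₀ * nikodymMax (Icc a b) e (nikodymScale r K n)
              (nikodymIter (Icc a b) e r K n w) x) := by
            refine mul_le_mul_right ?_ _
            rw [← nikodymMax_const_mul ENNReal.ofReal_ne_top]
            exact nikodymMax_mono hW' x
        _ ≤ ENNReal.ofReal q * (ENNReal.ofReal C₀ * (ENNReal.ofReal C₄ *
              nikodymIter (Icc a b) e r K (n + 1) w x)) :=
            mul_le_mul_right (mul_le_mul_right (h₄ (Icc a b) e hF.orthonormal _
              (nikodymScale_pos hr hK0 n) _ x) _) _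
        _ = _ := by
            rw [← mul_assoc, ← mul_assoc, ← ENNReal.ofReal_mul hq.le,
              ← ENNReal.ofReal_mul (by positivity)]
    have hV3 : ∀ x, lconv V (prodWeight (frameBasis e σ) (nikodymScale r K (n + 1))) x ≤
        ENNReal.ofReal (q * (q * C₀ * C₄)) * N x := fun x => by
      calc _ ≤ ENNReal.ofReal q * nikodymMax (Icc a b) e (nikodymScale r K (n + 1)) V x :=
            h₃ _ _ hF.orthonormal _ (nikodymScale_pos hr hK0 _) σ hσI V hVm.aemeasurable x
        _ ≤ ENNReal.ofReal q * (ENNReal.ofReal (q * C₀ * C₄) * N x) := by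
            refine mul_le_mul_right ?_ _
            rw [hN, ← nikodymMax_const_mul ENNReal.ofReal_ne_top]
            exact nikodymMax_mono hV2 x
        _ = _ := by rw [← mul_assoc, ← ENNReal.ofReal_mul hq.le]
    -- For a single point the square function estimate is the weighted L² bound of one piece.
    have hsing := h₁ t₀ t₁ h₀' h₁' hJ R K hR0 hKr hK {σ}
      (fun s hs => by rw [Finset.mem_singleton.1 hs]; exact hS₁ σ hσ)
      (by rw [Finset.coe_singleton]; exact pairwise_singleton _ _) σ (hS₁ σ hσ)
      (fun s hs => by rw [Finset.mem_singleton.1 hs, sub_self, abs_zero]; positivity) f hf V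
      hVm.aemeasurable
    rw [Finset.sum_singleton] at hsing
    calc _ ≤ ∫⁻ x, ENNReal.ofReal C₂ * (‖sconv (coneKernel hη one_pos (A * R) (e 0 σ) (e 1 t₀)) f x‖ₑ ^ 2 *
          lconv V (prodWeight (frameBasis e σ) (nikodymScale r K (n + 1))) x) :=
          lintegral_mono fun x => by
            rw [mul_left_comm (ENNReal.ofReal C₂)]
            exact mul_le_mul_right (hVle x) _
      _ ≤ ENNReal.ofReal C₂ * (ENNReal.ofReal C₁ * ∫⁻ x, ‖f x‖ₑ ^ 2 *
          lconv V (prodWeight (frameBasis e σ) (nikodymScale r K (n + 1))) x) := by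
          rw [lintegral_const_mul' _ _ ENNReal.ofReal_ne_top]
          exact mul_le_mul_right hsing _
      _ ≤ ENNReal.ofReal C₂ * (ENNReal.ofReal C₁ * ∫⁻ x,
          ENNReal.ofReal (q * (q * C₀ * C₄)) * (‖f x‖ₑ ^ 2 * N x)) := by
          refine mul_le_mul_right (mul_le_mul_right (lintegral_mono fun x => ?_) _) _
          rw [mul_left_comm]
          exact mul_le_mul_right (hV3 x) _
      _ = _ := by
          rw [lintegral_const_mul' _ _ ENNReal.ofReal_ne_top, ← mul_assoc, ← mul_assoc,
            ← ENNReal.ofReal_mul hC₂.le, ← ENNReal.ofReal_mul (by positivity), hC₅]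
  -- The remaining points are R-separated with K²R ≥ 1 on an arc shorter than 1. Summing over them
  -- trivially turns K⁴ into K⁶.
  have hcard : (S₁.card : ℝ) ≤ 2 * K ^ 2 := by
    rcases S₁.eq_empty_or_nonempty with rfl | ⟨s, hs⟩
    · simp; positivity
    have hlen : 0 ≤ t₁ - t₀ := by linarith [(hS₁ s hs).1, (hS₁ s hs).2]
    have h5 := card_le_of_separated (t₀ := t₀) (ℓ := t₁ - t₀) hR0 hlen
      (fun s hs => ⟨(hS₁ s hs).1, by linarith [(hS₁ s hs).2]⟩) hsep₁
    have h6 : (t₁ - t₀) / R ≤ K ^ 2 := by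
      rw [div_le_iff₀ hR0]
      have : K ^ 2 * R = K ^ (n + 3) * r := by rw [hR]; ring
      nlinarith
    have h7 : 1 ≤ K ^ 2 := one_le_pow₀ hK
    linarith
  calc _ ≤ ENNReal.ofReal (C₀ * K ^ 4) * ∑ σ ∈ S₁, ENNReal.ofReal C₅ * ∫⁻ x, ‖f x‖ₑ ^ 2 * N x :=
        hle.trans (mul_le_mul_right (Finset.sum_le_sum hone) _)
    _ = ENNReal.ofReal (C₀ * K ^ 4 * (S₁.card * C₅)) * ∫⁻ x, ‖f x‖ₑ ^ 2 * N x := by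
        rw [Finset.sum_const, nsmul_eq_mul, ← ENNReal.ofReal_natCast, ← mul_assoc, ← mul_assoc,
          ← ENNReal.ofReal_mul (by positivity), ← ENNReal.ofReal_mul (by positivity)]
        congr 2
        ring
    _ ≤ _ := by
        refine mul_le_mul_left (ENNReal.ofReal_le_ofReal ?_) _
        calc C₀ * K ^ 4 * (S₁.card * C₅) ≤ C₀ * K ^ 4 * (2 * K ^ 2 * C₅) := by gcongr
          _ = _ := by ring

end

end

/-! ### The whole interval, the case M = 0, and the weighted inequality -/

section

open scoped SchwartzMap LineDeriv Topology

section
variable {a b : ℝ} {e : Fin 3 → ℝ → E3} {α τ : ℝ → ℝ} {c L : ℝ}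

/-- The estimate on a short interval implies the one on the full interval. -/
theorem FrenetBounds.exists_full_interval_le (hF : FrenetBounds (Icc a b) e α τ c L) {η : ℝ → ℝ}
    (hη : IsCutoff η) {F : 𝓢(E3, ℂ)} (hFη : ∀ y : E3,
    (𝓕 F : 𝓢(E3, ℂ)) y = ((η (2 * Real.pi * y 0) * betaTilde η (2 * Real.pi * y 1) *
      η (2 * Real.pi * y 2) : ℝ) : ℂ)) (n : ℕ) :
    ∃ C : ℝ, 0 < C ∧ ∀ r K : ℝ, ∀ hr : 0 < r, 1 ≤ K → K ^ (n + 1) * r ≤ 1 → 1 ≤ K ^ (n + 3) * r →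
    ∀ S : Finset ℝ, (∀ s ∈ S, s ∈ Icc a b) →
    (S : Set ℝ).Pairwise (fun s t => r ≤ |s - t|) → ∀ f : E3 → ℂ, MemLp f 2 volume →
    ∀ w : E3 → ℝ≥0∞, Measurable w →
    ∑ s ∈ S, ∫⁻ x, ‖sconv (plateKernel (frameBasis e s) ![r, 1, 1] (star_pos hr) F) f x‖ₑ ^ 2 * w x ≤
      ENNReal.ofReal (C * K ^ 6) * ∫⁻ x, ‖f x‖ₑ ^ 2 *
        nikodymMax (Icc a b) e (nikodymScale r K (n + 1)) (nikodymIter (Icc a b) e r K (n + 1) w) x := by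
  obtain ⟨C, hC, h⟩ := hF.exists_short_interval_le hη hFη n
  have hL := hF.one_le
  -- The longest arc admitted by the short interval estimate; the number of such arcs depends on the
  -- curve only.
  set ℓ : ℝ := 1 / (1024 * L) with hℓ
  have hℓ0 : 0 < ℓ := by positivity
  obtain ⟨N, hN⟩ : ∃ N : ℝ, N = |b - a| / ℓ + 1 := ⟨_, rfl⟩
  have hN0 : 0 < N := by rw [hN]; positivity
  refine ⟨N * C, by positivity, fun r K hr hK hKr hKr' S hS hsep f hf w hw => ?_⟩
  set rd := gridRound a ℓ with hrd
  set X := ENNReal.ofReal (C * K ^ 6) * ∫⁻ x, ‖f x‖ₑ ^ 2 *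
    nikodymMax (Icc a b) e (nikodymScale r K (n + 1)) (nikodymIter (Icc a b) e r K (n + 1) w) x
    with hX
  have hcard : ((S.image rd).card : ℝ) ≤ N := by
    rw [hN]
    refine card_le_of_separated (t₀ := a) hℓ0 (abs_nonneg _) (fun σ hσ => ?_)
      fun σ hσ σ' hσ' hne => ?_
    · obtain ⟨s, hs, rfl⟩ := Finset.mem_image.1 hσ
      have h1 := gridRound_le hℓ0 (hS s hs).1
      exact ⟨le_gridRound hℓ0, by linarith [(hS s hs).2, le_abs_self (b - a)]⟩
    · obtain ⟨s, hs, rfl⟩ := Finset.mem_image.1 hσ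
      obtain ⟨s', hs', rfl⟩ := Finset.mem_image.1 hσ'
      exact gridRound_separated hℓ0 hne
  calc _ = ∑ σ ∈ S.image rd, ∑ s ∈ S with rd s = σ, ∫⁻ x, ‖sconv (plateKernel (frameBasis e s)
          ![r, 1, 1] (star_pos hr) F) f x‖ₑ ^ 2 * w x :=
        (Finset.sum_fiberwise_of_maps_to (fun s hs => Finset.mem_image_of_mem rd hs) _).symm
    _ ≤ ∑ σ ∈ S.image rd, X := by
        refine Finset.sum_le_sum fun σ hσ => ?_
        obtain ⟨s₀, hs₀, hs₀'⟩ := Finset.mem_image.1 hσ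
        refine h σ (min b (σ + ℓ)) (hs₀' ▸ le_gridRound hℓ0) (min_le_left _ _) ?_ r K hr hK hKr hKr' _
          (fun s hs => ?_) (hsep.mono fun s hs => (Finset.mem_filter.1 hs).1) f hf w hw
        · calc L * (min b (σ + ℓ) - σ) ≤ L * ℓ := by
                refine mul_le_mul_of_nonneg_left ?_ (by linarith)
                linarith [min_le_right b (σ + ℓ)]
            _ = 1 / 1024 := by rw [hℓ]; field_simp
        · obtain ⟨hsS, rfl⟩ := Finset.mem_filter.1 hs
          have hs := hsS
          exact ⟨gridRound_le hℓ0 (hS s hs).1, le_min (hS s hs).2 (lt_gridRound_add hℓ0).le⟩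
    _ ≤ ENNReal.ofReal N * X := by
        rw [Finset.sum_const, nsmul_eq_mul, ← ENNReal.ofReal_natCast]
        exact mul_le_mul_left (ENNReal.ofReal_le_ofReal hcard) _
    _ = _ := by rw [hX, ← mul_assoc, ← ENNReal.ofReal_mul hN0.le, mul_assoc N]

/-- The direct estimate, without iteration. -/
theorem FrenetBounds.exists_direct_le (hF : FrenetBounds (Icc a b) e α τ c L) (F : 𝓢(E3, ℂ)) :
    ∃ C : ℝ, 0 < C ∧ ∀ r K : ℝ, ∀ hr : 0 < r, r ≤ 1 → 1 ≤ K → 1 ≤ K ^ 2 * r →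
    ∀ S : Finset ℝ, (∀ s ∈ S, s ∈ Icc a b) →
    (S : Set ℝ).Pairwise (fun s t => r ≤ |s - t|) → ∀ f : E3 → ℂ, MemLp f 2 volume →
    ∀ w : E3 → ℝ≥0∞, Measurable w →
    ∑ s ∈ S, ∫⁻ x, ‖sconv (plateKernel (frameBasis e s) ![r, 1, 1] (star_pos hr) F) f x‖ₑ ^ 2 * w x ≤
      ENNReal.ofReal (C * K ^ 4) * ∫⁻ x, ‖f x‖ₑ ^ 2 *
        nikodymMax (Icc a b) e (nikodymScale r K 0) (nikodymIter (Icc a b) e r K 0 w) x := by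
  obtain ⟨C₁, hC₁, h₁⟩ := exists_lintegral_sconv_plateKernel_le F
  obtain ⟨C₂, hC₂, h₂⟩ := exists_lconv_le_lconv_lconv 1 zero_le_one
  obtain ⟨B, hB⟩ : ∃ B : ℝ, B = |b - a| + 1 := ⟨_, rfl⟩
  have hB0 : 0 < B := by rw [hB]; positivity
  refine ⟨B * (C₁ * C₂), by positivity, fun r K hr hr1 hK hKr S hS hsep f hf w hw => ?_⟩
  have hK0 : 0 < K := by linarith
  set N := nikodymMax (Icc a b) e (nikodymScale r K 0) (nikodymIter (Icc a b) e r K 0 w) with hN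
  have hone : ∀ s ∈ S, ∫⁻ x, ‖sconv (plateKernel (frameBasis e s) ![r, 1, 1] (star_pos hr) F) f x‖ₑ ^ 2 *
      w x ≤ ENNReal.ofReal (C₁ * (C₂ * K ^ 2)) * ∫⁻ x, ‖f x‖ₑ ^ 2 * N x := by
    intro s hs
    set V := lconv w (frameWeight (frameBasis e s) ![r, 1, 1]) with hV
    have hVm : Measurable V := measurable_lconv hw (frameWeight_continuous _ _ (star_pos hr))
    have hV1 : ∀ x, V x ≤ ENNReal.ofReal (C₂ * K ^ 2) * N x := by
      intro x
      refine (h₂ _ _ ![r, 1, 1] ![r, 1, 1] (star_pos hr) (star_pos hr) (fun z => (one_mul _).ge) _ _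
        (Or.inl rfl) (Or.inl rfl) w x).trans ?_
      rw [ENNReal.ofReal_mul hC₂.le, mul_assoc]
      refine mul_le_mul_right ?_ _
      refine (lconv_mono_right (C := K ^ 2) (by positivity) (fun y => frameWeight_le_of_le _
        (nikodymScale_pos hr hK0 0) (fun j => ?_) ?_ y)
        (frameWeight_continuous _ _ (nikodymScale_pos hr hK0 0)) x hVm.aemeasurable).trans ?_
      · have hKi : K⁻¹ ≤ 1 := inv_le_one_of_one_le₀ hK
        fin_cases j
        · simp [nikodymScale]
        · simpa [nikodymScale] using hKi
        · simpa [nikodymScale] using hKi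
      · simp only [nikodymScale, Fin.prod_univ_three]
        simp
        field_simp
      · refine mul_le_mul_right ?_ _
        refine (lconv_mono (fun y => ?_) x).trans (lconv_le_nikodymMax (hS s hs)
          (hF.orthonormal s (hS s hs)) _ _ x)
        exact lconv_le_nikodymMax (hS s hs) (hF.orthonormal s (hS s hs)) _ w y
    calc _ ≤ ENNReal.ofReal C₁ * ∫⁻ x, ‖f x‖ₑ ^ 2 * V x := h₁ _ _ _ _ hf w hw.aemeasurable
      _ ≤ ENNReal.ofReal C₁ * ∫⁻ x, ENNReal.ofReal (C₂ * K ^ 2) * (‖f x‖ₑ ^ 2 * N x) := by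
          refine mul_le_mul_right (lintegral_mono fun x => ?_) _
          rw [mul_left_comm]
          exact mul_le_mul_right (hV1 x) _
      _ = _ := by
          rw [lintegral_const_mul' _ _ ENNReal.ofReal_ne_top, ← mul_assoc,
            ← ENNReal.ofReal_mul hC₁.le]
  -- There are at most |b - a|/r + 1 points and r⁻¹ ≤ K². The other K² is the volume ratio of the
  -- plates (r, K⁻¹, K⁻¹) and (r, 1, 1).
  have hcard : (S.card : ℝ) ≤ B * K ^ 2 := by
    have h5 := card_le_of_separated (t₀ := a) hr (abs_nonneg (b - a))
      (fun s hs => ⟨(hS s hs).1, by linarith [(hS s hs).2, le_abs_self (b - a)]⟩) hsep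
    have h6 : |b - a| / r ≤ |b - a| * K ^ 2 := by
      rw [div_le_iff₀ hr]
      nlinarith [abs_nonneg (b - a)]
    have h7 : 1 ≤ K ^ 2 := one_le_pow₀ hK
    rw [hB]
    linarith
  calc _ ≤ ∑ s ∈ S, ENNReal.ofReal (C₁ * (C₂ * K ^ 2)) * ∫⁻ x, ‖f x‖ₑ ^ 2 * N x :=
        Finset.sum_le_sum hone
    _ = ENNReal.ofReal (S.card * (C₁ * (C₂ * K ^ 2))) * ∫⁻ x, ‖f x‖ₑ ^ 2 * N x := by
        rw [Finset.sum_const, nsmul_eq_mul, ← ENNReal.ofReal_natCast, ← mul_assoc,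
          ← ENNReal.ofReal_mul (by positivity)]
    _ ≤ _ := by
        refine mul_le_mul_left (ENNReal.ofReal_le_ofReal ?_) _
        calc S.card * (C₁ * (C₂ * K ^ 2)) ≤ (B * K ^ 2) * (C₁ * (C₂ * K ^ 2)) := by gcongr
          _ = _ := by ring

end

theorem one_le_rpow_neg {r ε : ℝ} (hr : 0 < r) (hr1 : r < 1) (hε : 0 < ε) : 1 ≤ r ^ (-(ε / 8)) :=
  Real.one_le_rpow_of_pos_of_le_one_of_nonpos hr hr1.le (by linarith)

theorem rpow_neg_pow {r : ℝ} (hr : 0 < r) (ε : ℝ) (m : ℕ) :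
    (r ^ (-(ε / 8))) ^ m * r = r ^ (1 - ε / 8 * m) := by
  rw [← Real.rpow_natCast, ← Real.rpow_mul hr.le]
  conv_lhs => rw [← Real.rpow_one r]
  rw [← Real.rpow_mul hr.le, ← Real.rpow_add hr]
  congr 1
  ring

/-- The weighted inequality for the box multipliers. -/
theorem exists_lintegral_boxes_le {a b : ℝ} (hab : a < b) {γ : ℝ → E3}
    (hγ : ContDiffOn ℝ ∞ γ (Icc a b)) (hnd : NonDegenerateCurve γ (Icc a b))
    {η : ℝ → ℝ} (hη : IsCutoff η) {ε : ℝ} (hε : 0 < ε) :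
    ∃ C : ℝ, 0 < C ∧ ∀ r : ℝ, 0 < r → r < 1 →
      ∀ P : FrenetBoxDecomposition γ (Icc a b) r,
      ∀ f : Lp ℂ 2 (volume : Measure E3),
      ∀ w : E3 → ℝ, LocallyIntegrable w volume → (∀ x, 0 ≤ w x) →
        ∫⁻ x, (∑' s : P.points, ‖multiplierOp (P.cutoff η s) f x‖ₑ ^ 2) *
            ENNReal.ofReal (w x) ≤
          ENNReal.ofReal (C * r ^ (-ε)) *
            ∫⁻ x, ‖f x‖ₑ ^ 2 *
              forwardMax γ (Icc a b) r ε (fun z => ENNReal.ofReal (w z)) x := by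
  obtain ⟨α, τ, c, L, hF⟩ := exists_frenetBounds hab hγ hnd
  obtain ⟨F, hFη⟩ := exists_boxProfile hη
  obtain ⟨M, hM⟩ : ∃ M : ℕ, M = ⌊8 / ε⌋₊ - 1 := ⟨_, rfl⟩
  have key : ∃ C : ℝ, 0 < C ∧ ∀ r : ℝ, ∀ hr : 0 < r, r < 1 →
      ∀ S : Finset ℝ, (∀ s ∈ S, s ∈ Icc a b) →
      (S : Set ℝ).Pairwise (fun s t => r ≤ |s - t|) → ∀ f : E3 → ℂ, MemLp f 2 volume →
      ∀ w : E3 → ℝ≥0∞, Measurable w →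
      ∑ s ∈ S, ∫⁻ x, ‖sconv (plateKernel (frameBasis (frenet γ (Icc a b)) s) ![r, 1, 1]
          (star_pos hr) F) f x‖ₑ ^ 2 * w x ≤
        ENNReal.ofReal (C * r ^ (-ε)) * ∫⁻ x, ‖f x‖ₑ ^ 2 * forwardMax γ (Icc a b) r ε w x := by
    -- K⁸ = r^{-ε}, so up to eight powers of K may be lost.
    have hpow : ∀ (r : ℝ), 0 < r → r < 1 → ∀ j : ℕ, j ≤ 8 → ∀ C : ℝ, 0 < C →
        C * (r ^ (-(ε / 8))) ^ j ≤ C * r ^ (-ε) := by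
      intro r hr hr1 j hj C hC
      refine mul_le_mul_of_nonneg_left ?_ hC.le
      refine (pow_le_pow_right₀ (one_le_rpow_neg hr hr1 hε) hj).trans (le_of_eq ?_)
      rw [← Real.rpow_natCast, ← Real.rpow_mul hr.le]
      congr 1
      push_cast
      ring
    have hfl := Nat.lt_floor_add_one (8 / ε)
    rw [div_lt_iff₀ hε] at hfl
    -- If M = 0 then 8/ε < 2, so K²r = r^{1-ε/4} ≥ 1. If M = n + 1 then ⌊8/ε⌋ = n + 2, which gives
    -- K^{n+1}r ≤ 1 ≤ K^{n+3}r.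
    rcases Nat.eq_zero_or_pos M with h0 | hpos
    · obtain ⟨C, hC, h⟩ := hF.exists_direct_le F
      refine ⟨C, hC, fun r hr hr1 S hS hsep f hf w hw => ?_⟩
      have hK := one_le_rpow_neg hr hr1 hε
      have hfl1 : (⌊8 / ε⌋₊ : ℝ) ≤ 1 := by exact_mod_cast (by omega : ⌊8 / ε⌋₊ ≤ 1)
      refine (h r _ hr hr1.le hK ?_ S hS hsep f hf w hw).trans ?_
      · rw [rpow_neg_pow hr]
        refine Real.one_le_rpow_of_pos_of_le_one_of_nonpos hr hr1.le ?_
        push_cast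
        nlinarith
      · simp only [forwardMax, Function.comp_apply, ← hM, h0]
        exact mul_le_mul_left (ENNReal.ofReal_le_ofReal (hpow r hr hr1 4 (by norm_num) C hC)) _
    · obtain ⟨n, rfl⟩ : ∃ n, M = n + 1 := ⟨M - 1, by omega⟩
      obtain ⟨C, hC, h⟩ := hF.exists_full_interval_le hη hFη n
      refine ⟨C, hC, fun r hr hr1 S hS hsep f hf w hw => ?_⟩
      have hK := one_le_rpow_neg hr hr1 hε
      have hn : ⌊8 / ε⌋₊ = n + 2 := by omega
      have hfl2 := Nat.floor_le (by positivity : 0 ≤ 8 / ε)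
      rw [le_div_iff₀ hε, hn] at hfl2
      rw [hn] at hfl
      push_cast at hfl hfl2
      refine (h r _ hr hK ?_ ?_ S hS hsep f hf w hw).trans ?_
      · rw [rpow_neg_pow hr]
        refine Real.rpow_le_one hr.le hr1.le ?_
        push_cast
        nlinarith
      · rw [rpow_neg_pow hr]
        refine Real.one_le_rpow_of_pos_of_le_one_of_nonpos hr hr1.le ?_
        push_cast
        nlinarith
      · simp only [forwardMax, Function.comp_apply, ← hM]
        exact mul_le_mul_left (ENNReal.ofReal_le_ofReal (hpow r hr hr1 6 (by norm_num) C hC)) _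
  obtain ⟨C, hC, h⟩ := key
  refine ⟨C, hC, fun r hr hr1 P f w hw hw0 => ?_⟩
  have hfin : P.points.Finite := finite_of_separated hr P.subset P.separated
  have hwm : AEMeasurable (fun z => ENNReal.ofReal (w z)) volume :=
    hw.aestronglyMeasurable.aemeasurable.ennreal_ofReal
  have hae := hwm.ae_eq_mk
  set w' := hwm.mk _ with hw'
  have hw'm : Measurable w' := hwm.measurable_mk
  set k : ℝ → 𝓢(E3, ℂ) := fun s =>
    plateKernel (frameBasis (frenet γ (Icc a b)) s) ![r, 1, 1] (star_pos hr) F with hk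
  have hmul : ∀ s ∈ P.points, ∀ x, multiplierOp (boxCutoff γ (Icc a b) η r s) f x =
      sconv (k s) f x := fun s hs x =>
    multiplierOp_eq_sconv (fun ζ => fourier_boxKernel hFη hr (hF.orthonormal s (P.subset hs)) ζ) f x
  calc _ = ∫⁻ x, ∑ s ∈ hfin.toFinset, ‖sconv (k s) f x‖ₑ ^ 2 * w' x := by
        refine lintegral_congr_ae ?_
        filter_upwards [hae] with x hx
        rw [hx, ← Finset.sum_mul]
        congr 1
        have e : ∑' s : P.points, ‖sconv (k s) f x‖ₑ ^ 2 =
            ∑ s ∈ hfin.toFinset, ‖sconv (k s) f x‖ₑ ^ 2 := by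
          have := Finset.tsum_subtype' hfin.toFinset fun s => ‖sconv (k s) f x‖ₑ ^ 2
          rwa [hfin.coe_toFinset] at this
        rw [← e]
        exact tsum_congr fun s => by rw [← hmul s s.2 x]; rfl
    _ = ∑ s ∈ hfin.toFinset, ∫⁻ x, ‖sconv (k s) f x‖ₑ ^ 2 * w' x := by
        refine lintegral_finsetSum' _ fun s _ => ?_
        exact ((sconv_stronglyMeasurable (k s)
          (Lp.memLp f)).aestronglyMeasurable.enorm.pow_const 2).mul hw'm.aemeasurable
    _ ≤ _ := by
        rw [forwardMax_congr_ae hae]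
        exact h r hr hr1 hfin.toFinset (fun s hs => P.subset (hfin.mem_toFinset.1 hs))
          (by rw [hfin.coe_toFinset]; exact P.separated) f (Lp.memLp f) w' hw'm

end

section

open scoped SchwartzMap LineDeriv Topology

/-! ### Variation of Gaussian symbols along the curve -/

theorem eVariationOn_le_one {f : ℝ → ℝ} {t : Set ℝ} (hf : MonotoneOn f t ∨ AntitoneOn f t)
    (h : MapsTo f t (Icc 0 1)) : eVariationOn f t ≤ 1 := by
  have h1 : eVariationOn (id : ℝ → ℝ) (Icc 0 1) ≤ 1 := by
    have := (monotoneOn_id (s := univ (α := ℝ))).eVariationOn_le (mem_univ 0) (mem_univ 1)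
    simpa using this
  rcases hf with hf | hf
  · exact (eVariationOn.comp_le_of_monotoneOn id f hf h).trans h1
  · exact (eVariationOn.comp_le_of_antitoneOn id f hf h).trans h1

theorem eVariationOn_Icc_add_Icc (f : ℝ → ℝ) {x y z : ℝ} (hxy : x ≤ y) (hyz : y ≤ z) :
    eVariationOn f (Icc x y) + eVariationOn f (Icc y z) = eVariationOn f (Icc x z) := by
  simpa using eVariationOn.Icc_add_Icc f (s := univ) hxy hyz (mem_univ y)

/-- The function is even and monotone in |u|, hence monotone on each half of the interval, with
values in [0, 1]. -/
theorem eVariationOn_exp_sq_le {A B n : ℝ} (hn : 0 ≤ n)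
    (h : ∀ u ∈ Icc (-n) n, A * u ^ 2 + B ≤ 0) :
    eVariationOn (fun u => Real.exp (A * u ^ 2 + B)) (Icc (-n) n) ≤ 2 := by
  have hm : MapsTo (fun u => Real.exp (A * u ^ 2 + B)) (Icc (-n) n) (Icc 0 1) := fun u hu =>
    ⟨(Real.exp_pos _).le, Real.exp_le_one_iff.2 (h u hu)⟩
  rw [← eVariationOn_Icc_add_Icc _ (neg_nonpos.2 hn) hn,
    show (2 : ℝ≥0∞) = 1 + 1 by norm_num]
  refine add_le_add (eVariationOn_le_one ?_ (hm.mono_left (Icc_subset_Icc_right hn)))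
    (eVariationOn_le_one ?_ (hm.mono_left (Icc_subset_Icc_left (neg_nonpos.2 hn))))
  · rcases le_total 0 A with hA | hA
    · right
      intro x hx y hy hxy
      have : y ^ 2 ≤ x ^ 2 := by nlinarith [hy.2]
      exact Real.exp_le_exp.2 (by nlinarith)
    · left
      intro x hx y hy hxy
      have : y ^ 2 ≤ x ^ 2 := by nlinarith [hy.2]
      exact Real.exp_le_exp.2 (by nlinarith)
  · rcases le_total 0 A with hA | hA
    · left
      intro x hx y hy hxy
      have : x ^ 2 ≤ y ^ 2 := by nlinarith [hx.1]
      exact Real.exp_le_exp.2 (by nlinarith)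
    · right
      intro x hx y hy hxy
      have : x ^ 2 ≤ y ^ 2 := by nlinarith [hx.1]
      exact Real.exp_le_exp.2 (by nlinarith)

/-- The Fourier transform of the Gaussian adapted to a plate, as a function of the base point. -/
noncomputable def plateSymbol (e : Fin 3 → ℝ → E3) (R κ : ℝ) (ξ : E3) (s : ℝ) : ℝ :=
  Real.exp (-Real.pi * ((R⁻¹ * inner ℝ (e 0 s) ξ) ^ 2 + (κ⁻¹ * inner ℝ (e 1 s) ξ) ^ 2 +
    (κ⁻¹ * inner ℝ (e 2 s) ξ) ^ 2))

theorem plateSymbol_neg (e : Fin 3 → ℝ → E3) (R κ : ℝ) (ξ : E3) (s : ℝ) :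
    plateSymbol e R κ (-ξ) s = plateSymbol e R κ ξ s := by
  simp [plateSymbol, inner_neg_right]

theorem plateSymbol_mem (e : Fin 3 → ℝ → E3) (R κ : ℝ) (ξ : E3) (s : ℝ) :
    plateSymbol e R κ ξ s ∈ Icc (0 : ℝ) 1 := by
  refine ⟨(Real.exp_pos _).le, Real.exp_le_one_iff.2 ?_⟩
  have := Real.pi_pos
  rw [neg_mul, neg_nonpos]
  positivity

section
variable {a b : ℝ} {e : Fin 3 → ℝ → E3} {α τ : ℝ → ℝ} {c L : ℝ}

theorem FrenetBounds.norm_sq_eq (hF : FrenetBounds (Icc a b) e α τ c L) {s : ℝ}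
    (hs : s ∈ Icc a b) (ξ : E3) :
    ‖ξ‖ ^ 2 = inner ℝ (e 0 s) ξ ^ 2 + inner ℝ (e 1 s) ξ ^ 2 + inner ℝ (e 2 s) ξ ^ 2 := by
  have := (frameBasis e s).sum_sq_norm_inner_right ξ
  rw [Fin.sum_univ_three] at this
  simp only [frameBasis_apply (hF.orthonormal s hs), Real.norm_eq_abs, sq_abs] at this
  exact this.symm

theorem FrenetBounds.abs_inner_le (hF : FrenetBounds (Icc a b) e α τ c L) {s : ℝ}
    (hs : s ∈ Icc a b) (ξ : E3) (j : Fin 3) : |inner ℝ (e j s) ξ| ≤ ‖ξ‖ := by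
  have := abs_real_inner_le_norm (e j s) ξ
  rwa [(hF.orthonormal s hs).1 j, one_mul] at this

/-- The scales of e_1 and e_2 coincide, so Pythagoras removes both coordinates: for fixed ξ the
symbol depends on s only through ⟨e_0(s),ξ⟩. The variation argument rests on this. -/
theorem FrenetBounds.plateSymbol_eq (hF : FrenetBounds (Icc a b) e α τ c L) {s : ℝ}
    (hs : s ∈ Icc a b) (R κ : ℝ) (ξ : E3) :
    plateSymbol e R κ ξ s = Real.exp (Real.pi * (κ⁻¹ ^ 2 - R⁻¹ ^ 2) * inner ℝ (e 0 s) ξ ^ 2 +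
      -Real.pi * κ⁻¹ ^ 2 * ‖ξ‖ ^ 2) := by
  rw [plateSymbol, hF.norm_sq_eq hs ξ]
  congr 1
  ring

/-- ⟨e_0,ξ⟩ has derivative α⟨e_1,ξ⟩ ≥ 0, and a monotone change of variable does not increase the
variation. -/
theorem FrenetBounds.eVariationOn_le_two (hF : FrenetBounds (Icc a b) e α τ c L) {x y : ℝ}
    (hx : a ≤ x) (hy : y ≤ b) (R κ : ℝ) (ξ : E3) (h : ∀ s ∈ Icc x y, 0 ≤ inner ℝ (e 1 s) ξ) :
    eVariationOn (plateSymbol e R κ ξ) (Icc x y) ≤ 2 := by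
  have hI : ∀ s ∈ Icc x y, s ∈ Icc a b := fun s hs => ⟨hx.trans hs.1, hs.2.trans hy⟩
  rw [eVariationOn.eq_of_eqOn (f' := (fun u => Real.exp (Real.pi * (κ⁻¹ ^ 2 - R⁻¹ ^ 2) * u ^ 2 +
      -Real.pi * κ⁻¹ ^ 2 * ‖ξ‖ ^ 2)) ∘ fun s => inner ℝ (e 0 s) ξ)
      fun s hs => hF.plateSymbol_eq (hI s hs) R κ ξ]
  refine (eVariationOn.comp_le_of_monotoneOn _ (s := Icc (-‖ξ‖) ‖ξ‖) (fun s => inner ℝ (e 0 s) ξ)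
    (fun s hs t ht hst => ?_) (fun s hs => abs_le.1 (hF.abs_inner_le (hI s hs) ξ 0))).trans
    (eVariationOn_exp_sq_le (norm_nonneg ξ) fun u hu => ?_)
  · have := hF.le_abs_inner_zero_sub (hx.trans hs.1) (ht.2.trans hy) hst (ξ := ξ) le_rfl
      fun z hz => h z ⟨hs.1.trans hz.1, hz.2.trans ht.2⟩
    simp only [mul_zero, zero_mul] at this
    linarith
  · have h1 : u ^ 2 ≤ ‖ξ‖ ^ 2 := sq_le_sq' hu.1 hu.2
    have h2 : 0 ≤ κ⁻¹ ^ 2 * (‖ξ‖ ^ 2 - u ^ 2) + R⁻¹ ^ 2 * u ^ 2 := by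
      have := sub_nonneg.2 h1
      positivity
    have := Real.pi_pos
    nlinarith

theorem FrenetBounds.eVariationOn_le_two' (hF : FrenetBounds (Icc a b) e α τ c L) {x y : ℝ}
    (hx : a ≤ x) (hy : y ≤ b) (R κ : ℝ) (ξ : E3) (h : ∀ s ∈ Icc x y, inner ℝ (e 1 s) ξ ≤ 0) :
    eVariationOn (plateSymbol e R κ ξ) (Icc x y) ≤ 2 := by
  have := hF.eVariationOn_le_two hx hy R κ (-ξ) fun s hs => by
    rw [inner_neg_right]; linarith [h s hs]
  rwa [funext (plateSymbol_neg e R κ ξ)] at this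

/-- By hypothesis ⟨e_1,ξ⟩ is non-decreasing, so it changes sign at most once; each side contributes
at most 2. -/
theorem FrenetBounds.eVariationOn_le_four (hF : FrenetBounds (Icc a b) e α τ c L) {x y : ℝ}
    (hx : a ≤ x) (hy : y ≤ b) (hxy : x ≤ y) (R κ : ℝ) (ξ : E3)
    (h : ∀ s ∈ Icc x y, 0 ≤ -α s * inner ℝ (e 0 s) ξ + τ s * inner ℝ (e 2 s) ξ) :
    eVariationOn (plateSymbol e R κ ξ) (Icc x y) ≤ 4 := by
  have hd := fun s (hs : s ∈ Icc a b) => hF.hasDerivWithinAt_inner_one ξ hs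
  have hmono : ∀ s ∈ Icc x y, ∀ t ∈ Icc x y, s ≤ t → inner ℝ (e 1 s) ξ ≤ inner ℝ (e 1 t) ξ := by
    intro s hs t ht hst
    have := mul_sub_le_of_le_hasDerivWithinAt hd (hx.trans hs.1) (ht.2.trans hy) hst (C := 0)
      fun z hz => h z ⟨hs.1.trans hz.1, hz.2.trans ht.2⟩
    simp only [zero_mul] at this
    linarith
  have h24 : (2 : ℝ≥0∞) ≤ 4 := by norm_num
  rcases le_total 0 (inner ℝ (e 1 x) ξ) with h0 | h0
  · exact (hF.eVariationOn_le_two hx hy R κ ξ fun s hs =>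
      h0.trans (hmono x ⟨le_rfl, hxy⟩ s hs hs.1)).trans h24
  rcases le_total (inner ℝ (e 1 y) ξ) 0 with h1 | h1
  · exact (hF.eVariationOn_le_two' hx hy R κ ξ fun s hs =>
      (hmono s hs y ⟨hxy, le_rfl⟩ hs.2).trans h1).trans h24
  have hcont : ContinuousOn (fun s => inner ℝ (e 1 s) ξ) (Icc x y) := fun s hs =>
    (hd s ⟨hx.trans hs.1, hs.2.trans hy⟩).continuousWithinAt.mono (Icc_subset_Icc hx hy)
  obtain ⟨z, hz, hz0⟩ := intermediate_value_Icc hxy hcont ⟨h0, h1⟩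
  simp only at hz0
  rw [← eVariationOn_Icc_add_Icc _ hz.1 hz.2, show (4 : ℝ≥0∞) = 2 + 2 by norm_num]
  refine add_le_add (hF.eVariationOn_le_two' hx (hz.2.trans hy) R κ ξ fun s hs => ?_)
    (hF.eVariationOn_le_two (hx.trans hz.1) hy R κ ξ fun s hs => ?_)
  · rw [← hz0]
    exact hmono s ⟨hs.1, hs.2.trans hz.2⟩ z hz hs.2
  · rw [← hz0]
    exact hmono z hz s ⟨hz.1.trans hs.1, hs.2⟩ hs.1

theorem FrenetBounds.eVariationOn_le_four' (hF : FrenetBounds (Icc a b) e α τ c L) {x y : ℝ}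
    (hx : a ≤ x) (hy : y ≤ b) (hxy : x ≤ y) (R κ : ℝ) (ξ : E3)
    (h : ∀ s ∈ Icc x y, -α s * inner ℝ (e 0 s) ξ + τ s * inner ℝ (e 2 s) ξ ≤ 0) :
    eVariationOn (plateSymbol e R κ ξ) (Icc x y) ≤ 4 := by
  have := hF.eVariationOn_le_four hx hy hxy R κ (-ξ) fun s hs => by
    rw [inner_neg_right, inner_neg_right]; linarith [h s hs]
  rwa [funext (plateSymbol_neg e R κ ξ)] at this

theorem mul_exp_neg_le_one (u : ℝ) : u * Real.exp (-u) ≤ 1 := by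
  rw [Real.exp_neg, ← div_eq_mul_inv, div_le_one (Real.exp_pos u)]
  linarith [Real.add_one_le_exp u]

/-- Let T = (κ⁻² + R⁻²)‖ξ‖². The lower bounds on the e_0 and e_2 coordinates give the decay
exp(-πμ²T), one for each scale, while the other factor is at most 2πLT. As ue^{-u} ≤ 1, the product
is bounded uniformly in R, κ and ξ. -/
theorem FrenetBounds.abs_deriv_plateSymbol_le (hF : FrenetBounds (Icc a b) e α τ c L) {s : ℝ}
    (hs : s ∈ Icc a b) (R κ : ℝ) {ξ : E3} {μ : ℝ} (hμ : 0 < μ)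
    (h0 : μ * ‖ξ‖ ≤ |inner ℝ (e 0 s) ξ|) (h2 : μ * ‖ξ‖ ≤ |inner ℝ (e 2 s) ξ|) :
    |plateSymbol e R κ ξ s * (Real.pi * (κ⁻¹ ^ 2 - R⁻¹ ^ 2) *
      (2 * inner ℝ (e 0 s) ξ * (α s * inner ℝ (e 1 s) ξ)))| ≤ 2 * L / μ ^ 2 := by
  have hπ := Real.pi_pos
  have hL : 0 ≤ L := zero_le_one.trans hF.one_le
  have hα0 : 0 < α s := hF.c_pos.trans_le (hF.a_lower s hs)
  set T := (κ⁻¹ ^ 2 + R⁻¹ ^ 2) * ‖ξ‖ ^ 2 with hT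
  have hT0 : 0 ≤ T := by positivity
  have hsq : ∀ u : ℝ, μ * ‖ξ‖ ≤ |u| → μ ^ 2 * ‖ξ‖ ^ 2 ≤ u ^ 2 := fun u hu => by
    rw [← mul_pow, ← sq_abs u]
    exact pow_le_pow_left₀ (by positivity) hu 2
  have hexp : plateSymbol e R κ ξ s ≤ Real.exp (-(Real.pi * μ ^ 2 * T)) := by
    refine Real.exp_le_exp.2 ?_
    rw [neg_mul, neg_le_neg_iff, mul_assoc]
    refine mul_le_mul_of_nonneg_left ?_ hπ.le
    have i0 := mul_le_mul_of_nonneg_left (hsq _ h0) (sq_nonneg R⁻¹)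
    have i2 := mul_le_mul_of_nonneg_left (hsq _ h2) (sq_nonneg κ⁻¹)
    have := sq_nonneg (κ⁻¹ * inner ℝ (e 1 s) ξ)
    rw [mul_pow, mul_pow, mul_pow] at *
    rw [hT]
    nlinarith
  have hD : |κ⁻¹ ^ 2 - R⁻¹ ^ 2| ≤ κ⁻¹ ^ 2 + R⁻¹ ^ 2 :=
    abs_le.2 ⟨by nlinarith [sq_nonneg κ⁻¹], by nlinarith [sq_nonneg R⁻¹]⟩
  have hfac : |Real.pi * (κ⁻¹ ^ 2 - R⁻¹ ^ 2) *
      (2 * inner ℝ (e 0 s) ξ * (α s * inner ℝ (e 1 s) ξ))| ≤ Real.pi * (2 * L * T) := by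
    rw [abs_mul, abs_mul, abs_of_pos hπ, mul_assoc]
    refine mul_le_mul_of_nonneg_left ?_ hπ.le
    have k1 : |2 * inner ℝ (e 0 s) ξ * (α s * inner ℝ (e 1 s) ξ)| ≤ 2 * ‖ξ‖ * (L * ‖ξ‖) := by
      rw [abs_mul, abs_mul, abs_mul, abs_of_pos hα0, abs_of_pos (by norm_num : (0 : ℝ) < 2)]
      gcongr
      · exact hF.abs_inner_le hs ξ 0
      · exact hF.a_upper s hs
      · exact hF.abs_inner_le hs ξ 1
    calc _ ≤ (κ⁻¹ ^ 2 + R⁻¹ ^ 2) * (2 * ‖ξ‖ * (L * ‖ξ‖)) := by gcongr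
      _ = 2 * L * T := by rw [hT]; ring
  rw [abs_mul, abs_of_nonneg (plateSymbol_mem e R κ ξ s).1]
  calc _ ≤ Real.exp (-(Real.pi * μ ^ 2 * T)) * (Real.pi * (2 * L * T)) := by gcongr
    _ = 2 * L / μ ^ 2 * (Real.pi * μ ^ 2 * T * Real.exp (-(Real.pi * μ ^ 2 * T))) := by
        field_simp
    _ ≤ 2 * L / μ ^ 2 * 1 := by gcongr; exact mul_exp_neg_le_one _
    _ = _ := mul_one _

theorem FrenetBounds.eVariationOn_le_of_far (hF : FrenetBounds (Icc a b) e α τ c L) {x y : ℝ}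
    (hx : a ≤ x) (hy : y ≤ b) (hxy : x ≤ y) (R κ : ℝ) {ξ : E3} {μ : ℝ} (hμ : 0 < μ)
    (h0 : ∀ s ∈ Icc x y, μ * ‖ξ‖ ≤ |inner ℝ (e 0 s) ξ|)
    (h2 : ∀ s ∈ Icc x y, μ * ‖ξ‖ ≤ |inner ℝ (e 2 s) ξ|) :
    eVariationOn (plateSymbol e R κ ξ) (Icc x y) ≤ ENNReal.ofReal (2 * L / μ ^ 2 * (y - x)) := by
  have hI : ∀ s ∈ Icc x y, s ∈ Icc a b := fun s hs => ⟨hx.trans hs.1, hs.2.trans hy⟩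
  have hL : 0 ≤ L := zero_le_one.trans hF.one_le
  set Λ := 2 * L / μ ^ 2 with hΛ
  have hΛ0 : 0 ≤ Λ := by positivity
  have hd : ∀ s ∈ Icc x y, HasDerivWithinAt (plateSymbol e R κ ξ)
      (plateSymbol e R κ ξ s * (Real.pi * (κ⁻¹ ^ 2 - R⁻¹ ^ 2) *
      (2 * inner ℝ (e 0 s) ξ * (α s * inner ℝ (e 1 s) ξ)))) (Icc x y) s := by
    intro s hs
    have h1 := ((hF.hasDerivWithinAt_inner_zero ξ (hI s hs)).mono (Icc_subset_Icc hx hy)).pow 2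
    have h3 := ((h1.const_mul (Real.pi * (κ⁻¹ ^ 2 - R⁻¹ ^ 2))).add_const
      (-Real.pi * κ⁻¹ ^ 2 * ‖ξ‖ ^ 2)).exp
    have h4 := h3.congr (fun t ht => hF.plateSymbol_eq (hI t ht) R κ ξ)
      (hF.plateSymbol_eq (hI s hs) R κ ξ)
    refine h4.congr_deriv ?_
    rw [hF.plateSymbol_eq (hI s hs) R κ ξ]
    simp
  have hlip : LipschitzOnWith (Real.toNNReal Λ) (plateSymbol e R κ ξ) (Icc x y) := by
    refine (convex_Icc x y).lipschitzOnWith_of_nnnorm_hasDerivWithin_le hd fun s hs => ?_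
    rw [← NNReal.coe_le_coe, coe_nnnorm, Real.norm_eq_abs, Real.coe_toNNReal _ hΛ0]
    exact hF.abs_deriv_plateSymbol_le (hI s hs) R κ hμ (h0 s hs) (h2 s hs)
  have hid : eVariationOn (id : ℝ → ℝ) (Icc x y) ≤ ENNReal.ofReal (y - x) := by
    have := (monotoneOn_id (s := univ (α := ℝ))).eVariationOn_le (mem_univ x) (mem_univ y)
    simpa using this
  have := hlip.comp_eVariationOn_le (g := id) (s := Icc x y) (fun s hs => hs)
  rw [Function.comp_id] at this
  refine this.trans ?_
  rw [ENNReal.ofReal_mul hΛ0]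
  exact mul_le_mul_right hid _

/-- On so short an arc one of three things happens. Either ⟨e_1,ξ⟩ keeps its sign; or its derivative
does; or both are small compared with ‖ξ‖ at x, and then ⟨e_0,ξ⟩ and ⟨e_2,ξ⟩ are comparable to ‖ξ‖
on the whole arc. The variation is bounded by 2, by 4, and by the Lipschitz estimate respectively.
-/
theorem FrenetBounds.eVariationOn_short_le (hF : FrenetBounds (Icc a b) e α τ c L) {x y : ℝ}
    (hx : a ≤ x) (hy : y ≤ b) (hxy : x ≤ y) (hδ : y - x ≤ c / (10 * L ^ 2)) (R κ : ℝ) (ξ : E3) :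
    eVariationOn (plateSymbol e R κ ξ) (Icc x y) ≤
      4 + ENNReal.ofReal (2 * L / (c / (8 * L)) ^ 2 * (b - a)) := by
  have hL := hF.one_le
  have hc := hF.c_pos
  have hI : ∀ s ∈ Icc x y, s ∈ Icc a b := fun s hs => ⟨hx.trans hs.1, hs.2.trans hy⟩
  have hxI := hI x ⟨le_rfl, hxy⟩
  set n := ‖ξ‖ with hn
  have hn0 : 0 ≤ n := norm_nonneg ξ
  set δ := c / (10 * L ^ 2) with hδd
  have hδ0 : 0 < δ := by positivity
  have hcL : c ≤ L := (hF.a_lower x hxI).trans (hF.a_upper x hxI)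
  have hLδ : 10 * (L * L * δ) = c := by rw [hδd]; field_simp
  have hclose : ∀ s ∈ Icc x y, ∀ j, |inner ℝ (e j s) ξ - inner ℝ (e j x) ξ| ≤ L * δ * n := by
    intro s hs j
    refine (abs_inner_sub_le hF (hI s hs) hxI j ξ).trans ?_
    have : |s - x| ≤ δ := by
      rw [abs_of_nonneg (by linarith [hs.1])]; linarith [hs.2]
    gcongr
  set Wf : ℝ → ℝ := fun s => -α s * inner ℝ (e 0 s) ξ + τ s * inner ℝ (e 2 s) ξ with hW
  have hWclose : ∀ s ∈ Icc x y, |Wf s - Wf x| ≤ 4 * (L * L * δ * n) := by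
    intro s hs
    have hsx : |s - x| ≤ δ := by
      rw [abs_of_nonneg (by linarith [hs.1])]; linarith [hs.2]
    have p1 : |(α s - α x) * inner ℝ (e 0 s) ξ| ≤ L * δ * n := by
      rw [abs_mul]
      refine mul_le_mul ((hF.a_lipschitz s (hI s hs) x hxI).trans ?_)
        (hF.abs_inner_le (hI s hs) ξ 0) (abs_nonneg _) (by positivity)
      gcongr
    have p2 : |(τ s - τ x) * inner ℝ (e 2 s) ξ| ≤ L * δ * n := by
      rw [abs_mul]
      refine mul_le_mul ((hF.τ_lipschitz s (hI s hs) x hxI).trans ?_)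
        (hF.abs_inner_le (hI s hs) ξ 2) (abs_nonneg _) (by positivity)
      gcongr
    have p3 : |α x * (inner ℝ (e 0 s) ξ - inner ℝ (e 0 x) ξ)| ≤ L * (L * δ * n) := by
      rw [abs_mul, abs_of_pos (hc.trans_le (hF.a_lower x hxI))]
      exact mul_le_mul (hF.a_upper x hxI) (hclose s hs 0) (abs_nonneg _) (by linarith)
    have p4 : |τ x * (inner ℝ (e 2 s) ξ - inner ℝ (e 2 x) ξ)| ≤ L * (L * δ * n) := by
      rw [abs_mul, abs_of_pos (hc.trans_le (hF.τ_lower x hxI))]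
      exact mul_le_mul (hF.τ_upper x hxI) (hclose s hs 2) (abs_nonneg _) (by linarith)
    have p5 : L * δ * n ≤ L * L * δ * n := by
      have : L * δ * n ≤ L * (L * δ * n) := le_mul_of_one_le_left (by positivity) hL
      linarith
    have e1 : Wf s - Wf x = -((α s - α x) * inner ℝ (e 0 s) ξ) -
        α x * (inner ℝ (e 0 s) ξ - inner ℝ (e 0 x) ξ) + (τ s - τ x) * inner ℝ (e 2 s) ξ +
        τ x * (inner ℝ (e 2 s) ξ - inner ℝ (e 2 x) ξ) := by simp only [hW]; ring
    rw [abs_le] at p1 p2 p3 p4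
    rw [e1, abs_le]
    constructor <;> linarith [p1.1, p1.2, p2.1, p2.2, p3.1, p3.2, p4.1, p4.2]
  have h24 : (2 : ℝ≥0∞) ≤ 4 := by norm_num
  by_cases hA : L * δ * n ≤ |inner ℝ (e 1 x) ξ|
  · refine le_trans ?_ (h24.trans le_self_add)
    rcases le_abs.1 hA with h | h
    · exact hF.eVariationOn_le_two hx hy R κ ξ fun s hs => by
        linarith [(abs_le.1 (hclose s hs 1)).1]
    · exact hF.eVariationOn_le_two' hx hy R κ ξ fun s hs => by
        linarith [(abs_le.1 (hclose s hs 1)).2]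
  by_cases hB : 4 * (L * L * δ * n) ≤ |Wf x|
  · refine le_trans ?_ le_self_add
    rcases le_abs.1 hB with h | h
    · exact hF.eVariationOn_le_four hx hy hxy R κ ξ fun s hs => by
        have := (abs_le.1 (hWclose s hs)).1
        simp only [hW] at this h ⊢
        linarith
    · exact hF.eVariationOn_le_four' hx hy hxy R κ ξ fun s hs => by
        have := (abs_le.1 (hWclose s hs)).2
        simp only [hW] at this h ⊢
        linarith
  rw [not_le] at hA hB
  have hsum : n ≤ |inner ℝ (e 0 x) ξ| + |inner ℝ (e 1 x) ξ| + |inner ℝ (e 2 x) ξ| := by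
    have := norm_le_sum_abs_inner (frameBasis e x) ξ
    rw [Fin.sum_univ_three] at this
    simpa only [frameBasis_apply (hF.orthonormal x hxI)] using this
  set u := |inner ℝ (e 0 x) ξ| with hu
  set v := |inner ℝ (e 2 x) ξ| with hv
  have hu0 : 0 ≤ u := abs_nonneg _
  have hv0 : 0 ≤ v := abs_nonneg _
  have q1 : α x * u ≤ τ x * v + 4 * (L * L * δ * n) := by
    have e2 : α x * u = |α x * inner ℝ (e 0 x) ξ| := by
      rw [abs_mul, abs_of_pos (hc.trans_le (hF.a_lower x hxI))]
    have e3 : τ x * v = |τ x * inner ℝ (e 2 x) ξ| := by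
      rw [abs_mul, abs_of_pos (hc.trans_le (hF.τ_lower x hxI))]
    have := abs_sub_abs_le_abs_sub (α x * inner ℝ (e 0 x) ξ) (τ x * inner ℝ (e 2 x) ξ)
    have e4 : |α x * inner ℝ (e 0 x) ξ - τ x * inner ℝ (e 2 x) ξ| = |Wf x| := by
      rw [← abs_neg]; congr 1; simp only [hW]; ring
    rw [e2, e3]; linarith
  have q2 : τ x * v ≤ α x * u + 4 * (L * L * δ * n) := by
    have e2 : α x * u = |α x * inner ℝ (e 0 x) ξ| := by
      rw [abs_mul, abs_of_pos (hc.trans_le (hF.a_lower x hxI))]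
    have e3 : τ x * v = |τ x * inner ℝ (e 2 x) ξ| := by
      rw [abs_mul, abs_of_pos (hc.trans_le (hF.τ_lower x hxI))]
    have := abs_sub_abs_le_abs_sub (τ x * inner ℝ (e 2 x) ξ) (α x * inner ℝ (e 0 x) ξ)
    have e4 : |τ x * inner ℝ (e 2 x) ξ - α x * inner ℝ (e 0 x) ξ| = |Wf x| := by
      congr 1; simp only [hW]; ring
    rw [e2, e3]; linarith
  have q3 : c * u ≤ α x * u := mul_le_mul_of_nonneg_right (hF.a_lower x hxI) hu0
  have q4 : c * v ≤ τ x * v := mul_le_mul_of_nonneg_right (hF.τ_lower x hxI) hv0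
  have q5 : α x * u ≤ L * u := mul_le_mul_of_nonneg_right (hF.a_upper x hxI) hu0
  have q6 : τ x * v ≤ L * v := mul_le_mul_of_nonneg_right (hF.τ_upper x hxI) hv0
  have q7 : 10 * (L * L * δ * n) = c * n := by rw [← hLδ]; ring
  have q8 : c * (L * δ * n) ≤ L * L * δ * n := by
    have := mul_le_mul_of_nonneg_right hcL (by positivity : 0 ≤ L * δ * n)
    linarith
  have q9 : c * n ≤ c * (u + L * δ * n + v) := mul_le_mul_of_nonneg_left (by linarith) hc.le
  have q10 : c * u ≤ L * u := mul_le_mul_of_nonneg_right hcL hu0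
  have q11 : c * v ≤ L * v := mul_le_mul_of_nonneg_right hcL hv0
  -- αu and τv differ by at most 4L²δn = (2/5)cn, while u + v ≥ (1 - Lδ)n; neither u nor v can then
  -- be small.
  have r1 : c * n ≤ 4 * (L * u) := by nlinarith
  have r2 : c * n ≤ 4 * (L * v) := by nlinarith
  have q12 : 10 * (L * (L * δ * n)) = c * n := by rw [← q7]; ring
  have hfar : ∀ j, c * n ≤ 4 * (L * |inner ℝ (e j x) ξ|) → ∀ s ∈ Icc x y,
      c / (8 * L) * n ≤ |inner ℝ (e j s) ξ| := by
    intro j hj s hs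
    rw [div_mul_eq_mul_div, div_le_iff₀ (by positivity)]
    have h5 := abs_sub_abs_le_abs_sub (inner ℝ (e j x) ξ) (inner ℝ (e j s) ξ)
    rw [abs_sub_comm] at h5
    have h6 := hclose s hs j
    have h7 : L * |inner ℝ (e j x) ξ| ≤ L * (|inner ℝ (e j s) ξ| + L * δ * n) :=
      mul_le_mul_of_nonneg_left (by linarith) (by linarith)
    linarith
  refine (hF.eVariationOn_le_of_far hx hy hxy R κ (by positivity : 0 < c / (8 * L))
    (hfar 0 r1) (hfar 2 r2)).trans (le_trans (ENNReal.ofReal_le_ofReal ?_) le_add_self)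
  have : y - x ≤ b - a := by linarith
  gcongr

/-- The number of short arcs covering [a, b] depends on the Frenet constants and b - a alone, and
variation is additive. -/
theorem FrenetBounds.exists_eVariationOn_le (hF : FrenetBounds (Icc a b) e α τ c L) (hab : a ≤ b) :
    ∃ V : ℝ≥0∞, V ≠ ⊤ ∧ ∀ (R κ : ℝ) (ξ : E3),
      eVariationOn (plateSymbol e R κ ξ) (Icc a b) ≤ V := by
  have hL := hF.one_le
  have hc := hF.c_pos
  set δ := c / (10 * L ^ 2) with hδd
  have hδ0 : 0 < δ := by positivity
  obtain ⟨V₀, hV₀⟩ : ∃ V₀ : ℝ≥0∞, V₀ = 4 + ENNReal.ofReal (2 * L / (c / (8 * L)) ^ 2 * (b - a)) :=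
    ⟨_, rfl⟩
  have hV₀t : V₀ ≠ ⊤ := by
    rw [hV₀]; exact ENNReal.add_ne_top.2 ⟨by simp, ENNReal.ofReal_ne_top⟩
  have key : ∀ n : ℕ, ∀ y, a ≤ y → y ≤ b → y ≤ a + n * δ → ∀ (R κ : ℝ) (ξ : E3),
      eVariationOn (plateSymbol e R κ ξ) (Icc a y) ≤ n * V₀ := by
    intro n
    induction n with
    | zero =>
      intro y hay _ hy R κ ξ
      rw [Nat.cast_zero, zero_mul, add_zero] at hy
      rw [le_antisymm hy hay, Icc_self, eVariationOn.subsingleton _ subsingleton_singleton]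
      exact zero_le
    | succ n ih =>
      intro y hay hyb hy R κ ξ
      by_cases h : y ≤ a + n * δ
      · refine (ih y hay hyb h R κ ξ).trans ?_
        gcongr
        simp
      · rw [not_le] at h
        have hn : 0 ≤ n * δ := by positivity
        rw [← eVariationOn_Icc_add_Icc _ (by linarith : a ≤ a + n * δ) h.le, Nat.cast_succ, add_mul,
          one_mul]
        refine add_le_add (ih _ (by linarith) (by linarith) le_rfl R κ ξ) ?_
        rw [hV₀]
        refine hF.eVariationOn_short_le (by linarith) hyb h.le ?_ R κ ξ
        push_cast at hy
        linarith
  refine ⟨(⌈(b - a) / δ⌉₊ : ℕ) * V₀, ENNReal.mul_ne_top (by simp) hV₀t, fun R κ ξ =>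
    key _ b hab le_rfl ?_ R κ ξ⟩
  have := Nat.le_ceil ((b - a) / δ)
  rw [div_le_iff₀ hδ0] at this
  linarith

end

end

section

open scoped SchwartzMap LineDeriv Topology

/-! ### The maximal function over a net -/

/-- An even index of level J + 1 is an index of level J, and an odd one is a single step from an
even one, so each level adds one difference. -/
theorem norm_le_of_dyadic_chain {F : ℕ → ℕ → ℂ} (hF : ∀ j i, F (j + 1) (2 * i) = F j i)
    {d : ℕ → ℝ} (hd : ∀ j, ∀ i < 2 ^ j, ‖F j (i + 1) - F j i‖ ≤ d j) (J : ℕ) :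
    ∀ i ≤ 2 ^ J, ‖F J i‖ ≤ ‖F 0 0‖ + ∑ j ∈ Finset.range (J + 1), d j := by
  have hd0 : ∀ j, 0 ≤ d j := fun j => (norm_nonneg _).trans (hd j 0 (by positivity))
  have hstep : ∀ J, ∀ i < 2 ^ J, ‖F J (i + 1)‖ ≤ ‖F J i‖ + d J := fun J i hi => by
    have := norm_le_norm_add_norm_sub (F J i) (F J (i + 1))
    rw [norm_sub_rev] at this
    exact this.trans (add_le_add_right (hd J i hi) _)
  induction J with
  | zero =>
    intro i hi
    rw [zero_add, Finset.sum_range_one]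
    interval_cases i
    · linarith [hd0 0]
    · exact hstep 0 0 (by norm_num)
  | succ J ih =>
    intro i hi
    rw [Finset.sum_range_succ]
    rcases Nat.even_or_odd' i with ⟨k, rfl | rfl⟩
    · rw [hF]
      have := ih k (by rw [pow_succ] at hi; omega)
      linarith [hd0 (J + 1)]
    · have h1 := ih k (by rw [pow_succ] at hi; omega)
      have h2 := hstep (J + 1) (2 * k) (by omega)
      rw [hF] at h2
      linarith

/-- The largest step of a level is at most the ℓ² norm of all its steps, and Cauchy–Schwarz over J +
2 terms gives the factor. A maximum is thus bounded by sums accessible to Plancherel. -/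
theorem enorm_sq_le_of_dyadic_chain {F : ℕ → ℕ → ℂ} (hF : ∀ j i, F (j + 1) (2 * i) = F j i)
    (J : ℕ) {i : ℕ} (hi : i ≤ 2 ^ J) :
    ‖F J i‖ₑ ^ 2 ≤ (J + 2 : ℕ) * (‖F 0 0‖ₑ ^ 2 +
      ∑ j ∈ Finset.range (J + 1), ∑ i ∈ Finset.range (2 ^ j), ‖F j (i + 1) - F j i‖ₑ ^ 2) := by
  set D : ℕ → ℝ := fun j => ∑ i ∈ Finset.range (2 ^ j), ‖F j (i + 1) - F j i‖ ^ 2 with hD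
  have hD0 : ∀ j, 0 ≤ D j := fun j => Finset.sum_nonneg fun _ _ => by positivity
  have h1 := norm_le_of_dyadic_chain hF (d := fun j => Real.sqrt (D j)) (fun j i hi =>
    Real.le_sqrt_of_sq_le (Finset.single_le_sum (f := fun i => ‖F j (i + 1) - F j i‖ ^ 2)
      (fun _ _ => by positivity) (Finset.mem_range.2 hi))) J i hi
  have h2 : ‖F J i‖ ^ 2 ≤ (J + 2 : ℕ) * (‖F 0 0‖ ^ 2 + ∑ j ∈ Finset.range (J + 1), D j) := by
    have h3 := sq_sum_le_card_mul_sum_sq (s := Finset.range (J + 2))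
      (f := fun j => if j = 0 then ‖F 0 0‖ else Real.sqrt (D (j - 1)))
    rw [Finset.card_range, Finset.sum_range_succ' _ (J + 1), Finset.sum_range_succ' _ (J + 1)] at h3
    simp only [Nat.add_eq_zero_iff, one_ne_zero, and_false, if_false, if_true,
      Nat.add_sub_cancel, Real.sq_sqrt (hD0 _)] at h3
    calc ‖F J i‖ ^ 2 ≤ (∑ j ∈ Finset.range (J + 1), Real.sqrt (D j) + ‖F 0 0‖) ^ 2 :=
          pow_le_pow_left₀ (norm_nonneg _) (by linarith) 2
      _ ≤ _ := by rw [add_comm (‖F 0 0‖ ^ 2)]; exact h3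
  have he : ∀ z : ℂ, ‖z‖ₑ ^ 2 = ENNReal.ofReal (‖z‖ ^ 2) := fun z => by
    rw [ENNReal.ofReal_pow (norm_nonneg _), ofReal_norm_eq_enorm]
  simp only [he]
  rw [← ENNReal.ofReal_natCast]
  simp only [← ENNReal.ofReal_sum_of_nonneg fun i _ => sq_nonneg _]
  rw [← ENNReal.ofReal_sum_of_nonneg fun j _ => hD0 j, ← ENNReal.ofReal_add (by positivity)
    (Finset.sum_nonneg fun j _ => hD0 j), ← ENNReal.ofReal_mul (by positivity)]
  exact ENNReal.ofReal_le_ofReal h2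

theorem sconv_sub_left (k k' : 𝓢(E3, ℂ)) {g : E3 → ℂ} (hg : MemLp g 2 volume) (x : E3) :
    sconv (k - k') g x = sconv k g x - sconv k' g x := by
  simp only [sconv, SchwartzMap.sub_apply, sub_mul]
  exact integral_sub (sconv_integrable k hg x) (sconv_integrable k' hg x)

theorem scale_pos {R κ : ℝ} (hR : 0 < R) (hκ : 0 < κ) (j : Fin 3) :
    0 < (![R, κ, κ] : Fin 3 → ℝ) j := by
  fin_cases j <;> simpa

/-- The `i`-th point of the `j`-th dyadic net of `[a, b]`. -/
noncomputable def netPoint (a b : ℝ) (j i : ℕ) : ℝ := a + i * ((b - a) / 2 ^ j)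

theorem netPoint_succ (a b : ℝ) (j i : ℕ) : netPoint a b (j + 1) (2 * i) = netPoint a b j i := by
  unfold netPoint
  rw [pow_succ]
  push_cast
  field_simp

theorem netPoint_mem {a b : ℝ} (hab : a ≤ b) {j i : ℕ} (hi : i ≤ 2 ^ j) :
    netPoint a b j i ∈ Icc a b := by
  have hi' : (i : ℝ) ≤ 2 ^ j := by exact_mod_cast hi
  have h0 : 0 ≤ b - a := sub_nonneg.2 hab
  have h1 : (i : ℝ) * ((b - a) / 2 ^ j) ≤ 2 ^ j * ((b - a) / 2 ^ j) := by gcongr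
  rw [mul_div_cancel₀ _ (by positivity)] at h1
  unfold netPoint
  exact ⟨le_add_of_nonneg_right (by positivity), by linarith⟩

theorem netPoint_mono {a b : ℝ} (hab : a ≤ b) (j : ℕ) : Monotone (netPoint a b j) := by
  intro i i' h
  have h' : (i : ℝ) ≤ i' := by exact_mod_cast h
  have h0 : 0 ≤ b - a := sub_nonneg.2 hab
  unfold netPoint
  gcongr

theorem exists_netPoint_near {a b : ℝ} (hab : a < b) {s : ℝ} (hs : s ∈ Icc a b) (J : ℕ) :
    ∃ i ≤ 2 ^ J, |s - netPoint a b J i| ≤ (b - a) / 2 ^ J := by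
  have h0 : 0 < (b - a) / 2 ^ J := div_pos (sub_pos.2 hab) (by positivity)
  refine ⟨⌊(s - a) / ((b - a) / 2 ^ J)⌋₊, ?_, abs_sub_gridRound_le h0 hs.1⟩
  refine Nat.floor_le_of_le ?_
  rw [div_le_iff₀ h0]
  push_cast
  rw [mul_div_cancel₀ _ (by positivity)]
  linarith [hs.2]

section
variable {a b : ℝ} {e : Fin 3 → ℝ → E3} {α τ : ℝ → ℝ} {c L : ℝ}

theorem fourier_plateKernel_gaussian {s R κ : ℝ} (h : Orthonormal ℝ fun j => e j s) (hR : 0 < R)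
    (hκ : 0 < κ) (ξ : E3) :
    (𝓕 (plateKernel (frameBasis e s) ![R, κ, κ] (scale_pos hR hκ) gaussian) : 𝓢(E3, ℂ)) ξ =
      (plateSymbol e R κ ξ s : ℂ) := by
  rw [fourier_plateKernel, fourier_gaussian, norm_plateMap_sq, Fin.sum_univ_three]
  simp only [frameBasis_apply h]
  rfl

/-- By Plancherel the differences of one level cost the sum of squared increments of the symbol
along the net, which its total variation bounds for all ξ and all levels. The number of levels and
the chaining factor give a loss of order J². -/
theorem FrenetBounds.exists_lintegral_net_le (hF : FrenetBounds (Icc a b) e α τ c L) (hab : a ≤ b) :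
    ∃ B : ℝ≥0∞, B ≠ ⊤ ∧ ∀ (J : ℕ) (R κ : ℝ) (hR : 0 < R) (hκ : 0 < κ) (g : E3 → ℂ),
      MemLp g 2 volume → ∫⁻ x, ⨆ i ∈ Finset.range (2 ^ J + 1),
        ‖sconv (plateKernel (frameBasis e (netPoint a b J i)) ![R, κ, κ] (scale_pos hR hκ) gaussian)
          g x‖ₑ ^ 2 ≤ (J + 2 : ℕ) * (1 + (J + 1 : ℕ) * B) * ∫⁻ x, ‖g x‖ₑ ^ 2 := by
  obtain ⟨V, hVt, hV⟩ := hF.exists_eVariationOn_le hab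
  refine ⟨V, hVt, fun J R κ hR hκ g hg => ?_⟩
  set k : ℝ → 𝓢(E3, ℂ) := fun s =>
    plateKernel (frameBasis e s) ![R, κ, κ] (scale_pos hR hκ) gaussian with hk
  have hkF : ∀ s ∈ Icc a b, ∀ ξ, (𝓕 (k s) : 𝓢(E3, ℂ)) ξ = (plateSymbol e R κ ξ s : ℂ) :=
    fun s hs ξ => fourier_plateKernel_gaussian (hF.orthonormal s hs) hR hκ ξ
  set F : E3 → ℕ → ℕ → ℂ := fun x j i => sconv (k (netPoint a b j i)) g x with hFd
  have hmeas : ∀ j i, AEMeasurable (fun x => F x j i) volume := fun j i =>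
    (sconv_stronglyMeasurable (k _) hg).aestronglyMeasurable.aemeasurable
  have hmeas2 : ∀ j, ∀ i ∈ Finset.range (2 ^ j),
      AEMeasurable (fun x => ‖F x j (i + 1) - F x j i‖ₑ ^ 2) volume := fun j i _ =>
    ((hmeas j (i + 1)).sub (hmeas j i)).enorm.pow_const 2
  have h0 : ∫⁻ x, ‖F x 0 0‖ₑ ^ 2 ≤ ∫⁻ x, ‖g x‖ₑ ^ 2 := by
    have := sum_lintegral_sconv_le (ι := Unit) {()} (fun _ => k (netPoint a b 0 0)) (B := 1)
      ENNReal.one_ne_top (fun ξ => ?_) hg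
    · simpa using this
    · rw [Finset.sum_singleton, hkF _ (netPoint_mem hab (by norm_num))]
      refine pow_le_one' ?_ 2
      have hm := plateSymbol_mem e R κ ξ (netPoint a b 0 0)
      rw [← ofReal_norm_eq_enorm, Complex.norm_real, Real.norm_eq_abs, abs_of_nonneg hm.1]
      exact ENNReal.ofReal_le_one.2 hm.2
  have hj : ∀ j, ∑ i ∈ Finset.range (2 ^ j), ∫⁻ x, ‖F x j (i + 1) - F x j i‖ₑ ^ 2 ≤
      V * ∫⁻ x, ‖g x‖ₑ ^ 2 := by
    intro j
    have := sum_lintegral_sconv_le (Finset.range (2 ^ j))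
      (fun i => k (netPoint a b j (i + 1)) - k (netPoint a b j i)) (B := V) hVt (fun ξ => ?_) hg
    · simpa only [sconv_sub_left _ _ hg] using this
    · calc _ ≤ ∑ i ∈ Finset.range (2 ^ j), edist (plateSymbol e R κ ξ (netPoint a b j (i + 1)))
            (plateSymbol e R κ ξ (netPoint a b j i)) := by
            refine Finset.sum_le_sum fun i hi => ?_
            have hi' := Finset.mem_range.1 hi
            have e1 : (𝓕 (k (netPoint a b j (i + 1)) - k (netPoint a b j i)) : 𝓢(E3, ℂ)) ξ =
                ((plateSymbol e R κ ξ (netPoint a b j (i + 1)) -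
                  plateSymbol e R κ ξ (netPoint a b j i) : ℝ) : ℂ) := by
              rw [← FourierTransform.fourierCLM_apply (R := ℂ), map_sub, FourierTransform.fourierCLM_apply, FourierTransform.fourierCLM_apply, SchwartzMap.sub_apply,
                hkF _ (netPoint_mem hab (by omega)), hkF _ (netPoint_mem hab (by omega))]
              push_cast
              rfl
            have m1 := plateSymbol_mem e R κ ξ (netPoint a b j (i + 1))
            have m2 := plateSymbol_mem e R κ ξ (netPoint a b j i)
            rw [e1, edist_dist, Real.dist_eq, ← ofReal_norm_eq_enorm, Complex.norm_real,
              Real.norm_eq_abs, ← ENNReal.ofReal_pow (abs_nonneg _)]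
            -- The symbol has values in [0, 1], so a squared increment is at most the increment.
            refine ENNReal.ofReal_le_ofReal (pow_le_of_le_one (abs_nonneg _) ?_ two_ne_zero)
            exact abs_le.2 ⟨by linarith [m1.1, m2.2], by linarith [m1.2, m2.1]⟩
        _ ≤ eVariationOn (plateSymbol e R κ ξ) (Icc a b) :=
            eVariationOn.sum_le_of_monotoneOn_Iic ((netPoint_mono hab j).monotoneOn _)
              fun i hi => netPoint_mem hab hi
        _ ≤ V := hV R κ ξ
  calc _ ≤ ∫⁻ x, (J + 2 : ℕ) * (‖F x 0 0‖ₑ ^ 2 + ∑ j ∈ Finset.range (J + 1),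
          ∑ i ∈ Finset.range (2 ^ j), ‖F x j (i + 1) - F x j i‖ₑ ^ 2) := by
        refine lintegral_mono fun x => iSup₂_le fun i hi => ?_
        exact enorm_sq_le_of_dyadic_chain (F := F x)
          (fun j i => by simp only [hFd, netPoint_succ]) J
          (Nat.lt_succ_iff.1 (Finset.mem_range.1 hi))
    _ = (J + 2 : ℕ) * ((∫⁻ x, ‖F x 0 0‖ₑ ^ 2) + ∑ j ∈ Finset.range (J + 1),
          ∑ i ∈ Finset.range (2 ^ j), ∫⁻ x, ‖F x j (i + 1) - F x j i‖ₑ ^ 2) := by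
        rw [lintegral_const_mul' _ _ (by simp), lintegral_add_left' ((hmeas 0 0).enorm.pow_const 2),
          lintegral_finsetSum' _ fun j _ => Finset.aemeasurable_fun_sum _ (hmeas2 j)]
        congr 2
        exact Finset.sum_congr rfl fun j _ => lintegral_finsetSum' _ (hmeas2 j)
    _ ≤ (J + 2 : ℕ) * ((∫⁻ x, ‖g x‖ₑ ^ 2) + ∑ j ∈ Finset.range (J + 1), V * ∫⁻ x, ‖g x‖ₑ ^ 2) := by
        exact mul_le_mul_right (add_le_add h0 (Finset.sum_le_sum fun j _ => hj j)) _
    _ = _ := by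
        rw [Finset.sum_const, Finset.card_range, nsmul_eq_mul]
        ring

end

/-- The Gaussian weight adapted to a plate. -/
noncomputable def gaussWeight (b : OrthonormalBasis (Fin 3) ℝ E3) (ρ : Fin 3 → ℝ) (y : E3) : ℝ :=
  (∏ j, ρ j) * Real.exp (-Real.pi * ∑ j, (ρ j * inner ℝ (b j) y) ^ 2)

theorem gaussWeight_continuous (b : OrthonormalBasis (Fin 3) ℝ E3) (ρ : Fin 3 → ℝ) :
    Continuous (gaussWeight b ρ) := by
  unfold gaussWeight
  fun_prop

theorem plateKernel_gaussian (b : OrthonormalBasis (Fin 3) ℝ E3) {ρ : Fin 3 → ℝ}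
    (hρ : ∀ j, 0 < ρ j) (y : E3) : plateKernel b ρ hρ gaussian y = (gaussWeight b ρ y : ℂ) := by
  rw [plateKernel_apply, gaussian_apply, norm_plateMap_sq, gaussWeight, Complex.ofReal_mul]

theorem gaussWeight_nonneg (b : OrthonormalBasis (Fin 3) ℝ E3) {ρ : Fin 3 → ℝ}
    (hρ : ∀ j, 0 < ρ j) (y : E3) : 0 ≤ gaussWeight b ρ y :=
  mul_nonneg (Finset.prod_nonneg fun j _ => (hρ j).le) (Real.exp_pos _).le

/-- Weight and function are non-negative, so the average is the modulus of a complex convolution, to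
which Plancherel applies. -/
theorem lconv_gaussWeight_eq (b : OrthonormalBasis (Fin 3) ℝ E3) {ρ : Fin 3 → ℝ}
    (hρ : ∀ j, 0 < ρ j) {g : E3 → ℝ≥0∞} (hg : MemLp (fun x => ((g x).toReal : ℂ)) 2 volume)
    (hfin : ∀ᵐ x, g x ≠ ⊤) (x : E3) :
    lconv g (gaussWeight b ρ) x =
      ‖sconv (plateKernel b ρ hρ gaussian) (fun x => ((g x).toReal : ℂ)) x‖ₑ := by
  have hint := sconv_integrable (plateKernel b ρ hρ gaussian) hg x
  simp only [plateKernel_gaussian, ← Complex.ofReal_mul] at hint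
  have hint' : Integrable fun y => gaussWeight b ρ (x - y) * (g y).toReal := by
    simpa using hint.re
  have hnn : ∀ y, 0 ≤ gaussWeight b ρ (x - y) * (g y).toReal := fun y =>
    mul_nonneg (gaussWeight_nonneg b hρ _) ENNReal.toReal_nonneg
  rw [sconv]
  simp only [plateKernel_gaussian, ← Complex.ofReal_mul]
  rw [integral_complex_ofReal, ← ofReal_norm_eq_enorm, Complex.norm_real, Real.norm_eq_abs,
    abs_of_nonneg (integral_nonneg hnn),
    ofReal_integral_eq_lintegral_ofReal hint' (Filter.Eventually.of_forall hnn), lconv,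
    ← lintegral_sub_left_eq_self _ x]
  refine lintegral_congr_ae ?_
  filter_upwards [hfin] with y hy
  rw [sub_sub_cancel, ENNReal.ofReal_mul (gaussWeight_nonneg b hρ _), ENNReal.ofReal_toReal hy,
    mul_comm]

/-- Let q be the squared Euclidean size of y in plate coordinates; take k = 0 if q ≤ 1, otherwise
4^k ≤ q < 4^{k+1}. Relative to ∏ ρ_j, the Gaussian dilated by 2^k has size about 8^{-k} at y, while
the weight is at most 64^{-k} ≤ 4^{-k}8^{-k}. The gain 4^{-k} makes the sum over k converge. -/
theorem exists_frameWeight_le_gaussWeight (b : OrthonormalBasis (Fin 3) ℝ E3) {ρ : Fin 3 → ℝ}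
    (hρ : ∀ j, 0 < ρ j) (y : E3) : ∃ k : ℕ, frameWeight b ρ y ≤
      Real.exp (4 * Real.pi) * ((4⁻¹ : ℝ) ^ k * gaussWeight b (fun j => (2⁻¹ : ℝ) ^ k * ρ j) y) := by
  have hπ := Real.pi_pos
  set q := ∑ j, (ρ j * inner ℝ (b j) y) ^ 2 with hq
  set P := ∏ j, ρ j with hP
  have hP0 : 0 < P := Finset.prod_pos fun j _ => hρ j
  have hG0 : 0 ≤ gauge3 b ρ y := gauge3_nonneg b hρ y
  have hqG : q ≤ gauge3 b ρ y ^ 2 := by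
    rw [hq, gauge3]
    have := Finset.sum_sq_le_sq_sum_of_nonneg (s := Finset.univ)
      (f := fun j => ρ j * |inner ℝ (b j) y|) fun j _ => mul_nonneg (hρ j).le (abs_nonneg _)
    refine le_trans (le_of_eq (Finset.sum_congr rfl fun j _ => ?_)) this
    rw [mul_pow, mul_pow, sq_abs]
  have hgw : ∀ k : ℕ, gaussWeight b (fun j => (2⁻¹ : ℝ) ^ k * ρ j) y =
      (8⁻¹ : ℝ) ^ k * P * Real.exp (-(Real.pi * ((4⁻¹ : ℝ) ^ k * q))) := by
    intro k
    have hs : ∑ j, ((2⁻¹ : ℝ) ^ k * ρ j * inner ℝ (b j) y) ^ 2 = (4⁻¹ : ℝ) ^ k * q := by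
      rw [hq, Finset.mul_sum]
      refine Finset.sum_congr rfl fun j _ => ?_
      rw [mul_assoc, mul_pow, ← pow_mul, mul_comm k, pow_mul]
      norm_num
    rw [gaussWeight, Finset.prod_mul_distrib, hs, neg_mul]
    congr 2
    · rw [Finset.prod_const, Finset.card_univ, Fintype.card_fin, ← pow_mul, mul_comm k, pow_mul]
      norm_num
  rcases le_total q 1 with h1 | h1
  · refine ⟨0, ?_⟩
    rw [hgw]
    simp only [pow_zero, one_mul]
    have h2 : frameWeight b ρ y ≤ P * 1 := by
      rw [frameWeight]
      refine mul_le_mul_of_nonneg_left (inv_le_one_of_one_le₀ (one_le_pow₀ (by linarith))) hP0.le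
    have h3 : 1 ≤ Real.exp (4 * Real.pi) * Real.exp (-(Real.pi * q)) := by
      rw [← Real.exp_add]
      exact Real.one_le_exp (by nlinarith)
    calc _ ≤ P * 1 := h2
      _ ≤ P * (Real.exp (4 * Real.pi) * Real.exp (-(Real.pi * q))) := by gcongr
      _ = _ := by ring
  · obtain ⟨k, hk1, hk2⟩ := exists_nat_pow_near h1 (by norm_num : (1 : ℝ) < 4)
    refine ⟨k, ?_⟩
    rw [hgw]
    have h4 : (0 : ℝ) < 4 ^ k := by positivity
    have h2 : frameWeight b ρ y ≤ P * ((4 ^ k) ^ 3)⁻¹ := by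
      rw [frameWeight]
      refine mul_le_mul_of_nonneg_left (inv_anti₀ (by positivity) ?_) hP0.le
      calc ((4 : ℝ) ^ k) ^ 3 ≤ (gauge3 b ρ y ^ 2) ^ 3 :=
            pow_le_pow_left₀ h4.le (hk1.trans hqG) 3
        _ = gauge3 b ρ y ^ 6 := by ring
        _ ≤ (1 + gauge3 b ρ y) ^ 6 := pow_le_pow_left₀ hG0 (by linarith) 6
        _ ≤ (1 + gauge3 b ρ y) ^ 300 := pow_le_pow_right₀ (by linarith) (by norm_num)
    have h3 : 1 ≤ Real.exp (4 * Real.pi) * Real.exp (-(Real.pi * ((4⁻¹ : ℝ) ^ k * q))) := by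
      rw [← Real.exp_add]
      refine Real.one_le_exp ?_
      have : (4⁻¹ : ℝ) ^ k * q ≤ 4 := by
        rw [inv_pow, inv_mul_le_iff₀ h4, ← pow_succ]
        exact hk2.le
      nlinarith
    have h5 : ((4 : ℝ) ^ k) ^ 3 = 64 ^ k := by rw [← pow_mul, mul_comm, pow_mul]; norm_num
    have h6 : ((64 : ℝ) ^ k)⁻¹ ≤ (4⁻¹ : ℝ) ^ k * (8⁻¹ : ℝ) ^ k := by
      rw [← mul_pow, ← inv_pow]
      exact pow_le_pow_left₀ (by norm_num) (by norm_num) k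
    calc _ ≤ P * ((4 ^ k) ^ 3)⁻¹ * 1 := by rw [mul_one]; exact h2
      _ ≤ P * ((4⁻¹ : ℝ) ^ k * (8⁻¹ : ℝ) ^ k) *
          (Real.exp (4 * Real.pi) * Real.exp (-(Real.pi * ((4⁻¹ : ℝ) ^ k * q)))) := by
          rw [h5]
          gcongr
      _ = _ := by ring

end

section

open scoped SchwartzMap LineDeriv Topology

/-! ### `L²` bounds for the maximal operators -/

/-- Cauchy–Schwarz for the measure with masses a_k. -/
theorem lintegral_tsum_sq_le {a : ℕ → ℝ≥0∞} {M : ℕ → E3 → ℝ≥0∞} (hM : ∀ k, Measurable (M k))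
    {X : ℝ≥0∞} (hX : ∀ k, ∫⁻ x, M k x ^ 2 ≤ X) :
    ∫⁻ x, (∑' k, a k * M k x) ^ 2 ≤ (∑' k, a k) ^ 2 * X := by
  have hcs : ∀ x, (∑' k, a k * M k x) ^ 2 ≤ (∑' k, a k) * ∑' k, a k * M k x ^ 2 := by
    intro x
    have h1 : ∀ k, a k ^ (1 / 2 : ℝ) * a k ^ (1 / 2 : ℝ) = a k := fun k => by
      rw [← ENNReal.rpow_add_of_nonneg _ _ (by norm_num) (by norm_num)]; norm_num
    have h2 := lintegral_mul_sq_le Measure.count (f := fun k : ℕ => a k ^ (1 / 2 : ℝ))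
      (g := fun k => a k ^ (1 / 2 : ℝ) * M k x) (measurable_of_countable _).aemeasurable
      (measurable_of_countable _).aemeasurable
    simp only [lintegral_count, ← mul_assoc, h1, mul_pow, sq (_ ^ (1 / 2 : ℝ))] at h2
    exact h2
  calc _ ≤ ∫⁻ x, (∑' k, a k) * ∑' k, a k * M k x ^ 2 := lintegral_mono hcs
    _ = (∑' k, a k) * ∑' k, a k * ∫⁻ x, M k x ^ 2 := by
        rw [lintegral_const_mul _ (Measurable.tsum fun k => ((hM k).pow_const 2).const_mul _),
          lintegral_tsum fun k => (((hM k).pow_const 2).const_mul _).aemeasurable]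
        congr 2
        exact funext fun k => lintegral_const_mul _ ((hM k).pow_const 2)
    _ ≤ (∑' k, a k) * ∑' k, a k * X := by
        gcongr with k
        exact hX k
    _ = _ := by rw [ENNReal.tsum_mul_right]; ring

theorem biSup_sq_le {s : Finset ℕ} {M : ℕ → ℝ≥0∞} {B : ℝ≥0∞} (h : ∀ i ∈ s, M i ^ 2 ≤ B) :
    (⨆ i ∈ s, M i) ^ 2 ≤ B := by
  have hB : (B ^ (1 / 2 : ℝ)) ^ 2 = B := by
    rw [← ENNReal.rpow_natCast, ← ENNReal.rpow_mul]; norm_num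
  rw [← hB]
  refine pow_le_pow_left' (iSup₂_le fun i hi => ?_) 2
  rw [← ENNReal.pow_le_pow_left_iff two_ne_zero, hB]
  exact h i hi

theorem frameWeight_le_of_gauge3_le {b b' : OrthonormalBasis (Fin 3) ℝ E3} {ρ : Fin 3 → ℝ}
    (hρ : ∀ j, 0 < ρ j) {A : ℝ} (hA : 1 ≤ A) {y : E3} (h : gauge3 b' ρ y ≤ A * gauge3 b ρ y) :
    frameWeight b ρ y ≤ A ^ 300 * frameWeight b' ρ y := by
  have h0 := gauge3_nonneg b hρ y
  have h0' := gauge3_nonneg b' hρ y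
  have hA0 : 0 < A := by linarith
  rw [frameWeight, frameWeight, mul_left_comm]
  refine mul_le_mul_of_nonneg_left ?_ (Finset.prod_nonneg fun j _ => (hρ j).le)
  rw [← div_eq_mul_inv, ← one_div, div_le_div_iff₀ (by positivity) (by positivity), one_mul,
    ← mul_pow]
  refine pow_le_pow_left₀ (by positivity) ?_ _
  nlinarith

section
variable {a b : ℝ} {e : Fin 3 → ℝ → E3} {α τ : ℝ → ℝ} {c L : ℝ}

/-- The Nikodym maximal operator is bounded on `L²` with a logarithmic loss. -/
theorem FrenetBounds.exists_nikodymMax_le (hF : FrenetBounds (Icc a b) e α τ c L) (hab : a < b) :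
    ∃ B : ℝ≥0∞, B ≠ ⊤ ∧ ∀ (J : ℕ) (R κ : ℝ), 0 < R → 0 < κ → R ≤ 2 ^ J * κ → κ ≤ 2 ^ J * R →
      ∀ g : E3 → ℝ≥0∞, AEMeasurable g volume → ∃ G : E3 → ℝ≥0∞, Measurable G ∧
        (∀ x, nikodymMax (Icc a b) e ![R, κ, κ] g x ≤ G x) ∧
        ∫⁻ x, G x ^ 2 ≤ B * (J + 2 : ℕ) ^ 2 * ∫⁻ x, g x ^ 2 := by
  obtain ⟨V, hVt, hV⟩ := hF.exists_lintegral_net_le hab.le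
  have hL := hF.one_le
  -- The nearest net point is within (b - a)/2^J of s and the scales have ratio at most 2^J, so the
  -- comparison of gauges holds with B = b - a.
  set A := 1 + 3 * L * (b - a) with hAd
  have hA : 1 ≤ A := by
    have : 0 ≤ 3 * L * (b - a) := mul_nonneg (by linarith) (sub_nonneg.2 hab.le)
    linarith
  obtain ⟨D, hD0, hD⟩ : ∃ D : ℝ, 0 ≤ D ∧ D = A ^ 300 * Real.exp (4 * Real.pi) :=
    ⟨_, by positivity, rfl⟩
  set wt : ℕ → ℝ≥0∞ := fun k => ENNReal.ofReal D * (4⁻¹ : ℝ≥0∞) ^ k with hwt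
  have hS : ∑' k, wt k ≠ ⊤ := by
    rw [hwt, ENNReal.tsum_mul_left, ENNReal.tsum_geometric]
    refine ENNReal.mul_ne_top ENNReal.ofReal_ne_top (ENNReal.inv_ne_top.2 ?_)
    rw [ne_eq, tsub_eq_zero_iff_le, not_le]
    exact ENNReal.inv_lt_one.2 (by norm_num)
  refine ⟨1 + (∑' k, wt k) ^ 2 * (1 + V), ENNReal.add_ne_top.2 ⟨ENNReal.one_ne_top,
    ENNReal.mul_ne_top (ENNReal.pow_ne_top hS) (ENNReal.add_ne_top.2 ⟨ENNReal.one_ne_top, hVt⟩)⟩,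
    fun J R κ hR hκ hRκ hκR g hg => ?_⟩
  -- With an infinite right side the majorant ⊤ will do. Otherwise g is finite almost everywhere and
  -- represents an L² function.
  by_cases hgt : ∫⁻ x, g x ^ 2 = ⊤
  · refine ⟨fun _ => ⊤, measurable_const, fun x => le_top, ?_⟩
    rw [hgt, ENNReal.mul_top]
    · exact le_top
    · refine mul_ne_zero (by simp) (by simp)
  set g' := hg.mk g with hg'
  have hg'm : Measurable g' := hg.measurable_mk
  have hae : g =ᵐ[volume] g' := hg.ae_eq_mk
  have hint : ∫⁻ x, g x ^ 2 = ∫⁻ x, g' x ^ 2 :=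
    lintegral_congr_ae (hae.mono fun x hx => by simp only [hx])
  have hfin : ∀ᵐ x, g' x ≠ ⊤ := by
    have := ae_lt_top (hg'm.pow_const 2) (hint ▸ hgt)
    filter_upwards [this] with x hx h
    rw [h] at hx
    simp at hx
  have hsq : ∫⁻ x, ‖((g' x).toReal : ℂ)‖ₑ ^ 2 = ∫⁻ x, g' x ^ 2 := by
    refine lintegral_congr_ae ?_
    filter_upwards [hfin] with x hx
    rw [← ofReal_norm_eq_enorm, Complex.norm_real, Real.norm_eq_abs,
      abs_of_nonneg ENNReal.toReal_nonneg, ENNReal.ofReal_toReal hx]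
  have hmem : MemLp (fun x => ((g' x).toReal : ℂ)) 2 volume := by
    refine ⟨(Complex.measurable_ofReal.comp hg'm.ennreal_toReal).aestronglyMeasurable, ?_⟩
    have : eLpNorm (fun x => ((g' x).toReal : ℂ)) 2 volume ^ 2 < ⊤ := by
      rw [eLpNorm_two_sq, hsq, ← hint]
      exact lt_top_iff_ne_top.2 hgt
    exact (ENNReal.pow_lt_top_iff.1 this).resolve_right (by norm_num)
  have hρ : ∀ j, 0 < (![R, κ, κ] : Fin 3 → ℝ) j := scale_pos hR hκ
  have hR' : ∀ k : ℕ, 0 < (2⁻¹ : ℝ) ^ k * R := fun k => by positivity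
  have hκ' : ∀ k : ℕ, 0 < (2⁻¹ : ℝ) ^ k * κ := fun k => by positivity
  have hscale : ∀ k : ℕ, (fun j => (2⁻¹ : ℝ) ^ k * (![R, κ, κ] : Fin 3 → ℝ) j) =
      ![(2⁻¹ : ℝ) ^ k * R, (2⁻¹ : ℝ) ^ k * κ, (2⁻¹ : ℝ) ^ k * κ] := fun k => by
    funext j; fin_cases j <;> rfl
  set Mx : ℕ → E3 → ℝ≥0∞ := fun k x => ⨆ i ∈ Finset.range (2 ^ J + 1),
    lconv g' (gaussWeight (frameBasis e (netPoint a b J i))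
      ![(2⁻¹ : ℝ) ^ k * R, (2⁻¹ : ℝ) ^ k * κ, (2⁻¹ : ℝ) ^ k * κ]) x with hMx
  have hMm : ∀ k, Measurable (Mx k) := fun k =>
    Measurable.biSup ((Finset.range (2 ^ J + 1) : Finset ℕ) : Set ℕ) (Finset.countable_toSet _)
      fun i _ => measurable_lconv hg'm (gaussWeight_continuous _ _)
  have hMsq : ∀ k, ∫⁻ x, Mx k x ^ 2 ≤
      (J + 2 : ℕ) * (1 + (J + 1 : ℕ) * V) * ∫⁻ x, g' x ^ 2 := by
    intro k
    refine le_trans (lintegral_mono fun x => ?_) ((hV J _ _ (hR' k) (hκ' k) _ hmem).trans_eq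
      (by rw [hsq]))
    refine biSup_sq_le fun i hi => ?_
    rw [lconv_gaussWeight_eq _ (scale_pos (hR' k) (hκ' k)) hmem hfin x]
    exact le_iSup₂ (f := fun i (_ : i ∈ Finset.range (2 ^ J + 1)) => ‖sconv (plateKernel
      (frameBasis e (netPoint a b J i)) ![(2⁻¹ : ℝ) ^ k * R, (2⁻¹ : ℝ) ^ k * κ, (2⁻¹ : ℝ) ^ k * κ]
      (scale_pos (hR' k) (hκ' k)) gaussian) (fun x => ((g' x).toReal : ℂ)) x‖ₑ ^ 2) i hi
  refine ⟨fun x => ∑' k, wt k * Mx k x, Measurable.tsum fun k => (hMm k).const_mul _,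
    fun x => ?_, ?_⟩
  · rw [nikodymMax_congr_ae hae]
    refine nikodymMax_le hF.orthonormal fun s hs => ?_
    obtain ⟨i, hi, hsi⟩ := exists_netPoint_near hab hs J
    have ht := netPoint_mem hab.le hi
    set t := netPoint a b J i with htd
    have hratio : ∀ l j : Fin 3, (![R, κ, κ] : Fin 3 → ℝ) j ≤ 2 ^ J * (![R, κ, κ] : Fin 3 → ℝ) l := by
      have hJ1 : (1 : ℝ) ≤ 2 ^ J := one_le_pow₀ one_le_two
      have h1 := le_mul_of_one_le_left hR.le hJ1
      have h2 := le_mul_of_one_le_left hκ.le hJ1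
      intro l j
      fin_cases l <;> fin_cases j <;> assumption
    have hgauge : ∀ y, gauge3 (frameBasis e t) ![R, κ, κ] y ≤
        A * gauge3 (frameBasis e s) ![R, κ, κ] y := by
      refine hF.gauge3_le ht hs hρ fun l j => ?_
      rw [abs_sub_comm]
      calc (![R, κ, κ] : Fin 3 → ℝ) j * |s - t|
          ≤ (2 ^ J * (![R, κ, κ] : Fin 3 → ℝ) l) * ((b - a) / 2 ^ J) :=
            mul_le_mul (hratio l j) hsi (abs_nonneg _) (mul_nonneg (by positivity) (hρ l).le)
        _ = _ := by field_simp
    -- The dilation index k depends on y, which the sum over all k hides; the net point t does not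
    -- depend on y.
    have hpt : ∀ y, ENNReal.ofReal (frameWeight (frameBasis e s) ![R, κ, κ] y) ≤
        ∑' k, wt k * ENNReal.ofReal (gaussWeight (frameBasis e t)
          ![(2⁻¹ : ℝ) ^ k * R, (2⁻¹ : ℝ) ^ k * κ, (2⁻¹ : ℝ) ^ k * κ] y) := by
      intro y
      obtain ⟨k, hk⟩ := exists_frameWeight_le_gaussWeight (frameBasis e t) hρ y
      rw [hscale] at hk
      refine le_trans ?_ (ENNReal.le_tsum k)
      have h4 : (4⁻¹ : ℝ≥0∞) ^ k = ENNReal.ofReal ((4⁻¹ : ℝ) ^ k) := by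
        rw [ENNReal.ofReal_pow (by norm_num), ENNReal.ofReal_inv_of_pos (by norm_num),
          ENNReal.ofReal_ofNat]
      rw [hwt]
      simp only
      rw [h4, ← ENNReal.ofReal_mul hD0, ← ENNReal.ofReal_mul (by positivity)]
      refine ENNReal.ofReal_le_ofReal ((frameWeight_le_of_gauge3_le hρ hA (hgauge y)).trans ?_)
      rw [hD, mul_assoc, mul_assoc]
      exact mul_le_mul_of_nonneg_left hk (by positivity)
    calc lconv g' (frameWeight (frameBasis e s) ![R, κ, κ]) x
        ≤ ∫⁻ y, ∑' k, wt k * (g' (x - y) * ENNReal.ofReal (gaussWeight (frameBasis e t)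
          ![(2⁻¹ : ℝ) ^ k * R, (2⁻¹ : ℝ) ^ k * κ, (2⁻¹ : ℝ) ^ k * κ] y)) := by
          refine lintegral_mono fun y => (mul_le_mul_right (hpt y) _).trans_eq ?_
          rw [← ENNReal.tsum_mul_left]
          exact tsum_congr fun k => mul_left_comm _ _ _
      _ = ∑' k, wt k * lconv g' (gaussWeight (frameBasis e t)
          ![(2⁻¹ : ℝ) ^ k * R, (2⁻¹ : ℝ) ^ k * κ, (2⁻¹ : ℝ) ^ k * κ]) x := by
          have hmk : ∀ k : ℕ, Measurable fun y => g' (x - y) * ENNReal.ofReal (gaussWeight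
              (frameBasis e t) ![(2⁻¹ : ℝ) ^ k * R, (2⁻¹ : ℝ) ^ k * κ, (2⁻¹ : ℝ) ^ k * κ] y) :=
            fun k => (hg'm.comp (measurable_const.sub measurable_id)).mul
              (gaussWeight_continuous _ _).measurable.ennreal_ofReal
          rw [lintegral_tsum fun k => ((hmk k).const_mul _).aemeasurable]
          exact tsum_congr fun k => lintegral_const_mul _ (hmk k)
      _ ≤ _ := by
          refine ENNReal.tsum_le_tsum fun k => mul_le_mul_right ?_ _
          exact le_iSup₂ (f := fun i (_ : i ∈ Finset.range (2 ^ J + 1)) => lconv g' (gaussWeight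
            (frameBasis e (netPoint a b J i))
            ![(2⁻¹ : ℝ) ^ k * R, (2⁻¹ : ℝ) ^ k * κ, (2⁻¹ : ℝ) ^ k * κ]) x) i
            (Finset.mem_range.2 (Nat.lt_succ_iff.2 hi))
  · refine (lintegral_tsum_sq_le hMm hMsq).trans ?_
    rw [← hint, ← mul_assoc]
    refine mul_le_mul_left ?_ _
    calc (∑' k, wt k) ^ 2 * ((J + 2 : ℕ) * (1 + (J + 1 : ℕ) * V))
        ≤ (∑' k, wt k) ^ 2 * ((J + 2 : ℕ) * ((J + 2 : ℕ) + (J + 2 : ℕ) * V)) := by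
          gcongr
          · exact_mod_cast (by omega : 1 ≤ J + 2)
          · omega
      _ = (∑' k, wt k) ^ 2 * (1 + V) * (J + 2 : ℕ) ^ 2 := by ring
      _ ≤ _ := by gcongr; exact le_add_self

end

/-- `T` is bounded on `L²` with constant `√B`, in the sense of measurable majorants. -/
def HasSqBound (T : (E3 → ℝ≥0∞) → E3 → ℝ≥0∞) (B : ℝ≥0∞) : Prop :=
  ∀ g : E3 → ℝ≥0∞, AEMeasurable g volume → ∃ G : E3 → ℝ≥0∞, Measurable G ∧ (∀ x, T g x ≤ G x) ∧
    ∫⁻ x, G x ^ 2 ≤ B * ∫⁻ x, g x ^ 2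

theorem HasSqBound.nikodymMax_comp {I : Set ℝ} {e : Fin 3 → ℝ → E3} {ρ : Fin 3 → ℝ}
    {T : (E3 → ℝ≥0∞) → E3 → ℝ≥0∞} {B B' : ℝ≥0∞} (h : HasSqBound (nikodymMax I e ρ) B)
    (hT : HasSqBound T B') : HasSqBound (nikodymMax I e ρ ∘ T) (B * B') := by
  intro g hg
  obtain ⟨G, hG, hle, hint⟩ := hT g hg
  obtain ⟨G', hG', hle', hint'⟩ := h G hG.aemeasurable
  refine ⟨G', hG', fun x => (nikodymMax_mono hle x).trans (hle' x), hint'.trans ?_⟩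
  rw [mul_assoc]
  gcongr

/-- N_* contributes one factor and each of the M levels two. -/
theorem HasSqBound.nikodymIter {I : Set ℝ} {e : Fin 3 → ℝ → E3} {r K : ℝ} {B : ℝ≥0∞} {M : ℕ}
    (h₀ : HasSqBound (nikodymMax I e ![r, 1, 1]) B)
    (h : ∀ m < M, HasSqBound (nikodymMax I e (nikodymScale r K m)) B) :
    HasSqBound (nikodymIter I e r K M) (B ^ (2 * M + 1)) := by
  induction M with
  | zero => simpa [_root_.nikodymIter] using h₀
  | succ M ih =>
    have h1 := h M (Nat.lt_succ_self M)
    have h2 := h1.nikodymMax_comp (h1.nikodymMax_comp (ih fun m hm => h m (hm.trans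
      (Nat.lt_succ_self M))))
    rw [show B ^ (2 * (M + 1) + 1) = B * (B * B ^ (2 * M + 1)) by ring]
    exact h2

theorem HasSqBound.eLpNorm_le {T : (E3 → ℝ≥0∞) → E3 → ℝ≥0∞} {B : ℝ≥0∞} (h : HasSqBound T (B ^ 2))
    {g : E3 → ℝ≥0∞} (hg : AEMeasurable g volume) :
    eLpNorm (T g) 2 volume ≤ B * eLpNorm g 2 volume := by
  obtain ⟨G, hG, hle, hint⟩ := h g hg
  have h1 : eLpNorm (T g) 2 volume ≤ eLpNorm G 2 volume :=
    eLpNorm_mono_enorm fun x => by simpa using hle x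
  refine h1.trans ((ENNReal.pow_le_pow_left_iff two_ne_zero).1 ?_)
  rw [mul_pow, eLpNorm_two_sq, eLpNorm_two_sq]
  simpa using hint

/-- The `L²` bound for the composed maximal operator. -/
theorem exists_eLpNorm_forwardMax_le {a b : ℝ} (hab : a < b) {γ : ℝ → E3}
    (hγ : ContDiffOn ℝ ∞ γ (Icc a b)) (hnd : NonDegenerateCurve γ (Icc a b)) {ε : ℝ} (hε : 0 < ε)
    {ε₀ : ℝ} (hε₀ : 0 < ε₀) : ∃ C : ℝ, 0 < C ∧ ∀ r : ℝ, 0 < r → r < 1 →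
      ∀ g : E3 → ℝ≥0∞, AEMeasurable g volume →
        eLpNorm (forwardMax γ (Icc a b) r ε g) 2 volume ≤
          ENNReal.ofReal (C * r ^ (-ε₀)) * eLpNorm g 2 volume := by
  obtain ⟨α, τ, c, L, hF⟩ := exists_frenetBounds hab hγ hnd
  obtain ⟨B, hBt, hB⟩ := hF.exists_nikodymMax_le hab
  obtain ⟨M, hM⟩ : ∃ M : ℕ, M = ⌊8 / ε⌋₊ - 1 := ⟨_, rfl⟩
  -- Q = r^{-p} = r⁻¹K^{M+1} dominates all ratios between the scales of the operators in the
  -- composition, and J is its binary logarithm rounded up.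
  set p : ℝ := 1 + ε / 8 * (M + 1) with hp
  have hp0 : 0 < p := by positivity
  -- There are 2M + 2 operators, each with L² norm of order J, so each logarithm may cost r^{-δ}.
  set δ : ℝ := ε₀ / (2 * M + 2) with hδ
  have hδ0 : 0 < δ := by positivity
  have hlog2 : 0 < Real.log 2 := Real.log_pos one_lt_two
  obtain ⟨E, hE⟩ : ∃ E : ℝ, E = p / (δ * Real.log 2) + 3 := ⟨_, rfl⟩
  have hE0 : 0 < E := by rw [hE]; positivity
  refine ⟨(B.toReal + 1) ^ (M + 1) * E ^ (2 * M + 2), by positivity, fun r hr hr1 g hg => ?_⟩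
  set K : ℝ := r ^ (-(ε / 8)) with hK
  have hK1 : 1 ≤ K := one_le_rpow_neg hr hr1 hε
  have hK0 : 0 < K := by linarith
  set Q : ℝ := r ^ (-p) with hQ
  have hQ0 : 0 < Q := Real.rpow_pos_of_pos hr _
  have hQr : 1 ≤ Q * r := by
    have : Q * r = r ^ (-p + 1) := by rw [Real.rpow_add_one hr.ne']
    rw [this]
    refine Real.one_le_rpow_of_pos_of_le_one_of_nonpos hr hr1.le ?_
    have : 0 ≤ ε / 8 * (M + 1) := by positivity
    linarith
  have hKQ : K ^ (M + 1) ≤ Q := by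
    rw [hK, ← Real.rpow_natCast, ← Real.rpow_mul hr.le]
    refine Real.rpow_le_rpow_of_exponent_ge hr hr1.le ?_
    push_cast
    linarith
  set J : ℕ := ⌈Real.logb 2 Q⌉₊ with hJ
  have hJQ : Q ≤ 2 ^ J := by
    calc Q = 2 ^ Real.logb 2 Q := (Real.rpow_logb two_pos (by norm_num) hQ0).symm
      _ ≤ (2 : ℝ) ^ (J : ℝ) := Real.rpow_le_rpow_of_exponent_le one_le_two (Nat.le_ceil _)
      _ = 2 ^ J := Real.rpow_natCast _ _
  have hJr : 1 ≤ 2 ^ J * r := hQr.trans (mul_le_mul_of_nonneg_right hJQ hr.le)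
  have hrδ : 1 ≤ r ^ (-δ) := Real.one_le_rpow_of_pos_of_le_one_of_nonpos hr hr1.le (by linarith)
  -- A logarithm of r⁻¹ is at most r^{-δ}/δ. The 3 in E is the 2 here plus the 1 lost to the
  -- ceiling.
  have hJE : ((J + 2 : ℕ) : ℝ) ≤ E * r ^ (-δ) := by
    have h1 : Real.logb 2 Q = p * Real.log r⁻¹ / Real.log 2 := by
      rw [Real.logb, hQ, Real.log_rpow hr, Real.log_inv]; ring
    have h2 : Real.log r⁻¹ ≤ r ^ (-δ) / δ := by
      have := Real.log_le_rpow_div (inv_pos.2 hr).le hδ0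
      rwa [Real.inv_rpow hr.le, ← Real.rpow_neg hr.le] at this
    have h3 : 0 ≤ Real.logb 2 Q := by
      rw [h1]
      have : 0 ≤ Real.log r⁻¹ := Real.log_nonneg ((one_le_inv₀ hr).2 hr1.le)
      positivity
    have h4 := Nat.ceil_lt_add_one h3
    have h5 : Real.logb 2 Q ≤ p / (δ * Real.log 2) * r ^ (-δ) := by
      rw [h1]
      calc p * Real.log r⁻¹ / Real.log 2 ≤ p * (r ^ (-δ) / δ) / Real.log 2 := by gcongr
        _ = _ := by field_simp
    push_cast
    rw [hE]
    nlinarith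
  set X : ℝ≥0∞ := B * (J + 2 : ℕ) ^ 2 with hX
  have hstar : HasSqBound (nikodymMax (Icc a b) (frenet γ (Icc a b)) ![r, 1, 1]) X := by
    refine hB J r 1 hr one_pos ?_ hJr
    rw [mul_one]
    exact hr1.le.trans (one_le_pow₀ one_le_two)
  have hscale : ∀ m ≤ M, HasSqBound (nikodymMax (Icc a b) (frenet γ (Icc a b))
      (nikodymScale r K m)) X := by
    intro m hm
    have hKm : K ^ (m + 1) ≤ K ^ (M + 1) := pow_le_pow_right₀ hK1 (by omega)
    refine hB J (K ^ m * r) K⁻¹ (by positivity) (by positivity) ?_ ?_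
    · rw [← div_eq_mul_inv, le_div_iff₀ hK0]
      calc K ^ m * r * K = K ^ (m + 1) * r := by ring
        _ ≤ K ^ (m + 1) * 1 := by gcongr
        _ ≤ 2 ^ J := by linarith
    · rw [← one_div, div_le_iff₀ hK0]
      calc (1 : ℝ) ≤ 2 ^ J * r * 1 := by linarith
        _ ≤ 2 ^ J * r * K ^ (m + 1) := by gcongr; exact one_le_pow₀ hK1
        _ = _ := by ring
  have hall : HasSqBound (forwardMax γ (Icc a b) r ε) ((X ^ (M + 1)) ^ 2) := by
    have := (hscale M le_rfl).nikodymMax_comp (hstar.nikodymIter fun m hm => hscale m hm.le)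
    rw [show X * X ^ (2 * M + 1) = (X ^ (M + 1)) ^ 2 by ring] at this
    rw [hM] at this ⊢
    exact this
  refine (hall.eLpNorm_le hg).trans (mul_le_mul_left ?_ _)
  have hBle : B ≤ ENNReal.ofReal (B.toReal + 1) := by
    rw [← ENNReal.ofReal_toReal hBt, ENNReal.toReal_ofReal ENNReal.toReal_nonneg]
    exact ENNReal.ofReal_le_ofReal (by linarith)
  have hXle : X ≤ ENNReal.ofReal ((B.toReal + 1) * (E * r ^ (-δ)) ^ 2) := by
    rw [ENNReal.ofReal_mul (by positivity), ENNReal.ofReal_pow (by positivity)]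
    refine mul_le_mul' hBle (pow_le_pow_left' ?_ 2)
    rw [← ENNReal.ofReal_natCast]
    exact ENNReal.ofReal_le_ofReal hJE
  refine (pow_le_pow_left' hXle (M + 1)).trans ?_
  rw [← ENNReal.ofReal_pow (by positivity)]
  refine ENNReal.ofReal_le_ofReal (le_of_eq ?_)
  have hfin : (r ^ (-δ)) ^ (2 * M + 2) = r ^ (-ε₀) := by
    rw [← Real.rpow_natCast, ← Real.rpow_mul hr.le]
    congr 1
    rw [hδ]
    push_cast
    field_simp
  rw [← hfin]
  generalize B.toReal + 1 = t
  ring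

end

theorem mainTheorem6 (a b : ℝ) (hab : a < b) (γ : ℝ → E3)
    (hγ : ContDiffOn ℝ ∞ γ (Icc a b)) (hnd : NonDegenerateCurve γ (Icc a b))
    (η : ℝ → ℝ) (hη : IsCutoff η) (ε : ℝ) (hε : 0 < ε) :
    (∃ C : ℝ, 0 < C ∧ ∀ r : ℝ, 0 < r → r < 1 →
      ∀ P : FrenetBoxDecomposition γ (Icc a b) r,
      ∀ f : Lp ℂ 2 (volume : Measure E3),
      ∀ w : E3 → ℝ, LocallyIntegrable w volume → (∀ x, 0 ≤ w x) →
        ∫⁻ x, (∑' s : P.points, ‖multiplierOp (P.cutoff η s) f x‖ₑ ^ 2) *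
            ENNReal.ofReal (w x) ≤
          ENNReal.ofReal (C * r ^ (-ε)) *
            ∫⁻ x, ‖f x‖ₑ ^ 2 *
              forwardMax γ (Icc a b) r ε (fun z => ENNReal.ofReal (w z)) x) ∧
    (∀ ε₀ : ℝ, 0 < ε₀ → ∃ C : ℝ, 0 < C ∧ ∀ r : ℝ, 0 < r → r < 1 →
      ∀ g : E3 → ℝ≥0∞, AEMeasurable g volume →
        eLpNorm (forwardMax γ (Icc a b) r ε g) 2 volume ≤
          ENNReal.ofReal (C * r ^ (-ε₀)) * eLpNorm g 2 volume) := by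
  exact ⟨exists_lintegral_boxes_le hab hγ hnd hη hε,
    fun _ hε₀ => exists_eLpNorm_forwardMax_le hab hγ hnd hε hε₀⟩
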